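/- Let $M$ be a smooth surface and $U$ a smooth one-dimensional manifold. Consider the problem of minimizing $\int\varphi(q,u)\,dt$ along the trajectories of $\dot q=f(q,u)$, $q\in M$, $u\in U$, with $f,\varphi$ smooth, under the regularity assumptions $f\wedge\partial_u f\neq0$ and $\partial_u f\wedge\partial_u^2f\neq 0$ on $M\times U$. Let $h(\lambda)=\max_{u\in U}\big(\langle\lambda,f(q,u)\rangle-\varphi(q,u)\big)$, $\lambda\in T^*_qM$, be the maximized Hamiltonian, fix $e\in\mathbb R$, put $\mathcal H=h^{-1}(e)$, $\mathcal H_q=\mathcal H\cap T_q^*M$, and assume that near $\mathcal H$ the maximum is attained and $h$ is smooth. Let $s=p\,dq$ be the Liouville form, $\sigma=ds$, and let $\vec h$ be the Hamiltonian field, $\sigma(\cdot,\vec h)=dh$. Locally on $\mathcal H$ let $v$ be the nowhere vanishing vertical vector field, unique up to sign, such that $L_v^2s=-s+b\,L_vs$ on $\mathcal H$ for a smooth function $b$. The curvature $\kappa$ is the function on $\mathcal H$ defined by $[\vec h,[v,\vec h]]=\kappa v$. It is defined on all of $\mathcal H$ if the problem is time-optimal, i.e. $\varphi\equiv c$ is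 constant, with $e+c>0$. Let $\lambda:[0,+\infty[\,\to\mathcal H$ be an extremal (a trajectory of $\vec h$), $q(t)=\pi(\lambda(t))$, $q_0=q(0)$, where $\pi:T^*M\to M$ is the projection. Assume either that $\varphi\equiv c$ is constant with $e+c>0$, or that the curvature is defined at all points $\lambda(t)$, $t\ge0$; let $\kappa_t=\kappa(\lambda(t))$. A time $t>0$ is called conjugate (to $0$ along $\lambda$) if $(t,\lambda(0))$ is a critical point of the map $(\tau,\mu)\mapsto\pi(e^{\tau\vec h}(\mu))$, defined for $\mu\in\mathcal H_{q_0}$ near $\lambda(0)$. (i) If $\kappa_t\le0$ for all $t\ge0$, there are no conjugate times in $[0,+\infty[$. (ii) If $\kappa_1>0$ and $\kappa_t\le\kappa_1$ (resp. $\kappa_t<\kappa_1$) for all $t\ge0$, there are no conjugate times in $[0,\pi/\sqrt{\kappa_1}[$ (resp. in $[0,\pi/\sqrt{\kappa_1}]$). (iii) If $\kappa_0>0$ and $\kappa_0\le\kappa_t$ (resp. $\kappa_0<\kappa_t$) for all $t\ge0$, there is at least one conjugate time in $]0,\pi/\sqrt{\kappa_0}]$ (resp. in $]0,\pi/\sqrt{\kappa_0}[$).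 -/

import Mathlib

open Set Bundle Topology
open scoped Manifold ContDiff

noncomputable section

/-! ### Exterior derivative and Lie derivative of one-forms on a manifold -/

section OneForms

variable {E : Type*} [NormedAddCommGroup E] [NormedSpace ℝ E]
  {H : Type*} [TopologicalSpace H] (I : ModelWithCorners ℝ E H) [I.Boundaryless]
  {N : Type*} [TopologicalSpace N] [ChartedSpace H N]

/-- The exterior derivative of a one-form `α` at `x`, computed in the preferred chart at `x`:
`dα(X, Y) = (D_X α)(Y) - (D_Y α)(X)`. -/
def extD (α : ∀ x : N, TangentSpace I x →L[ℝ] ℝ) (x : N) (X : TangentSpace I x) :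
    TangentSpace I x →L[ℝ] ℝ :=
  let a : E → E →L[ℝ] ℝ := fun y =>
    (α ((extChartAt I x).symm y)).comp (mfderiv 𝓘(ℝ, E) I (extChartAt I x).symm y)
  let A : TangentSpace I x →L[ℝ] E := mfderiv I 𝓘(ℝ, E) (extChartAt I x) x
  (fderiv ℝ a (extChartAt I x x) (A X) -
    (fderiv ℝ a (extChartAt I x x)).flip (A X)).comp A

/-- The Lie derivative `L_v α = i_v dα + d(α(v))` of a one-form. -/
def lieD (v : ∀ x : N, TangentSpace I x) (α : ∀ x : N, TangentSpace I x →L[ℝ] ℝ) (x : N) :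
    TangentSpace I x →L[ℝ] ℝ :=
  let dαv : TangentSpace I x →L[ℝ] ℝ := mfderiv I 𝓘(ℝ, ℝ) (fun y => α y (v y)) x
  extD I α x (v x) + dαv

end OneForms

/-! ### The cotangent bundle of a surface -/

/-- The model space of a surface. -/
abbrev E2 : Type := EuclideanSpace ℝ (Fin 2)

/-- The cotangent bundle `T*M` of a surface `M`; a point is `λ = ⟨q, p⟩` with `p ∈ T*_q M`. -/
abbrev CoT (M : Type*) [TopologicalSpace M] [ChartedSpace E2 M] : Type _ :=
  TotalSpace (E2 →L[ℝ] ℝ) (fun q : M => TangentSpace 𝓘(ℝ, E2) q →L[ℝ] Trivial M ℝ q)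

/-- The model with corners of `T*M`. -/
abbrev ICoT : ModelWithCorners ℝ (E2 × (E2 →L[ℝ] ℝ)) (ModelProd E2 (E2 →L[ℝ] ℝ)) :=
  𝓘(ℝ, E2).prod 𝓘(ℝ, E2 →L[ℝ] ℝ)

section Cotangent

variable {M : Type*} [TopologicalSpace M] [ChartedSpace E2 M] [IsManifold 𝓘(ℝ, E2) ∞ M]

/-- The canonical projection `π : T*M → M`. -/
def proj (μ : CoT M) : M := μ.1

/-- The differential of the canonical projection. -/
def dproj (μ : CoT M) : TangentSpace ICoT μ →L[ℝ] TangentSpace 𝓘(ℝ, E2) μ.1 :=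
  mfderiv ICoT 𝓘(ℝ, E2) (proj (M := M)) μ

/-- The Liouville one-form `s = p dq`: `s_μ(w) = ⟨μ, dπ w⟩`. -/
def liouville (μ : CoT M) : TangentSpace ICoT μ →L[ℝ] ℝ :=
  (show TangentSpace 𝓘(ℝ, E2) μ.1 →L[ℝ] ℝ from μ.2).comp (dproj μ)

/-- The canonical symplectic form `σ = ds`. -/
def symplecticForm (μ : CoT M) (X Y : TangentSpace ICoT μ) : ℝ :=
  extD ICoT liouville μ X Y

/-- The differential of a function on `T*M`. -/
def dfun (h : CoT M → ℝ) (μ : CoT M) : TangentSpace ICoT μ →L[ℝ] ℝ :=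
  mfderiv ICoT 𝓘(ℝ, ℝ) h μ

/-- The Hamiltonian vector field of `h`: the solution `X` of `σ(·, X) = dh`. -/
def hamField (h : CoT M → ℝ) (μ : CoT M) : TangentSpace ICoT μ :=
  Function.invFun
    (fun (X : TangentSpace ICoT μ) (w : TangentSpace ICoT μ) => symplecticForm μ w X)
    (fun w => dfun h μ w)

end Cotangent

/-! ### Two-dimensional optimal control problems with scalar input -/

/-- A smooth control system `q' = f(q, u)` on a surface `M` with one-dimensional control set `U`,
together with a smooth running cost `φ(q, u)`. -/
structure ControlProblem (M U : Type*) [TopologicalSpace M] [ChartedSpace E2 M]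
    [IsManifold 𝓘(ℝ, E2) ∞ M] [TopologicalSpace U] [ChartedSpace ℝ U]
    [IsManifold 𝓘(ℝ, ℝ) ∞ U] where
  /-- the dynamics -/
  f : ∀ q : M, U → TangentSpace 𝓘(ℝ, E2) q
  /-- the running cost -/
  cost : M → U → ℝ
  smooth_f : ContMDiff (𝓘(ℝ, E2).prod 𝓘(ℝ, ℝ)) 𝓘(ℝ, E2).tangent ∞
    (fun x : M × U => (⟨x.1, f x.1 x.2⟩ : TangentBundle 𝓘(ℝ, E2) M))
  smooth_cost : ContMDiff (𝓘(ℝ, E2).prod 𝓘(ℝ, ℝ)) 𝓘(ℝ, ℝ) ∞ (fun x : M × U => cost x.1 x.2)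

namespace ControlProblem

variable {M U : Type*} [TopologicalSpace M] [ChartedSpace E2 M] [IsManifold 𝓘(ℝ, E2) ∞ M]
  [TopologicalSpace U] [ChartedSpace ℝ U] [IsManifold 𝓘(ℝ, ℝ) ∞ U] (P : ControlProblem M U)

/-- `x ↦ f(q, u(x))`, where `x` is the coordinate on `U` given by the preferred chart at `u`. -/
def fCoord (q : M) (u : U) (x : ℝ) : E2 := P.f q ((chartAt ℝ u).symm x)

/-- The partial derivative `∂f/∂u`, as a vector of `T_q M`. -/
def fu (q : M) (u : U) : E2 := deriv (P.fCoord q u) (chartAt ℝ u u)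

/-- The second partial derivative `∂²f/∂u²`, as a vector of `T_q M`. -/
def fuu (q : M) (u : U) : E2 := deriv (deriv (P.fCoord q u)) (chartAt ℝ u u)

/-- The regularity assumptions `f ∧ f_u ≠ 0` and `f_u ∧ f_uu ≠ 0`. The sign of the second bivector
depends on the orientations of `T_q M` and of `U`, so only its non-vanishing, which is independent
of the coordinates, is required. -/
def IsRegular : Prop :=
  ∀ (q : M) (u : U), LinearIndependent ℝ ![(P.f q u : E2), P.fu q u] ∧
    LinearIndependent ℝ ![P.fu q u, P.fuu q u]

/-- `⟨μ, f(q, u)⟩ - φ(q, u)` for `μ ∈ T*_q M`. -/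
def preHam (μ : CoT M) (u : U) : ℝ := μ.2 (P.f μ.1 u) - P.cost μ.1 u

/-- The maximized Hamiltonian `h(μ) = max_u (⟨μ, f(q, u)⟩ - φ(q, u))`. -/
def ham (μ : CoT M) : ℝ := ⨆ u : U, P.preHam μ u

/-- The level set `h⁻¹(e)`: the covectors at which the maximum is attained and equals `e`. -/
def level (e : ℝ) : Set (CoT M) := {μ | IsGreatest (range (P.preHam μ)) e}

/-- The maximized Hamiltonian is a smooth function around the level `h⁻¹(e)`: there the maximum
is attained and depends smoothly on the covector. -/
def HamSmoothNear (e : ℝ) : Prop :=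
  ∃ D : Set (CoT M), IsOpen D ∧ P.level e ⊆ D ∧
    (∀ μ ∈ D, ∃ u : U, IsMaxOn (P.preHam μ) univ u) ∧ ContMDiffOn ICoT 𝓘(ℝ, ℝ) ∞ P.ham D

/-- The Hamiltonian vector field of the maximized Hamiltonian. -/
def hVec (μ : CoT M) : TangentSpace ICoT μ := hamField P.ham μ

/-- An extremal on `[0, +∞)` in the level `h⁻¹(e)`: a trajectory of the Hamiltonian field. -/
def IsExtremal (e : ℝ) (l : ℝ → CoT M) : Prop :=
  IsMIntegralCurveOn l P.hVec (Ici 0) ∧ ∀ t, 0 ≤ t → l t ∈ P.level e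

/-- `v` is, on the part of `h⁻¹(e)` in the open set `N`, the vertical field of the natural
parameter of the curves `h⁻¹(e) ∩ T*_q M`: it is smooth, vertical, tangent to the levels of `h`,
nowhere zero and satisfies `L_v² s = -s + b L_v s` on `h⁻¹(e)` with a smooth function `b`.
It is determined up to sign; brackets and Lie derivatives at points of `h⁻¹(e)` do not depend on
how `v` is extended off `h⁻¹(e)`. -/
def IsNaturalField (e : ℝ) (N : Set (CoT M)) (v : ∀ μ : CoT M, TangentSpace ICoT μ) : Prop :=
  ContMDiffOn ICoT ICoT.tangent ∞ (fun μ => (⟨μ, v μ⟩ : TangentBundle ICoT (CoT M))) N ∧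
  (∀ μ ∈ N, dproj μ (v μ) = 0 ∧ dfun P.ham μ (v μ) = 0 ∧ v μ ≠ 0) ∧
  ∃ b : CoT M → ℝ, ContMDiffOn ICoT 𝓘(ℝ, ℝ) ∞ b N ∧
    ∀ μ ∈ N ∩ P.level e, ∀ w : TangentSpace ICoT μ, dfun P.ham μ w = 0 →
      lieD ICoT v (lieD ICoT v liouville) μ w =
        -liouville μ w + b μ * lieD ICoT v liouville μ w

/-- `k` is the coefficient at `μ` in the commutator relation `[h, [v, h]] = k v`, where `h` stands
for the Hamiltonian field and `v` for the natural vertical field on `h⁻¹(e)` near `μ`. -/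
def IsCurvatureAt (e : ℝ) (μ : CoT M) (k : ℝ) : Prop :=
  ∃ N : Set (CoT M), IsOpen N ∧ μ ∈ N ∧ ∃ v : ∀ μ : CoT M, TangentSpace ICoT μ,
    P.IsNaturalField e N v ∧
    VectorField.mlieBracket ICoT P.hVec (VectorField.mlieBracket ICoT v P.hVec) μ = k • v μ

/-- The control curvature at a point of the level `h⁻¹(e)`. -/
def curvature (e : ℝ) (μ : CoT M) : ℝ := Classical.epsilon (P.IsCurvatureAt e μ)

/-- The time `t > 0` is conjugate to `0` along the extremal `l`. Here `ε ↦ Λ (0, ε)` is a regular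
parametrization near `l 0` of the curve `h⁻¹(e) ∩ T*_{q₀} M`, `q₀ = π (l 0)`, and `Λ (τ, ε)` is the
image of `Λ (0, ε)` under the time-`τ` map of the Hamiltonian flow, so that `Λ` parametrizes the
surface swept by that curve under the flow; conjugacy means that `(t, 0)`, i.e. the point `l t`, is
a critical point of the projection of this surface to `M`. -/
def IsConjugateTime (e : ℝ) (l : ℝ → CoT M) (t : ℝ) : Prop :=
  0 < t ∧ ∃ δ : ℝ, 0 < δ ∧ ∃ Λ : ℝ × ℝ → CoT M,
    ContMDiffOn 𝓘(ℝ, ℝ × ℝ) ICoT 1 Λ (Ioo (-δ) (t + δ) ×ˢ Ioo (-δ) δ) ∧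
    (∀ ε ∈ Ioo (-δ) δ, Λ (0, ε) ∈ P.level e ∧ proj (Λ (0, ε)) = proj (l 0) ∧
      IsMIntegralCurveOn (fun τ => Λ (τ, ε)) P.hVec (Ioo (-δ) (t + δ))) ∧
    (∀ τ ∈ Icc 0 t, Λ (τ, 0) = l τ) ∧
    mfderiv 𝓘(ℝ, ℝ) ICoT (fun ε : ℝ => Λ (0, ε)) 0 ≠ 0 ∧
    ¬ Function.Surjective
      (mfderiv 𝓘(ℝ, ℝ × ℝ) 𝓘(ℝ, E2) (fun x : ℝ × ℝ => proj (Λ x)) (t, 0))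

end ControlProblem

end

/-! Carry a regular parametrization of the curve `h⁻¹(e) ∩ T*_{q₀} M` near `l 0` by the Hamiltonian
flow. This gives a surface `Λ (τ, ε)` (`IsFan`) with `Λ (τ, 0) = l τ`. Put `J = ∂Λ/∂ε` and `y(τ) =
σ(v, J)` along the extremal. The flow preserves `σ` and transports `J`, so differentiating `σ(Y, J)`
along the flow replaces `Y` by `[h, Y]` (`hasDerivAt_omega_variation`). Hence `y'' = σ([h, [h, v]],
J) = -κ y`, by the relation that defines the curvature.

Two facts connect `y` with conjugate times. First, `v` is vertical, that is, a covector, and it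
annihilates the nonzero velocity `π_* h` because `dh(v) = 0`. On a surface the projection of `Λ` is
therefore singular exactly when `v` also annihilates `π_* J`, which means `y = 0`
(`IsFan.surjective_iff`). Second, `J` is vertical at time `0`, so `y(0) = 0`, while `y'(0) = D²h(v,
J)` is nonzero: maximality in `u` and the independence of `f` and `f_u` make `D²h` positive on
nonzero vertical vectors tangent to the level (`legendre_ham`). Conjugate times are thus the
positive zeros of a nontrivial solution of the Jacobi equation, and all bounds follow from Sturm
comparison with `sin (r t)` through the Wronskian.

The field `v` exists only locally and is determined only up to sign (`IsNaturalField.eq_or_eq_neg`),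
so the function that makes sense along the whole extremal is `|y|`. The predicate `IsAbsJacobi` is
formulated for it, and a sign is recovered between zeros in `IsAbsJacobi.hasDerivWithinAt`.

For a constant cost `c` with `e + c > 0` the curvature has to be shown to exist. Then `s(h) = h +
c`, so the flow preserves `s` as well as `σ` and `h`. It follows that `[h, [v, h]]` is annihilated
by `dh`, `s` and `σ(v, ·)`, whose common kernel is the line of `v`
(`exists_lieBracket_lieBracket_eq_smul`).

The computations take place in the canonical charts of `T*M`, where `σ` has constant coefficients
(`symplecticForm_apply_chart`). The surface `Λ` itself requires a flow that is `C¹` in the initial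
point (`exists_contDiffOn_local_flow`) and its continuation along a compact time interval
(`exists_isCurveFamily`). -/

set_option linter.unusedSectionVars false

/-! ### Vector fields and one-forms in a chart -/

section ChartCalculus

variable {E : Type*} [NormedAddCommGroup E] [NormedSpace ℝ E]
  {H : Type*} [TopologicalSpace H] {I : ModelWithCorners ℝ E H} [I.Boundaryless]
  {N : Type*} [TopologicalSpace N] [ChartedSpace H N] [IsManifold I ∞ N]

/-- The differential at `x` of the preferred chart at `x₀`. -/
noncomputable def dChart (I : ModelWithCorners ℝ E H) (x₀ x : N) : TangentSpace I x →L[ℝ] E :=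
  mfderiv I 𝓘(ℝ, E) (extChartAt I x₀) x

/-- The differential at `y` of the inverse of the preferred chart at `x₀`. -/
noncomputable def dChartSymm (I : ModelWithCorners ℝ E H) (x₀ : N) (y : E) :
    E →L[ℝ] TangentSpace I ((extChartAt I x₀).symm y) :=
  mfderiv 𝓘(ℝ, E) I (extChartAt I x₀).symm y

/-- The vector field `X` in the coordinates of the preferred chart at `x₀`. -/
noncomputable def chartField (x₀ : N) (X : ∀ x : N, TangentSpace I x) (y : E) : E :=
  dChart I x₀ ((extChartAt I x₀).symm y) (X ((extChartAt I x₀).symm y))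

theorem contMDiffAt_extChartAt_of_mem {x₀ x : N} (hx : x ∈ (extChartAt I x₀).source) :
    ContMDiffAt I 𝓘(ℝ, E) ∞ (extChartAt I x₀) x := by
  rw [extChartAt_source] at hx
  exact contMDiffAt_extChartAt' hx

theorem mdifferentiableAt_extChartAt_of_mem {x₀ x : N} (hx : x ∈ (extChartAt I x₀).source) :
    MDifferentiableAt I 𝓘(ℝ, E) (extChartAt I x₀) x :=
  (contMDiffAt_extChartAt_of_mem hx).mdifferentiableAt (by simp)

theorem contMDiffAt_extChartAt_symm {x₀ : N} {y : E} (hy : y ∈ (extChartAt I x₀).target) :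
    ContMDiffAt 𝓘(ℝ, E) I ∞ (extChartAt I x₀).symm y :=
  (contMDiffOn_extChartAt_symm x₀).contMDiffAt (extChartAt_target_mem_nhds' hy)

theorem mdifferentiableAt_extChartAt_symm {x₀ : N} {y : E} (hy : y ∈ (extChartAt I x₀).target) :
    MDifferentiableAt 𝓘(ℝ, E) I (extChartAt I x₀).symm y :=
  (contMDiffAt_extChartAt_symm hy).mdifferentiableAt (by simp)

theorem dChart_dChartSymm {x₀ : N} {y : E} (hy : y ∈ (extChartAt I x₀).target) (w : E) :
    dChart I x₀ ((extChartAt I x₀).symm y) (dChartSymm I x₀ y w) = w := by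
  have := mfderiv_extChartAt_comp_mfderivWithin_extChartAt_symm (I := I) hy
  rw [I.range_eq_univ, mfderivWithin_univ] at this
  exact DFunLike.congr_fun this w

theorem mfderiv_symm_dChart {x₀ x : N} (hx : x ∈ (extChartAt I x₀).source)
    (w : TangentSpace I x) :
    mfderiv 𝓘(ℝ, E) I (extChartAt I x₀).symm (extChartAt I x₀ x) (dChart I x₀ x w) = w := by
  have := mfderivWithin_extChartAt_symm_comp_mfderiv_extChartAt' (I := I) hx
  rw [I.range_eq_univ, mfderivWithin_univ] at this
  exact DFunLike.congr_fun this w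

theorem dChartSymm_dChart {x₀ : N} {y : E} (hy : y ∈ (extChartAt I x₀).target)
    (w : TangentSpace I ((extChartAt I x₀).symm y)) :
    dChartSymm I x₀ y (dChart I x₀ ((extChartAt I x₀).symm y) w) = w := by
  have := mfderiv_symm_dChart ((extChartAt I x₀).map_target hy) w
  rw [(extChartAt I x₀).right_inv hy] at this
  exact this

theorem dChart_injective {x₀ x : N} (hx : x ∈ (extChartAt I x₀).source) :
    Function.Injective (dChart I x₀ x) := by
  intro a b hab
  rw [← mfderiv_symm_dChart hx a, hab, mfderiv_symm_dChart hx b]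

theorem dChart_surjective {x₀ x : N} (hx : x ∈ (extChartAt I x₀).source) :
    Function.Surjective (dChart I x₀ x) := by
  obtain ⟨y, hy, rfl⟩ : ∃ y ∈ (extChartAt I x₀).target, (extChartAt I x₀).symm y = x :=
    ⟨_, (extChartAt I x₀).map_source hx, (extChartAt I x₀).left_inv hx⟩
  exact fun w => ⟨_, dChart_dChartSymm hy w⟩

theorem chartField_apply {x₀ x : N} (hx : x ∈ (extChartAt I x₀).source)
    (X : ∀ x : N, TangentSpace I x) :
    chartField x₀ X (extChartAt I x₀ x) = dChart I x₀ x (X x) := by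
  simp only [chartField]
  rw [(extChartAt I x₀).left_inv hx]

theorem dChartSymm_chartField {x₀ : N} {y : E} (hy : y ∈ (extChartAt I x₀).target)
    (X : ∀ x : N, TangentSpace I x) :
    dChartSymm I x₀ y (chartField x₀ X y) = X ((extChartAt I x₀).symm y) :=
  dChartSymm_dChart hy _

/-- Identifies the coordinate expression with a pullback, so that naturality of the Lie bracket
under pullbacks applies to it. -/
theorem chartField_eq_mpullback {x₀ : N} {y : E} (hy : y ∈ (extChartAt I x₀).target)
    (X : ∀ x : N, TangentSpace I x) :
    chartField x₀ X y = VectorField.mpullback 𝓘(ℝ, E) I (extChartAt I x₀).symm X y := by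
  have hinv : (mfderiv 𝓘(ℝ, E) I (extChartAt I x₀).symm y).IsInvertible := by
    have := isInvertible_mfderivWithin_extChartAt_symm (I := I) hy
    rwa [I.range_eq_univ, mfderivWithin_univ] at this
  rw [VectorField.mpullback_apply, ← dChartSymm_chartField hy X]
  generalize chartField x₀ X y = w
  obtain ⟨e, he⟩ := hinv
  have h1 : dChartSymm I x₀ y w = e w := DFunLike.congr_fun he.symm w
  rw [h1, ← he]
  exact (e.symm_apply_apply _).symm.trans
    (DFunLike.congr_fun (ContinuousLinearMap.inverse_equiv e).symm _)

theorem trivializationAt_tangent_snd {x₀ x : N} (hx : x ∈ (extChartAt I x₀).source)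
    (w : TangentSpace I x) :
    (trivializationAt E (TangentSpace I) x₀ ⟨x, w⟩).2 = dChart I x₀ x w := by
  rw [extChartAt_source] at hx
  have h := TangentBundle.continuousLinearMapAt_trivializationAt (I := I) hx
  have h2 : dChart I x₀ x = (trivializationAt E (TangentSpace I) x₀).continuousLinearMapAt ℝ x :=
    h.symm
  rw [h2, Trivialization.continuousLinearMapAt_apply, Trivialization.linearMapAt_apply, if_pos]
  simpa using hx

theorem isOpen_extChartAt_target_inter_preimage (x₀ : N) {D : Set N} (hD : IsOpen D) :
    IsOpen ((extChartAt I x₀).target ∩ (extChartAt I x₀).symm ⁻¹' D) :=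
  (continuousOn_extChartAt_symm x₀).isOpen_inter_preimage (isOpen_extChartAt_target x₀) hD

theorem contDiffOn_chartField (x₀ : N) {X : ∀ x : N, TangentSpace I x} {D : Set N} (hD : IsOpen D)
    (hX : ContMDiffOn I I.tangent ∞ (fun x => (⟨x, X x⟩ : TangentBundle I N)) D) :
    ContDiffOn ℝ ∞ (chartField x₀ X)
      ((extChartAt I x₀).target ∩ (extChartAt I x₀).symm ⁻¹' D) := by
  rw [← contMDiffOn_iff_contDiffOn]
  rintro y ⟨hy, hyD⟩
  apply ContMDiffAt.contMDiffWithinAt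
  have hb : (extChartAt I x₀).symm y ∈ (trivializationAt E (TangentSpace I) x₀).baseSet := by
    simpa using (extChartAt I x₀).map_target hy
  have h1 := (Trivialization.contMDiffAt_section_iff (n := ∞) (IB := I)
    (trivializationAt E (TangentSpace I) x₀) hb).1 ((hX _ hyD).contMDiffAt (hD.mem_nhds hyD))
  refine (h1.comp y (contMDiffAt_extChartAt_symm hy)).congr_of_eventuallyEq ?_
  filter_upwards [extChartAt_target_mem_nhds' hy] with z hz
  exact (trivializationAt_tangent_snd ((extChartAt I x₀).map_target hz) _).symm

theorem contMDiffOn_of_contDiffOn_chartField (x₀ : N) {X : ∀ x : N, TangentSpace I x} {D : Set N}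
    (hD : IsOpen D) (hDs : D ⊆ (extChartAt I x₀).source)
    (hX : ContDiffOn ℝ ∞ (chartField x₀ X)
      ((extChartAt I x₀).target ∩ (extChartAt I x₀).symm ⁻¹' D)) :
    ContMDiffOn I I.tangent ∞ (fun x => (⟨x, X x⟩ : TangentBundle I N)) D := by
  refine (Trivialization.contMDiffOn_section_iff (n := ∞) (IB := I)
    (trivializationAt E (TangentSpace I) x₀) hD ?_).2 ?_
  · intro x hx
    simpa using hDs hx
  · intro x hx
    apply ContMDiffAt.contMDiffWithinAt
    have hy : extChartAt I x₀ x ∈ (extChartAt I x₀).target ∩ (extChartAt I x₀).symm ⁻¹' D := by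
      refine ⟨(extChartAt I x₀).map_source (hDs hx), ?_⟩
      rwa [mem_preimage, (extChartAt I x₀).left_inv (hDs hx)]
    have h1 := (hX.contDiffAt
      ((isOpen_extChartAt_target_inter_preimage x₀ hD).mem_nhds hy)).contMDiffAt
    refine (h1.comp x (contMDiffAt_extChartAt_of_mem (hDs hx))).congr_of_eventuallyEq ?_
    filter_upwards [hD.mem_nhds hx] with z hz
    rw [trivializationAt_tangent_snd (hDs hz)]
    exact (chartField_apply (hDs hz) X).symm

theorem mdifferentiableAt_vectorField {X : ∀ x : N, TangentSpace I x} {D : Set N} (hD : IsOpen D)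
    (hX : ContMDiffOn I I.tangent ∞ (fun x => (⟨x, X x⟩ : TangentBundle I N)) D) {x : N}
    (hx : x ∈ D) :
    MDifferentiableAt I I.tangent (fun x => (⟨x, X x⟩ : TangentBundle I N)) x :=
  ((hX x hx).contMDiffAt (hD.mem_nhds hx)).mdifferentiableAt (by simp)

/-- The bracket commutes with pullback by the inverse chart, and on a vector space the manifold
bracket is the usual one. -/
theorem chartField_mlieBracket [CompleteSpace E] {x₀ : N} {V W : ∀ x : N, TangentSpace I x} {y : E}
    (hy : y ∈ (extChartAt I x₀).target)
    (hV : MDifferentiableAt I I.tangent (fun x => (⟨x, V x⟩ : TangentBundle I N))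
      ((extChartAt I x₀).symm y))
    (hW : MDifferentiableAt I I.tangent (fun x => (⟨x, W x⟩ : TangentBundle I N))
      ((extChartAt I x₀).symm y)) :
    chartField x₀ (VectorField.mlieBracket I V W) y =
      VectorField.lieBracket ℝ (chartField x₀ V) (chartField x₀ W) y := by
  have : IsManifold I (minSmoothness ℝ 2) N := by
    rw [minSmoothness_of_isRCLikeNormedField]; infer_instance
  have h1 := VectorField.mpullback_mlieBracket (n := ∞) hV hW
    (contMDiffAt_extChartAt_symm hy)
    (by rw [minSmoothness_of_isRCLikeNormedField]; exact WithTop.coe_le_coe.2 le_top)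
  rw [chartField_eq_mpullback hy, h1]
  have h := extChartAt_target_mem_nhds' hy
  have h2 := VectorField.mlieBracketWithin_eq_lieBracketWithin (𝕜 := ℝ) (E := E)
    (V := VectorField.mpullback 𝓘(ℝ, E) I (extChartAt I x₀).symm V)
    (W := VectorField.mpullback 𝓘(ℝ, E) I (extChartAt I x₀).symm W) (s := univ)
  rw [VectorField.mlieBracketWithin_univ] at h2
  refine (congrFun h2 y).trans ?_
  refine (congrFun (VectorField.lieBracketWithin_univ (𝕜 := ℝ) (E := E)) y).trans ?_
  refine Filter.EventuallyEq.lieBracket_vectorField_eq ?_ ?_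
  · filter_upwards [h] with z hz using (chartField_eq_mpullback hz V).symm
  · filter_upwards [h] with z hz using (chartField_eq_mpullback hz W).symm

/-- The one-form `α` in the coordinates of the preferred chart at `x₀`. -/
noncomputable def chartForm (x₀ : N) (α : ∀ x : N, TangentSpace I x →L[ℝ] ℝ) (y : E) : E →L[ℝ] ℝ :=
  (α ((extChartAt I x₀).symm y)).comp (dChartSymm I x₀ y)

theorem chartForm_apply (x₀ : N) (α : ∀ x : N, TangentSpace I x →L[ℝ] ℝ) (y w : E) :
    chartForm x₀ α y w = α ((extChartAt I x₀).symm y) (dChartSymm I x₀ y w) := rfl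

theorem extD_apply_self (α : ∀ x : N, TangentSpace I x →L[ℝ] ℝ) (x : N) (X Y : TangentSpace I x) :
    extD I α x X Y =
      fderiv ℝ (chartForm x α) (extChartAt I x x) (dChart I x x X) (dChart I x x Y) -
      fderiv ℝ (chartForm x α) (extChartAt I x x) (dChart I x x Y) (dChart I x x X) := rfl

theorem fderiv_extChartAt_comp_symm {x₀ x : N} {y w : E} (hy : y ∈ (extChartAt I x).target)
    (hy₀ : (extChartAt I x).symm y ∈ (extChartAt I x₀).source) :
    fderiv ℝ (fun z => extChartAt I x₀ ((extChartAt I x).symm z)) y w =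
      dChart I x₀ ((extChartAt I x).symm y) (dChartSymm I x y w) := by
  have := mfderiv_comp_apply y (mdifferentiableAt_extChartAt_of_mem hy₀)
      (mdifferentiableAt_extChartAt_symm hy) w
  rw [mfderiv_eq_fderiv] at this
  exact this

/-- Independence of the chart: `extD` is defined in the chart centred at the point, whereas later
computations stay in one fixed chart. A change of chart adds a term with the second derivative of
the transition map, which is symmetric and cancels in the antisymmetrization. -/
theorem extD_apply_chart (x₀ : N) (α : ∀ x : N, TangentSpace I x →L[ℝ] ℝ) {x : N}
    (hx : x ∈ (extChartAt I x₀).source)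
    (hα : DifferentiableAt ℝ (chartForm x₀ α) (extChartAt I x₀ x)) (X Y : TangentSpace I x) :
    extD I α x X Y =
      fderiv ℝ (chartForm x₀ α) (extChartAt I x₀ x) (dChart I x₀ x X) (dChart I x₀ x Y) -
      fderiv ℝ (chartForm x₀ α) (extChartAt I x₀ x) (dChart I x₀ x Y) (dChart I x₀ x X) := by
  set φ : E → E := fun y => extChartAt I x₀ ((extChartAt I x).symm y) with hφ
  have hxs : x ∈ (extChartAt I x).source := mem_extChartAt_source x
  have hyt : extChartAt I x x ∈ (extChartAt I x).target := mem_extChartAt_target x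
  have hsx : (extChartAt I x).symm (extChartAt I x x) = x := (extChartAt I x).left_inv hxs
  have hφc : ContDiffAt ℝ ∞ φ (extChartAt I x x) := by
    rw [← contMDiffAt_iff_contDiffAt]
    have h2 : ContMDiffAt I 𝓘(ℝ, E) ∞ (extChartAt I x₀)
        ((extChartAt I x).symm (extChartAt I x x)) := by
      rw [hsx]
      exact contMDiffAt_extChartAt_of_mem hx
    exact h2.comp _ (contMDiffAt_extChartAt_symm hyt)
  have hφx : φ (extChartAt I x x) = extChartAt I x₀ x := by simp only [hφ]; rw [hsx]
  have hev : ∀ᶠ y in 𝓝 (extChartAt I x x), y ∈ (extChartAt I x).target ∧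
      (extChartAt I x).symm y ∈ (extChartAt I x₀).source := by
    refine Filter.Eventually.and (extChartAt_target_mem_nhds' hyt) ?_
    have : ContinuousAt (extChartAt I x).symm (extChartAt I x x) := continuousAt_extChartAt_symm x
    apply this.preimage_mem_nhds
    rw [hsx]
    exact (isOpen_extChartAt_source x₀).mem_nhds hx
  have ha : chartForm x α =ᶠ[𝓝 (extChartAt I x x)]
      fun y => (chartForm x₀ α (φ y)).comp (fderiv ℝ φ y) := by
    filter_upwards [hev] with y hy
    ext w
    rw [ContinuousLinearMap.comp_apply, fderiv_extChartAt_comp_symm hy.1 hy.2, chartForm_apply]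
    have h1 := mfderiv_symm_dChart hy.2 (dChartSymm I x y w)
    -- The two base points are only propositionally equal; quantifying over `z` lets the tangent
    -- vector be carried along the equality.
    have h2 : ∀ z : N, z = (extChartAt I x).symm y → ∀ u : TangentSpace I z,
        u = (dChartSymm I x y w : E) → α ((extChartAt I x).symm y) (dChartSymm I x y w) = α z u := by
      rintro z rfl u hu
      exact congrArg _ hu.symm
    exact h2 _ ((extChartAt I x₀).left_inv hy.2) _ h1
  have hφ' : DifferentiableAt ℝ (fderiv ℝ φ) (extChartAt I x x) :=
    (hφc.fderiv_right (m := 1) (by norm_cast)).differentiableAt (by simp)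
  have hα' : HasFDerivAt (chartForm x₀ α) (fderiv ℝ (chartForm x₀ α) (extChartAt I x₀ x))
      (φ (extChartAt I x x)) := by rw [hφx]; exact hα.hasFDerivAt
  have hd := ((HasFDerivAt.clm_comp (c := fun y => chartForm x₀ α (φ y)) (d := fderiv ℝ φ)
    (hα'.comp (extChartAt I x x) (hφc.differentiableAt (by simp)).hasFDerivAt)
      hφ'.hasFDerivAt)).congr_of_eventuallyEq ha
  have key : ∀ w : TangentSpace I x, fderiv ℝ φ (extChartAt I x x) (dChart I x x w) =
      dChart I x₀ x w := by
    intro w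
    have h1 := fderiv_extChartAt_comp_symm (x₀ := x₀) (w := dChart I x x w) hyt (by rwa [hsx])
    refine h1.trans ?_
    have h2 := mfderiv_symm_dChart (I := I) hxs w
    have h3 : ∀ z : N, z = x → ∀ u : TangentSpace I z, u = (w : E) →
        dChart I x₀ z u = dChart I x₀ x w := by
      rintro z rfl u hu
      exact congrArg _ hu
    exact h3 _ hsx _ h2
  have hsymm := (hφc.isSymmSndFDerivAt (by rw [minSmoothness_of_isRCLikeNormedField]; exact WithTop.coe_le_coe.2 le_top)).eq (dChart I x x X) (dChart I x x Y)
  rw [extD_apply_self, hd.fderiv]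
  simp only [add_apply, ContinuousLinearMap.comp_apply,
    ContinuousLinearMap.compL_apply, ContinuousLinearMap.flip_apply, key, hsymm]
  ring

/-- An integral curve of `X`, read in a chart, is an integral curve of `X` in the coordinates. -/
theorem HasMFDerivWithinAt.hasDerivWithinAt_extChartAt {x₀ : N} {γ : ℝ → N} {s : Set ℝ} {t : ℝ}
    {X : ∀ x : N, TangentSpace I x} (hγ : HasMFDerivWithinAt 𝓘(ℝ, ℝ) I γ s t
      ((1 : ℝ →L[ℝ] ℝ).smulRight (X (γ t)))) (ht : γ t ∈ (extChartAt I x₀).source) :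
    HasDerivWithinAt (fun τ => extChartAt I x₀ (γ τ))
      (chartField x₀ X (extChartAt I x₀ (γ t))) s t := by
  have h := (mdifferentiableAt_extChartAt_of_mem ht).hasMFDerivAt.comp_hasMFDerivWithinAt t hγ
  have h2 := h.hasFDerivWithinAt
  have h3 : HasFDerivWithinAt (fun τ => extChartAt I x₀ (γ τ))
      ((dChart I x₀ (γ t)).comp ((1 : ℝ →L[ℝ] ℝ).smulRight (X (γ t)))) s t := h2
  rw [chartField_apply ht]
  simpa using h3.hasDerivWithinAt

/-- Moves solutions of the coordinate equation back to the manifold; this is how a local flow in a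
chart becomes a flow box. -/
theorem HasDerivAt.hasMFDerivAt_extChartAt_symm {x₀ : N} {c : ℝ → E} {t : ℝ}
    {X : ∀ x : N, TangentSpace I x} (ht : c t ∈ (extChartAt I x₀).target)
    (hc : HasDerivAt c (chartField x₀ X (c t)) t) :
    HasMFDerivAt 𝓘(ℝ, ℝ) I (fun τ => (extChartAt I x₀).symm (c τ)) t
      ((1 : ℝ →L[ℝ] ℝ).smulRight (X ((extChartAt I x₀).symm (c t)))) := by
  have h := (mdifferentiableAt_extChartAt_symm ht).hasMFDerivAt.comp t hc.hasFDerivAt.hasMFDerivAt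
  have h1 : (1 : ℝ →L[ℝ] ℝ).smulRight (X ((extChartAt I x₀).symm (c t))) =
      (dChartSymm I x₀ (c t)).comp
        (ContinuousLinearMap.toSpanSingleton ℝ (chartField x₀ X (c t))) := by
    ext
    rw [ContinuousLinearMap.comp_apply, ContinuousLinearMap.toSpanSingleton_apply, one_smul,
      dChartSymm_chartField ht X, ContinuousLinearMap.smulRight_apply, one_apply_eq_self,
      one_smul]
  rw [h1]
  exact h

end ChartCalculus

/-! ### Differentiable dependence of local flows on the initial point -/

section LocalFlow

variable {E : Type*} [NormedAddCommGroup E] [NormedSpace ℝ E]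

/-- Quadratic estimate of the remainder of the linearized flow, for positive times. -/
theorem norm_variation_remainder_le {Y : E → E} {B : Set E} (hB : Convex ℝ B) {K K₂ L η : ℝ}
    (hK₂ : 0 ≤ K₂) (hY : ∀ x ∈ B, DifferentiableAt ℝ Y x)
    (hYK : ∀ x ∈ B, ‖fderiv ℝ Y x‖ ≤ K)
    (hlip : ∀ x ∈ B, ∀ y ∈ B, ‖fderiv ℝ Y y - fderiv ℝ Y x‖ ≤ K₂ * ‖y - x‖)
    {a b : ℝ → E} {A : ℝ → E →L[ℝ] E} {Δ : E}
    (ha : ∀ t ∈ Icc 0 η, HasDerivWithinAt a (Y (a t)) (Icc 0 η) t)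
    (hb : ∀ t ∈ Icc 0 η, HasDerivWithinAt b (Y (b t)) (Icc 0 η) t)
    (hA : ∀ t ∈ Icc 0 η, HasDerivWithinAt A ((fderiv ℝ Y (a t)).comp (A t)) (Icc 0 η) t)
    (haB : ∀ t ∈ Icc 0 η, a t ∈ B) (hbB : ∀ t ∈ Icc 0 η, b t ∈ B)
    (hL : ∀ t ∈ Icc 0 η, ‖b t - a t‖ ≤ L * ‖Δ‖) (h0 : b 0 - a 0 - A 0 Δ = 0) :
    ∀ t ∈ Icc 0 η, ‖b t - a t - A t Δ‖ ≤ gronwallBound 0 K (K₂ * (L * ‖Δ‖) ^ 2) t := by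
  have hr : ∀ t ∈ Icc 0 η, HasDerivWithinAt (fun t => b t - a t - A t Δ)
      (Y (b t) - Y (a t) - (fderiv ℝ Y (a t)) (A t Δ)) (Icc 0 η) t := by
    intro t ht
    have h1 := (hA t ht).clm_apply (hasDerivWithinAt_const t (Icc 0 η) Δ)
    simpa using ((hb t ht).fun_sub (ha t ht)).fun_sub h1
  have := norm_le_gronwallBound_of_norm_deriv_right_le (f := fun t => b t - a t - A t Δ)
    (f' := fun t => Y (b t) - Y (a t) - (fderiv ℝ Y (a t)) (A t Δ)) (δ := 0) (K := K)
    (ε := K₂ * (L * ‖Δ‖) ^ 2) (a := 0) (b := η)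
    (fun t ht => (hr t ht).continuousWithinAt) ?_ (by simp [h0]) ?_
  · simpa using this
  · intro t ht
    refine (hr t (Ico_subset_Icc_self ht)).mono_of_mem_nhdsWithin ?_
    exact Filter.mem_of_superset (Icc_mem_nhdsGE ht.2) (Icc_subset_Icc_left ht.1)
  · intro t ht'
    have ht := Ico_subset_Icc_self ht'
    have hseg : segment ℝ (a t) (b t) ⊆ B := hB.segment_subset (haB t ht) (hbB t ht)
    -- Mean value inequality on the segment from `a t` to `b t`, where the derivative of `Y` differs
    -- from its value at `a t` by at most `K₂ * ‖b t - a t‖`.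
    have h1 : ‖Y (b t) - Y (a t) - fderiv ℝ Y (a t) (b t - a t)‖ ≤
        (K₂ * ‖b t - a t‖) * ‖b t - a t‖ := by
      refine (convex_segment (a t) (b t)).norm_image_sub_le_of_norm_fderiv_le'
        (fun x hx => hY x (hseg hx)) (fun x hx => ?_) (left_mem_segment ℝ _ _)
        (right_mem_segment ℝ _ _)
      refine (hlip _ (haB t ht) _ (hseg hx)).trans ?_
      gcongr
      exact norm_sub_le_of_mem_segment hx
    have h2 : Y (b t) - Y (a t) - (fderiv ℝ Y (a t)) (A t Δ) =
        fderiv ℝ Y (a t) (b t - a t - A t Δ) +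
          (Y (b t) - Y (a t) - fderiv ℝ Y (a t) (b t - a t)) := by
      simp only [map_sub]; abel
    have h3 : (K₂ * ‖b t - a t‖) * ‖b t - a t‖ ≤ K₂ * (L * ‖Δ‖) ^ 2 := by
      rw [mul_assoc, ← sq]
      gcongr
      exact hL t ht
    calc ‖Y (b t) - Y (a t) - (fderiv ℝ Y (a t)) (A t Δ)‖
        ≤ ‖fderiv ℝ Y (a t) (b t - a t - A t Δ)‖ +
          ‖Y (b t) - Y (a t) - fderiv ℝ Y (a t) (b t - a t)‖ := by rw [h2]; exact norm_add_le _ _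
      _ ≤ K * ‖b t - a t - A t Δ‖ + K₂ * (L * ‖Δ‖) ^ 2 := by
        refine add_le_add ?_ (h1.trans h3)
        exact (fderiv ℝ Y (a t)).le_of_opNorm_le (hYK _ (haB t ht)) _

/-- The same estimate for both signs of the time, on `[-η, η]`. -/
theorem norm_variation_remainder_le_of_abs_le {Y : E → E} {B : Set E} (hB : Convex ℝ B)
    {K K₂ L η : ℝ} (hK : 0 < K) (hK₂ : 0 ≤ K₂) (hη : 0 ≤ η)
    (hY : ∀ x ∈ B, DifferentiableAt ℝ Y x) (hYK : ∀ x ∈ B, ‖fderiv ℝ Y x‖ ≤ K)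
    (hlip : ∀ x ∈ B, ∀ y ∈ B, ‖fderiv ℝ Y y - fderiv ℝ Y x‖ ≤ K₂ * ‖y - x‖)
    {a b : ℝ → E} {A : ℝ → E →L[ℝ] E} {Δ : E}
    (ha : ∀ t ∈ Icc (-η) η, HasDerivWithinAt a (Y (a t)) (Icc (-η) η) t)
    (hb : ∀ t ∈ Icc (-η) η, HasDerivWithinAt b (Y (b t)) (Icc (-η) η) t)
    (hA : ∀ t ∈ Icc (-η) η, HasDerivWithinAt A ((fderiv ℝ Y (a t)).comp (A t)) (Icc (-η) η) t)
    (haB : ∀ t ∈ Icc (-η) η, a t ∈ B) (hbB : ∀ t ∈ Icc (-η) η, b t ∈ B)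
    (hL : ∀ t ∈ Icc (-η) η, ‖b t - a t‖ ≤ L * ‖Δ‖) (h0 : b 0 - a 0 - A 0 Δ = 0) :
    ∀ t ∈ Icc (-η) η,
      ‖b t - a t - A t Δ‖ ≤ K₂ * L ^ 2 * (Real.exp (K * η) - 1) / K * ‖Δ‖ ^ 2 := by
  have hbd : ∀ s ∈ Icc 0 η, gronwallBound 0 K (K₂ * (L * ‖Δ‖) ^ 2) s ≤
      K₂ * L ^ 2 * (Real.exp (K * η) - 1) / K * ‖Δ‖ ^ 2 := by
    intro s hs
    rw [gronwallBound_of_K_ne_0 hK.ne']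
    simp only [zero_mul, zero_add]
    have : Real.exp (K * s) ≤ Real.exp (K * η) := by
      apply Real.exp_le_exp.2; gcongr; exact hs.2
    calc K₂ * (L * ‖Δ‖) ^ 2 / K * (Real.exp (K * s) - 1)
        ≤ K₂ * (L * ‖Δ‖) ^ 2 / K * (Real.exp (K * η) - 1) := by gcongr
      _ = _ := by ring
  have hsub : Icc 0 η ⊆ Icc (-η) η := Icc_subset_Icc_left (by linarith)
  have hneg : MapsTo (fun s : ℝ => -s) (Icc 0 η) (Icc (-η) η) := fun s hs =>
    ⟨by linarith [hs.2], by linarith [hs.1]⟩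
  intro t ht
  rcases le_total 0 t with h | h
  · exact (norm_variation_remainder_le hB hK₂ hY hYK hlip
      (fun s hs => (ha s (hsub hs)).mono hsub) (fun s hs => (hb s (hsub hs)).mono hsub)
      (fun s hs => (hA s (hsub hs)).mono hsub) (fun s hs => haB s (hsub hs))
      (fun s hs => hbB s (hsub hs)) (fun s hs => hL s (hsub hs)) h0 t ⟨h, ht.2⟩).trans
      (hbd t ⟨h, ht.2⟩)
  · have hcomp : ∀ {F : Type _} [NormedAddCommGroup F] [NormedSpace ℝ F] {c : ℝ → F} {c' : F} {s},
        s ∈ Icc 0 η → HasDerivWithinAt c c' (Icc (-η) η) (-s) →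
        HasDerivWithinAt (fun s => c (-s)) (-c') (Icc 0 η) s := by
      intro F _ _ c c' s hs hc
      simpa [Function.comp_def] using hc.scomp s (hasDerivAt_neg s).hasDerivWithinAt hneg
    have hfd : ∀ x, fderiv ℝ (fun x => -Y x) x = -fderiv ℝ Y x := fun x => fderiv_fun_neg
    have := norm_variation_remainder_le (Y := fun x => -Y x) (K := K) (K₂ := K₂) (L := L) (η := η)
      (a := fun s => a (-s)) (b := fun s => b (-s)) (A := fun s => A (-s)) (Δ := Δ) hB hK₂
      (fun x hx => (hY x hx).neg) (fun x hx => by rw [hfd, norm_neg]; exact hYK x hx)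
      (fun x hx y hy => by rw [hfd, hfd, ← neg_sub', norm_neg]; exact hlip x hx y hy)
      (fun s hs => hcomp hs (ha _ (hneg hs))) (fun s hs => hcomp hs (hb _ (hneg hs)))
      (fun s hs => by
        simpa only [hfd, ContinuousLinearMap.neg_comp] using hcomp hs (hA _ (hneg hs)))
      (fun s hs => haB _ (hneg hs)) (fun s hs => hbB _ (hneg hs))
      (fun s hs => hL _ (hneg hs)) (by simpa using h0) (-t) ⟨by linarith, by linarith [ht.1]⟩
    simp only [neg_neg] at this
    exact this.trans (hbd _ ⟨by linarith, by linarith [ht.1]⟩)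

/-- A function on an open subset of `ℝ × E` with continuous partial derivatives is `C¹`. -/
theorem contDiffOn_one_of_continuousOn_partial {F : Type*} [NormedAddCommGroup F] [NormedSpace ℝ F]
    {f : ℝ × E → F} {O : Set (ℝ × E)} (hO : IsOpen O) {f₁ : ℝ × E → F} {f₂ : ℝ × E → E →L[ℝ] F}
    (h₁ : ∀ z ∈ O, HasDerivAt (fun t => f (t, z.2)) (f₁ z) z.1)
    (h₂ : ∀ z ∈ O, HasFDerivAt (fun x => f (z.1, x)) (f₂ z) z.2)
    (c₁ : ContinuousOn f₁ O) (c₂ : ContinuousOn f₂ O) : ContDiffOn ℝ 1 f O := by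
  set g₁ : ℝ × E → ℝ →L[ℝ] F := fun z => ContinuousLinearMap.toSpanSingleton ℝ (f₁ z)
  have cg₁ : ContinuousOn g₁ O :=
    (ContinuousLinearMap.toSpanSingletonCLE (𝕜 := ℝ) (E := F)).continuous.comp_continuousOn c₁
  have hfd : ∀ z ∈ O, HasFDerivAt f ((g₁ z).coprod (f₂ z)) z := by
    intro z hz
    refine (hasStrictFDerivAt_uncurry_coprod (u := z) (f := fun t x => f (t, x))
      (f₁ := fun t x => g₁ (t, x)) (f₂ := fun t x => f₂ (t, x)) ?_ ?_ ?_ ?_).hasFDerivAt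
    · filter_upwards [hO.mem_nhds hz] with v hv using (h₁ v hv).hasFDerivAt
    · filter_upwards [hO.mem_nhds hz] with v hv using h₂ v hv
    · exact cg₁.continuousAt (hO.mem_nhds hz)
    · exact c₂.continuousAt (hO.mem_nhds hz)
  rw [show (1 : WithTop ℕ∞) = 0 + 1 by norm_num, contDiffOn_succ_iff_fderiv_of_isOpen hO]
  refine ⟨fun z hz => (hfd z hz).differentiableAt.differentiableWithinAt, by simp, ?_⟩
  rw [contDiffOn_zero]
  refine ContinuousOn.congr (f := fun z => (g₁ z).comp (ContinuousLinearMap.fst ℝ ℝ E) +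
    (f₂ z).comp (ContinuousLinearMap.snd ℝ ℝ E)) ?_ fun z hz => ?_
  · exact (cg₁.clm_comp continuousOn_const).add (c₂.clm_comp continuousOn_const)
  · rw [(hfd z hz).fderiv]
    ext <;> simp

/-- A `C²` vector field has a local flow that is `C¹` jointly in the time and the initial point. -/
theorem exists_contDiffOn_local_flow [CompleteSpace E] {X : E → E} {x₀ : E}
    (hX : ContDiffAt ℝ 2 X x₀) :
    ∃ η > 0, ∃ r > 0, ∃ Φ : ℝ × E → E,
      ContDiffOn ℝ 1 Φ (Ioo (-η) η ×ˢ Metric.ball x₀ r) ∧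
      ∀ x ∈ Metric.ball x₀ r, Φ (0, x) = x ∧
        ∀ t ∈ Ioo (-η) η, HasDerivAt (fun t => Φ (t, x)) (X (Φ (t, x))) t := by
  -- The equation is coupled with its linearization. Started from `(x, id)`, the second component is
  -- the candidate for the derivative of the flow in `x`. This `C¹` system is solved at once by
  -- Picard–Lindelöf, which also gives Lipschitz dependence.
  let F : E × (E →L[ℝ] E) → E × (E →L[ℝ] E) := fun z => (X z.1, (fderiv ℝ X z.1).comp z.2)
  let ι : E →L[ℝ] E := ContinuousLinearMap.id ℝ E
  have hX' : ContDiffAt ℝ 1 (fderiv ℝ X) x₀ := hX.fderiv_right (by norm_num)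
  have hF : ContDiffAt ℝ 1 F (x₀, ι) := by
    refine ContDiffAt.prodMk ?_ ?_
    · exact (hX.of_le (by norm_num)).comp (x₀, ι) contDiffAt_fst
    · refine ContDiffAt.clm_comp ?_ contDiffAt_snd
      exact ContDiffAt.comp (x₀, ι) hX' contDiffAt_fst
  obtain ⟨ε, hε, a, r, L₀, K₀, hr, hpl⟩ := IsPicardLindelof.of_contDiffAt_one hF
  obtain ⟨α, hα, L, hL⟩ :=
    (hpl 0).exists_forall_mem_closedBall_eq_hasDerivWithinAt_lipschitzOnWith
  simp only [zero_sub, zero_add] at hα hL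
  have hcont : ContinuousOn (Function.uncurry α) (Metric.closedBall (x₀, ι) r ×ˢ Icc (-ε) ε) :=
    continuousOn_prod_of_continuousOn_lipschitzOnWith _ L
      (fun x hx => HasDerivWithinAt.continuousOn (hα x hx).2) hL
  obtain ⟨K₂, s, hs, hK₂⟩ := hX'.exists_lipschitzOnWith
  have hs' : ∀ᶠ x in 𝓝 x₀, x ∈ s ∧ ContDiffAt ℝ 2 X x ∧ ‖fderiv ℝ X x‖ < ‖fderiv ℝ X x₀‖ + 1 :=
    Filter.Eventually.and hs ((hX.eventually (by simp)).and
      (hX'.continuousAt.norm.eventually_lt continuousAt_const (by linarith)))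
  obtain ⟨ρ, hρ, hρs⟩ := Metric.eventually_nhds_iff_ball.1 hs'
  -- Times and initial points are restricted so that trajectories stay in the ball of radius `ρ`,
  -- where the bounds on the derivative of `X` hold.
  have hin : ∀ᶠ z : (E × (E →L[ℝ] E)) × ℝ in
      𝓝[Metric.closedBall (x₀, ι) r ×ˢ Icc (-ε) ε] ((x₀, ι), 0),
      (Function.uncurry α z).1 ∈ Metric.ball x₀ ρ := by
    have hz : (((x₀, ι), 0) : (E × (E →L[ℝ] E)) × ℝ) ∈
        Metric.closedBall (x₀, ι) r ×ˢ Icc (-ε) ε :=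
      ⟨Metric.mem_closedBall_self hr.le, by simp [hε.le]⟩
    have h1 := (hcont _ hz).fst
    refine h1.eventually (Metric.isOpen_ball.mem_nhds ?_)
    simp [Function.uncurry, (hα _ hz.1).1, hρ]
  rw [eventually_nhdsWithin_iff] at hin
  obtain ⟨d, hd, hdin⟩ := Metric.eventually_nhds_iff_ball.1 hin
  set η := min (d / 2) ε with hη
  have hη0 : 0 < η := by positivity
  have hηd : η < d := (min_le_left _ _).trans_lt (by linarith)
  have hηε : η ≤ ε := min_le_right _ _
  set r' := min d r with hr'
  have hr0 : 0 < r' := lt_min hd hr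
  have hball : ∀ x ∈ Metric.ball x₀ r', (x, ι) ∈ Metric.closedBall (x₀, ι) r := by
    intro x hx
    rw [Metric.mem_closedBall, Prod.dist_eq]
    simp only [dist_self, NNReal.coe_nonneg, max_le_iff, and_true]
    exact (Metric.mem_ball.1 hx).le.trans (min_le_right _ _)
  have hIcc : Icc (-η) η ⊆ Icc (-ε) ε := Icc_subset_Icc (by linarith) hηε
  have hB : ∀ x ∈ Metric.ball x₀ r', ∀ t ∈ Icc (-η) η, (α (x, ι) t).1 ∈ Metric.ball x₀ ρ := by
    intro x hx t ht
    refine hdin ((x, ι), t) ?_ ⟨hball x hx, hIcc ht⟩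
    rw [Metric.mem_ball, Prod.dist_eq, max_lt_iff, Prod.dist_eq, max_lt_iff]
    refine ⟨⟨(Metric.mem_ball.1 hx).trans_le (min_le_left _ _), by simpa using hd⟩, ?_⟩
    simp only [dist_zero_right, Real.norm_eq_abs]
    exact (abs_le.2 ht).trans_lt hηd
  have hsol : ∀ x ∈ Metric.ball x₀ r', ∀ t ∈ Icc (-η) η,
      HasDerivWithinAt (fun t => (α (x, ι) t).1) (X (α (x, ι) t).1) (Icc (-η) η) t := by
    intro x hx t ht
    exact ((hasFDerivAt_fst.comp_hasDerivWithinAt t ((hα _ (hball x hx)).2 t (hIcc ht)))).mono hIcc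
  have hvar : ∀ x ∈ Metric.ball x₀ r', ∀ t ∈ Icc (-η) η,
      HasDerivWithinAt (fun t => (α (x, ι) t).2)
        ((fderiv ℝ X (α (x, ι) t).1).comp (α (x, ι) t).2) (Icc (-η) η) t := by
    intro x hx t ht
    exact ((hasFDerivAt_snd.comp_hasDerivWithinAt t ((hα _ (hball x hx)).2 t (hIcc ht)))).mono hIcc
  have hfd : ∀ x ∈ Metric.ball x₀ r', ∀ t ∈ Icc (-η) η,
      HasFDerivAt (fun x => (α (x, ι) t).1) (α (x, ι) t).2 x := by
    intro x hx t ht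
    rw [hasFDerivAt_iff_isLittleO]
    -- By Grönwall the error of the linearized flow is quadratic in `x' - x`, so the second
    -- component really is the derivative.
    have hbig : (fun x' => (α (x', ι) t).1 - (α (x, ι) t).1 - (α (x, ι) t).2 (x' - x)) =O[𝓝 x]
        fun x' => ‖x' - x‖ ^ 2 := by
      refine Asymptotics.IsBigO.of_bound (K₂ * L ^ 2 *
        (Real.exp ((‖fderiv ℝ X x₀‖ + 1) * η) - 1) / (‖fderiv ℝ X x₀‖ + 1)) ?_
      filter_upwards [Metric.isOpen_ball.mem_nhds hx] with x' hx'
      rw [norm_pow, norm_norm]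
      refine norm_variation_remainder_le_of_abs_le (a := fun t => (α (x, ι) t).1)
        (b := fun t => (α (x', ι) t).1) (A := fun t => (α (x, ι) t).2) (convex_ball x₀ ρ)
        (by positivity) K₂.2 hη0.le
        (fun y hy => (hρs y hy).2.1.differentiableAt (by simp)) (fun y hy => (hρs y hy).2.2.le)
        (fun y hy z hz => ?_) (hsol x hx) (hsol x' hx') (hvar x hx) (hB x hx) (hB x' hx')
        (fun τ hτ => ?_) ?_ t ht
      · exact hK₂.norm_sub_le (hρs z hz).1 (hρs y hy).1
      · have h1 := (hL τ (hIcc hτ)).norm_sub_le (hball x' hx') (hball x hx)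
        have h2 : ‖((x', ι) : E × (E →L[ℝ] E)) - (x, ι)‖ = ‖x' - x‖ := by simp
        rw [h2] at h1
        exact (norm_fst_le _).trans h1
      · simp [(hα _ (hball x hx)).1, (hα _ (hball x' hx')).1, ι]
    refine hbig.trans_isLittleO ?_
    have := Asymptotics.isLittleO_norm_pow_id (E' := E) one_lt_two
    exact (this.comp_tendsto (tendsto_sub_nhds_zero_iff.2 Filter.tendsto_id))
  have hopen : IsOpen (Ioo (-η) η ×ˢ Metric.ball x₀ r') := isOpen_Ioo.prod Metric.isOpen_ball
  have hsol' : ∀ x ∈ Metric.ball x₀ r', ∀ t ∈ Ioo (-η) η,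
      HasDerivAt (fun t => (α (x, ι) t).1) (X (α (x, ι) t).1) t := fun x hx t ht =>
    (hsol x hx t (Ioo_subset_Icc_self ht)).hasDerivAt (Icc_mem_nhds ht.1 ht.2)
  have hαc : ContinuousOn (fun z : ℝ × E => α (z.2, ι) z.1) (Ioo (-η) η ×ˢ Metric.ball x₀ r') := by
    have h1 : ContinuousOn (fun z : ℝ × E => (((z.2, ι), z.1) : (E × (E →L[ℝ] E)) × ℝ))
      (Ioo (-η) η ×ˢ Metric.ball x₀ r') := by fun_prop
    exact hcont.comp h1 fun z hz => ⟨hball _ hz.2, hIcc (Ioo_subset_Icc_self hz.1)⟩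
  have hXc : ContinuousOn X (Metric.ball x₀ ρ) := fun y hy =>
    (hρs y hy).2.1.continuousAt.continuousWithinAt
  refine ⟨η, hη0, r', hr0, fun z => (α (z.2, ι) z.1).1, ?_, fun x hx => ⟨?_, hsol' x hx⟩⟩
  · exact contDiffOn_one_of_continuousOn_partial hopen (f₁ := fun z => X (α (z.2, ι) z.1).1)
      (f₂ := fun z => (α (z.2, ι) z.1).2) (fun z hz => hsol' z.2 hz.2 z.1 hz.1)
      (fun z hz => hfd z.2 hz.2 z.1 (Ioo_subset_Icc_self hz.1))
      (hXc.comp hαc.fst fun z hz => hB _ hz.2 _ (Ioo_subset_Icc_self hz.1)) hαc.snd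
  · simp [(hα _ (hball x hx)).1]

end LocalFlow

/-! ### The equation of variations -/

section Variation

variable {E : Type*} [NormedAddCommGroup E] [NormedSpace ℝ E] [CompleteSpace E]

/-- For a `C¹` family `G (τ, ε)` of solutions of `dx/dτ = X(x)`, the field `∂G/∂ε` solves the
linearized equation. -/
theorem hasDerivAt_variation {X : E → E} {G : ℝ × ℝ → E} {O : Set (ℝ × ℝ)} (hO : IsOpen O)
    (hG : ContDiffOn ℝ 1 G O) {U : Set E} (hU : IsOpen U) (hX : ContDiffOn ℝ 1 X U)
    (hGU : ∀ z ∈ O, G z ∈ U)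
    (hode : ∀ z ∈ O, HasDerivAt (fun τ => G (τ, z.2)) (X (G z)) z.1) {t ε : ℝ} (h : (t, ε) ∈ O) :
    HasDerivAt (fun τ => fderiv ℝ G (τ, ε) (0, 1))
      (fderiv ℝ X (G (t, ε)) (fderiv ℝ G (t, ε) (0, 1))) t := by
  obtain ⟨d, hd, hdO⟩ := Metric.isOpen_iff.1 hO _ h
  have hbox : ∀ τ ∈ Icc (t - d / 2) (t + d / 2), ∀ e ∈ Icc (ε - d / 2) (ε + d / 2), (τ, e) ∈ O := by
    intro τ hτ e he
    apply hdO
    rw [Metric.mem_ball, Prod.dist_eq, max_lt_iff, Real.dist_eq, Real.dist_eq, abs_lt, abs_lt]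
    refine ⟨⟨?_, ?_⟩, ?_, ?_⟩ <;> simp only <;> linarith [hτ.1, hτ.2, he.1, he.2]
  have hDG : ContinuousOn (fderiv ℝ G) O := hG.continuousOn_fderiv_of_isOpen hO le_rfl
  have hDX : ContinuousOn (fderiv ℝ X) U := hX.continuousOn_fderiv_of_isOpen hU le_rfl
  have hGc : ContinuousOn G O := hG.continuousOn
  have hdG : ∀ z ∈ O, DifferentiableAt ℝ G z := fun z hz =>
    (hG.contDiffAt (hO.mem_nhds hz)).differentiableAt (by simp)
  have hdX : ∀ z ∈ U, DifferentiableAt ℝ X z := fun z hz =>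
    (hX.contDiffAt (hU.mem_nhds hz)).differentiableAt (by simp)
  set Q : ℝ × ℝ → E := fun z => fderiv ℝ X (G z) (fderiv ℝ G z (0, 1)) with hQ
  have hQc : ContinuousOn Q O :=
    (hDX.comp hGc hGU).clm_apply (hDG.clm_apply continuousOn_const)
  have hGε : ∀ z ∈ O, HasDerivAt (fun e => G (z.1, e)) (fderiv ℝ G z (0, 1)) z.2 := by
    intro z hz
    have h1 : HasDerivAt (fun e : ℝ => (z.1, e)) ((0, 1) : ℝ × ℝ) z.2 :=
      (hasDerivAt_const z.2 z.1).prodMk (hasDerivAt_id z.2)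
    exact (hdG z hz).hasFDerivAt.comp_hasDerivAt z.2 h1
  have hXGε : ∀ z ∈ O, HasDerivAt (fun e => X (G (z.1, e))) (Q z) z.2 := fun z hz =>
    (hdX _ (hGU z hz)).hasFDerivAt.comp_hasDerivAt z.2 (hGε z hz)
  set K := Icc (t - d / 2) (t + d / 2) ×ˢ Icc (ε - d / 2) (ε + d / 2)
  have hKO : K ⊆ O := fun z hz => hbox z.1 hz.1 z.2 hz.2
  obtain ⟨C, hC⟩ := (isCompact_Icc.prod isCompact_Icc : IsCompact K).exists_bound_of_continuousOn
    (hQc.mono hKO)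
  have hslice : ∀ {F : ℝ × ℝ → E}, ContinuousOn F O → ∀ e ∈ Icc (ε - d / 2) (ε + d / 2),
      ContinuousOn (fun τ => F (τ, e)) (Icc (t - d / 2) (t + d / 2)) := by
    intro F hF e he
    have h1 : ContinuousOn (fun τ : ℝ => (τ, e)) (Icc (t - d / 2) (t + d / 2)) := by fun_prop
    exact hF.comp h1 fun τ hτ => hbox τ hτ e he
  have hXG : ContinuousOn (fun z => X (G z)) O := hX.continuousOn.comp hGc hGU
  have huIcc : ∀ τ ∈ Icc (t - d / 2) (t + d / 2), uIcc t τ ⊆ Icc (t - d / 2) (t + d / 2) :=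
    fun τ hτ => uIcc_subset_Icc ⟨by linarith, by linarith⟩ hτ
  have hεm : ε ∈ Icc (ε - d / 2) (ε + d / 2) := ⟨by linarith, by linarith⟩
  have hnε : Icc (ε - d / 2) (ε + d / 2) ∈ 𝓝 ε := Icc_mem_nhds (by linarith) (by linarith)
  -- the integrated equation of variations
  have hint : ∀ τ ∈ Icc (t - d / 2) (t + d / 2),
      fderiv ℝ G (τ, ε) (0, 1) = fderiv ℝ G (t, ε) (0, 1) + ∫ s in t..τ, Q (s, ε) := by
    intro τ hτ
    -- Since `G` is only `C¹`, mixed second derivatives cannot be interchanged directly. Instead the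
    -- integrated equation is differentiated in `ε` under the integral sign, and the fundamental
    -- theorem of calculus then gives the derivative in `τ`.
    have h1 := (intervalIntegral.hasDerivAt_integral_of_dominated_loc_of_deriv_le
      (μ := MeasureTheory.volume) (a := t) (b := τ)
      (F := fun e s => X (G (s, e))) (F' := fun e s => Q (s, e)) (x₀ := ε)
      (s := Icc (ε - d / 2) (ε + d / 2)) (bound := fun _ => C) hnε ?_ ?_ ?_ ?_ ?_ ?_).2
    · have h2 : (fun e => G (τ, e)) =ᶠ[𝓝 ε] fun e => G (t, e) + ∫ s in t..τ, X (G (s, e)) := by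
        filter_upwards [hnε] with e he
        rw [intervalIntegral.integral_eq_sub_of_hasDerivAt (f := fun s => G (s, e))]
        · abel
        · intro s hs
          exact hode (s, e) (hbox s (huIcc τ hτ hs) e he)
        · exact ((hslice hXG e he).mono (huIcc τ hτ)).intervalIntegrable
      have h3 := ((hGε (t, ε) h).add h1).congr_of_eventuallyEq h2
      exact (hGε (τ, ε) (hbox τ hτ ε hεm)).unique h3
    · filter_upwards [hnε] with e he
      exact ((hslice hXG e he).mono (uIoc_subset_uIcc.trans (huIcc τ hτ))).aestronglyMeasurable
        measurableSet_uIoc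
    · exact ((hslice hXG ε hεm).mono (huIcc τ hτ)).intervalIntegrable
    · exact ((hslice hQc ε hεm).mono (uIoc_subset_uIcc.trans (huIcc τ hτ))).aestronglyMeasurable
        measurableSet_uIoc
    · exact Filter.Eventually.of_forall fun s hs e he =>
        hC (s, e) ⟨huIcc τ hτ (uIoc_subset_uIcc hs), he⟩
    · exact intervalIntegrable_const
    · exact Filter.Eventually.of_forall fun s hs e he =>
        hXGε (s, e) (hbox s (huIcc τ hτ (uIoc_subset_uIcc hs)) e he)
  have hnt : Icc (t - d / 2) (t + d / 2) ∈ 𝓝 t := Icc_mem_nhds (by linarith) (by linarith)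
  have hQt : ContinuousOn (fun τ => Q (τ, ε)) (Icc (t - d / 2) (t + d / 2)) := hslice hQc ε hεm
  have hfin : HasDerivAt (fun τ => ∫ s in t..τ, Q (s, ε)) (Q (t, ε)) t := by
    refine intervalIntegral.integral_hasDerivAt_right (by simp) ?_ (hQt.continuousAt hnt)
    refine ⟨_, hnt, hQt.aestronglyMeasurable measurableSet_Icc⟩
  refine ((hfin.const_add (fderiv ℝ G (t, ε) (0, 1)))).congr_of_eventuallyEq ?_
  filter_upwards [hnt] with τ hτ using hint τ hτ

end Variation

/-! ### Families of integral curves on a manifold -/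

section Families

variable {E : Type*} [NormedAddCommGroup E] [NormedSpace ℝ E] [CompleteSpace E]
  {H : Type*} [TopologicalSpace H] {I : ModelWithCorners ℝ E H} [I.Boundaryless]
  {N : Type*} [TopologicalSpace N] [ChartedSpace H N] [IsManifold I ∞ N]

/-- Around each point of the domain of smoothness of a vector field, integral curves are unique and
there is a `C¹` local flow. -/
theorem exists_flow_box {X : ∀ x : N, TangentSpace I x} {D : Set N} (hD : IsOpen D)
    (hX : ContMDiffOn I I.tangent ∞ (fun x => (⟨x, X x⟩ : TangentBundle I N)) D) {x₀ : N}
    (hx₀ : x₀ ∈ D) :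
    ∃ U : Set N, IsOpen U ∧
      (∀ (γ₁ γ₂ : ℝ → N) (a b t₀ : ℝ), t₀ ∈ Ioo a b → IsMIntegralCurveOn γ₁ X (Ioo a b) →
        IsMIntegralCurveOn γ₂ X (Ioo a b) → (∀ t ∈ Ioo a b, γ₁ t ∈ U ∧ γ₂ t ∈ U) →
        γ₁ t₀ = γ₂ t₀ → EqOn γ₁ γ₂ (Ioo a b)) ∧
      (∀ (γ₁ γ₂ : ℝ → N) (a b : ℝ), IsMIntegralCurveOn γ₁ X (Icc a b) →
        IsMIntegralCurveOn γ₂ X (Icc a b) → (∀ t ∈ Icc a b, γ₁ t ∈ U ∧ γ₂ t ∈ U) →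
        γ₁ a = γ₂ a → EqOn γ₁ γ₂ (Icc a b)) ∧
      ∃ η > 0, ∃ W : Set N, IsOpen W ∧ x₀ ∈ W ∧ W ⊆ U ∧ ∃ Φ : ℝ × N → N,
        ContMDiffOn (𝓘(ℝ, ℝ).prod I) I 1 Φ (Ioo (-η) η ×ˢ W) ∧
        ∀ ν ∈ W, Φ (0, ν) = ν ∧ IsMIntegralCurveOn (fun t => Φ (t, ν)) X (Ioo (-η) η) ∧
          ∀ t ∈ Ioo (-η) η, Φ (t, ν) ∈ U := by
  set χ := extChartAt I x₀ with hχ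
  have hop := isOpen_extChartAt_target_inter_preimage (I := I) x₀ hD
  have hXc := contDiffOn_chartField x₀ hD hX
  have hx₀s : x₀ ∈ χ.source := mem_extChartAt_source x₀
  have hy₀ : χ x₀ ∈ χ.target ∩ χ.symm ⁻¹' D :=
    ⟨mem_extChartAt_target x₀, by rwa [mem_preimage, χ.left_inv hx₀s]⟩
  have hXat : ContDiffAt ℝ ∞ (chartField x₀ X) (χ x₀) := hXc.contDiffAt (hop.mem_nhds hy₀)
  obtain ⟨K, s, hs, hK⟩ := (hXat.of_le (by simp : (1 : WithTop ℕ∞) ≤ ∞)).exists_lipschitzOnWith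
  -- On `B` the coordinate field is Lipschitz, so integral curves are unique as long as they stay in
  -- the corresponding set `U`.
  obtain ⟨B, hBs, hBo, hBx⟩ := mem_nhds_iff.1 (Filter.inter_mem hs (hop.mem_nhds hy₀))
  set U := χ.source ∩ χ ⁻¹' B with hU
  have hUo : IsOpen U :=
    (continuousOn_extChartAt x₀).isOpen_inter_preimage (isOpen_extChartAt_source x₀) hBo
  have hcurve : ∀ {γ : ℝ → N} {T : Set ℝ} {t}, IsMIntegralCurveOn γ X T → t ∈ T → γ t ∈ U →
      HasDerivWithinAt (fun τ => χ (γ τ)) (chartField x₀ X (χ (γ t))) T t := fun h ht hU =>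
    (h _ ht).hasDerivWithinAt_extChartAt hU.1
  refine ⟨U, hUo, ?_, ?_, ?_⟩
  · intro γ₁ γ₂ a b t₀ ht₀ h₁ h₂ hγ h0
    have := ODE_solution_unique_of_mem_Ioo (v := fun _ => chartField x₀ X) (s := fun _ => B)
      (K := K) (f := fun τ => χ (γ₁ τ)) (g := fun τ => χ (γ₂ τ)) (a := a) (b := b) (t₀ := t₀)
      (fun t _ => hK.mono fun z hz => (hBs hz).1) ht₀
      (fun t ht => ⟨(hcurve h₁ ht (hγ t ht).1).hasDerivAt (Ioo_mem_nhds ht.1 ht.2),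
        (hγ t ht).1.2⟩)
      (fun t ht => ⟨(hcurve h₂ ht (hγ t ht).2).hasDerivAt (Ioo_mem_nhds ht.1 ht.2),
        (hγ t ht).2.2⟩) (by simp [h0])
    exact fun t ht => χ.injOn (hγ t ht).1.1 (hγ t ht).2.1 (this ht)
  -- The version on a closed interval, with data at its left end, is needed because the reference
  -- curve `l` is an integral curve only on `Ici 0`.
  · intro γ₁ γ₂ a b h₁ h₂ hγ h0
    have hd : ∀ {γ : ℝ → N}, IsMIntegralCurveOn γ X (Icc a b) → (∀ t ∈ Icc a b, γ t ∈ U) →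
        ∀ t ∈ Ico a b, HasDerivWithinAt (fun τ => χ (γ τ)) (chartField x₀ X (χ (γ t))) (Ici t) t := by
      intro γ h hγ t ht
      refine (hcurve h (Ico_subset_Icc_self ht) (hγ t (Ico_subset_Icc_self ht))).mono_of_mem_nhdsWithin
        ?_
      exact Filter.mem_of_superset (Icc_mem_nhdsGE ht.2) (Icc_subset_Icc_left ht.1)
    have := ODE_solution_unique_of_mem_Icc_right (v := fun _ => chartField x₀ X) (s := fun _ => B)
      (K := K) (f := fun τ => χ (γ₁ τ)) (g := fun τ => χ (γ₂ τ)) (a := a) (b := b)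
      (fun t _ => hK.mono fun z hz => (hBs hz).1)
      (fun t ht => (hcurve h₁ ht (hγ t ht).1).continuousWithinAt)
      (hd h₁ fun t ht => (hγ t ht).1)
      (fun t ht => (hγ t (Ico_subset_Icc_self ht)).1.2)
      (fun t ht => (hcurve h₂ ht (hγ t ht).2).continuousWithinAt)
      (hd h₂ fun t ht => (hγ t ht).2)
      (fun t ht => (hγ t (Ico_subset_Icc_self ht)).2.2) (by simp [h0])
    exact fun t ht => χ.injOn (hγ t ht).1.1 (hγ t ht).2.1 (this ht)
  · obtain ⟨η, hη, r, hr, Φ, hΦ, hΦ'⟩ := exists_contDiffOn_local_flow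
      (hXat.of_le (WithTop.coe_le_coe.2 le_top : (2 : WithTop ℕ∞) ≤ ∞))
    have hz : ((0, χ x₀) : ℝ × E) ∈ Ioo (-η) η ×ˢ Metric.ball (χ x₀) r :=
      ⟨⟨by linarith, hη⟩, Metric.mem_ball_self hr⟩
    have hO : IsOpen (Ioo (-η) η ×ˢ Metric.ball (χ x₀) r) := isOpen_Ioo.prod Metric.isOpen_ball
    have hin : ∀ᶠ z in 𝓝 ((0, χ x₀) : ℝ × E), Φ z ∈ B := by
      refine (hΦ.continuousOn.continuousAt (hO.mem_nhds hz)).eventually (hBo.mem_nhds ?_)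
      rw [(hΦ' _ hz.2).1]
      exact hBx
    obtain ⟨d, hd, hdB⟩ := Metric.eventually_nhds_iff_ball.1 hin
    have hmem : ∀ t ∈ Ioo (-(min η d)) (min η d), ∀ y ∈ Metric.ball (χ x₀) (min r d),
        (t, y) ∈ Ioo (-η) η ×ˢ Metric.ball (χ x₀) r ∧ Φ (t, y) ∈ B := by
      intro t ht y hy
      refine ⟨⟨⟨?_, ?_⟩, ?_⟩, ?_⟩
      · linarith [ht.1, min_le_left η d]
      · linarith [ht.2, min_le_left η d]
      · exact Metric.ball_subset_ball (min_le_left _ _) hy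
      · refine hdB _ ?_
        rw [Metric.mem_ball, Prod.dist_eq, max_lt_iff, Real.dist_eq, abs_lt]
        refine ⟨⟨?_, ?_⟩, (Metric.mem_ball.1 hy).trans_le (min_le_right _ _)⟩ <;>
          simp only [sub_zero] <;> linarith [ht.1, ht.2, min_le_right η d]
    have h0m : (0 : ℝ) ∈ Ioo (-(min η d)) (min η d) := by
      have := lt_min hη hd
      exact ⟨by linarith, this⟩
    have hsymm : ∀ t ∈ Ioo (-(min η d)) (min η d), ∀ ν ∈ χ.source ∩ χ ⁻¹' Metric.ball (χ x₀) (min r d),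
        Φ (t, χ ν) ∈ χ.target := fun t ht ν hν => (hBs (hmem t ht _ hν.2).2).2.1
    refine ⟨min η d, lt_min hη hd, χ.source ∩ χ ⁻¹' Metric.ball (χ x₀) (min r d),
      (continuousOn_extChartAt x₀).isOpen_inter_preimage (isOpen_extChartAt_source x₀)
        Metric.isOpen_ball, ⟨hx₀s, Metric.mem_ball_self (lt_min hr hd)⟩, ?_,
      fun z => χ.symm (Φ (z.1, χ z.2)), ?_, ?_⟩
    · intro ν hν
      refine ⟨hν.1, ?_⟩
      have := (hmem 0 h0m _ hν.2).2
      rwa [(hΦ' _ (hmem 0 h0m _ hν.2).1.2).1] at this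
    · rintro ⟨t, ν⟩ ⟨ht, hν⟩
      apply ContMDiffAt.contMDiffWithinAt
      have h1 : ContMDiffAt (𝓘(ℝ, ℝ).prod I) 𝓘(ℝ, ℝ × E) 1 (fun z : ℝ × N => (z.1, χ z.2)) (t, ν) := by
        refine contMDiffAt_fst.prodMk_space ?_
        exact ((contMDiffAt_extChartAt_of_mem hν.1).of_le (by simp)).comp (t, ν) contMDiffAt_snd
      have h2 : ContMDiffAt 𝓘(ℝ, ℝ × E) 𝓘(ℝ, E) 1 Φ (t, χ ν) :=
        (hΦ.contDiffAt (hO.mem_nhds (hmem t ht _ hν.2).1)).contMDiffAt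
      have h3 : ContMDiffAt 𝓘(ℝ, E) I 1 χ.symm (Φ (t, χ ν)) :=
        (contMDiffAt_extChartAt_symm (hsymm t ht ν hν)).of_le (by simp)
      have h4 := h2.comp (t, ν) h1
      exact ContMDiffAt.comp (I' := 𝓘(ℝ, E)) (g := χ.symm) (t, ν) h3 h4
    · intro ν hν
      refine ⟨?_, ?_, ?_⟩
      · simp only [(hΦ' _ (hmem 0 h0m _ hν.2).1.2).1]
        exact χ.left_inv hν.1
      · intro t ht
        have hm := (hmem t ht _ hν.2).1
        exact (HasDerivAt.hasMFDerivAt_extChartAt_symm (c := fun t => Φ (t, χ ν)) (hsymm t ht ν hν)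
          ((hΦ' _ hm.2).2 t hm.1)).hasMFDerivWithinAt
      · intro t ht
        refine ⟨χ.map_target (hsymm t ht ν hν), ?_⟩
        rw [mem_preimage, χ.right_inv (hsymm t ht ν hν)]
        exact (hmem t ht _ hν.2).2

end Families

/-! ### Continuation of a family of integral curves over a compact time interval. -/

section FamilyExtension

variable {E : Type*} [NormedAddCommGroup E] [NormedSpace ℝ E] [CompleteSpace E]
  {H : Type*} [TopologicalSpace H] {I : ModelWithCorners ℝ E H} [I.Boundaryless]
  {N : Type*} [TopologicalSpace N] [ChartedSpace H N] [IsManifold I ∞ N]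

/-- `Λ` is a `C¹` family of integral curves of `X`, around the integral curve `l` on `[0, T]`,
with the initial points `c ε`. -/
structure IsCurveFamily (X : ∀ x : N, TangentSpace I x) (l c : ℝ → N) (T δ : ℝ) (Λ : ℝ × ℝ → N) :
    Prop where
  contMDiffOn : ContMDiffOn 𝓘(ℝ, ℝ × ℝ) I 1 Λ (Ioo (-δ) (T + δ) ×ˢ Ioo (-δ) δ)
  initial : ∀ ε ∈ Ioo (-δ) δ, Λ (0, ε) = c ε
  integral : ∀ ε ∈ Ioo (-δ) δ, IsMIntegralCurveOn (fun τ => Λ (τ, ε)) X (Ioo (-δ) (T + δ))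
  central : ∀ τ ∈ Icc 0 T, Λ (τ, 0) = l τ

theorem IsMIntegralCurveOn.shift {X : ∀ x : N, TangentSpace I x} {γ : ℝ → N} {s : Set ℝ}
    (h : IsMIntegralCurveOn γ X s) (a : ℝ) {s' : Set ℝ} (hs : ∀ t ∈ s', t - a ∈ s) :
    IsMIntegralCurveOn (fun t => γ (t - a)) X s' := by
  have := h.comp_add (-a)
  refine IsMIntegralCurveOn.mono (s := {t | t + -a ∈ s})
    (by simpa [Function.comp_def, sub_eq_add_neg] using this) ?_
  intro t ht
  simpa [sub_eq_add_neg] using hs t ht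

theorem IsMIntegralCurveOn.hasMFDerivAt_of_mem_Ioo {X : ∀ x : N, TangentSpace I x} {γ : ℝ → N}
    {a b t : ℝ} (h : IsMIntegralCurveOn γ X (Ioo a b)) (ht : t ∈ Ioo a b) :
    HasMFDerivAt 𝓘(ℝ, ℝ) I γ t ((1 : ℝ →L[ℝ] ℝ).smulRight (X (γ t))) :=
  (h t ht).hasMFDerivAt (Ioo_mem_nhds ht.1 ht.2)

theorem HasMFDerivAt.congr_integralCurve {X : ∀ x : N, TangentSpace I x} {γ γ' : ℝ → N} {t : ℝ}
    (h : HasMFDerivAt 𝓘(ℝ, ℝ) I γ t ((1 : ℝ →L[ℝ] ℝ).smulRight (X (γ t)))) (hγ : γ' =ᶠ[𝓝 t] γ) :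
    HasMFDerivAt 𝓘(ℝ, ℝ) I γ' t ((1 : ℝ →L[ℝ] ℝ).smulRight (X (γ' t))) := by
  have key : ∀ w : E, w = (X (γ t) : E) →
      HasMFDerivAt 𝓘(ℝ, ℝ) I γ' t ((1 : ℝ →L[ℝ] ℝ).smulRight w : ℝ →L[ℝ] E) := by
    rintro w rfl
    exact h.congr_of_eventuallyEq hγ
  exact key _ (congrArg (fun z => (X z : E)) hγ.eq_of_nhds)

/-- One continuation step. Beyond `T₁` the family is replaced by the local flow issued from `Λ₁ (T₁,
ε)`. Uniqueness in `U` makes both families agree on an open time interval around `T₁`, so the glued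
family is still `C¹`. -/
theorem IsCurveFamily.exists_extension {X : ∀ x : N, TangentSpace I x} {l c : ℝ → N}
    {U W : Set N} {η : ℝ} {Φ : ℝ × N → N}
    (huniq : ∀ (γ₁ γ₂ : ℝ → N) (a b t₀ : ℝ), t₀ ∈ Ioo a b → IsMIntegralCurveOn γ₁ X (Ioo a b) →
        IsMIntegralCurveOn γ₂ X (Ioo a b) → (∀ t ∈ Ioo a b, γ₁ t ∈ U ∧ γ₂ t ∈ U) →
        γ₁ t₀ = γ₂ t₀ → EqOn γ₁ γ₂ (Ioo a b))
    (huniqr : ∀ (γ₁ γ₂ : ℝ → N) (a b : ℝ), IsMIntegralCurveOn γ₁ X (Icc a b) →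
        IsMIntegralCurveOn γ₂ X (Icc a b) → (∀ t ∈ Icc a b, γ₁ t ∈ U ∧ γ₂ t ∈ U) →
        γ₁ a = γ₂ a → EqOn γ₁ γ₂ (Icc a b))
    (hη : 0 < η) (hWo : IsOpen W) (hWU : W ⊆ U)
    (hΦ : ContMDiffOn (𝓘(ℝ, ℝ).prod I) I 1 Φ (Ioo (-η) η ×ˢ W))
    (hΦ' : ∀ ν ∈ W, Φ (0, ν) = ν ∧ IsMIntegralCurveOn (fun t => Φ (t, ν)) X (Ioo (-η) η) ∧
          ∀ t ∈ Ioo (-η) η, Φ (t, ν) ∈ U)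
    (hl : IsMIntegralCurveOn l X (Ici 0)) {T₁ T₂ δ₁ : ℝ} {Λ₁ : ℝ × ℝ → N} (hT₁ : 0 ≤ T₁)
    (hT : T₁ ≤ T₂) (hT₂ : T₂ < T₁ + η) (hlW : ∀ t ∈ Icc T₁ T₂, l t ∈ W) (hδ₁ : 0 < δ₁)
    (hΛ : IsCurveFamily X l c T₁ δ₁ Λ₁) :
    ∃ δ > 0, ∃ Λ, IsCurveFamily X l c T₂ δ Λ := by
  have hc1 : Λ₁ (T₁, 0) = l T₁ := hΛ.central T₁ ⟨hT₁, le_rfl⟩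
  have hO₁ : IsOpen (Ioo (-δ₁) (T₁ + δ₁) ×ˢ Ioo (-δ₁) δ₁) := isOpen_Ioo.prod isOpen_Ioo
  have hz₁ : ((T₁, 0) : ℝ × ℝ) ∈ Ioo (-δ₁) (T₁ + δ₁) ×ˢ Ioo (-δ₁) δ₁ :=
    ⟨⟨by linarith, by linarith⟩, by linarith, hδ₁⟩
  have hin : ∀ᶠ z in 𝓝 ((T₁, 0) : ℝ × ℝ), Λ₁ z ∈ W := by
    refine (hΛ.contMDiffOn.continuousOn.continuousAt (hO₁.mem_nhds hz₁)).eventually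
      (hWo.mem_nhds ?_)
    rw [hc1]
    exact hlW T₁ ⟨le_rfl, hT⟩
  obtain ⟨d, hd, hdW⟩ := Metric.eventually_nhds_iff_ball.1 hin
  -- The bounds keep the new family inside the domain of the old one, its values near `T₁` inside
  -- `W`, and the times up to `T₂ + δ` within the lifetime `η` of the flow box.
  obtain ⟨δ, hδ, hδδ₁, hδd, hδη, hδT⟩ : ∃ δ > 0, δ ≤ δ₁ ∧ δ ≤ d ∧ δ ≤ η ∧ T₂ + δ ≤ T₁ + η :=
    ⟨min (min δ₁ d) (min η (T₁ + η - T₂)), by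
      refine lt_min (lt_min hδ₁ hd) (lt_min hη (by linarith)),
      (min_le_left _ _).trans (min_le_left _ _), (min_le_left _ _).trans (min_le_right _ _),
      (min_le_right _ _).trans (min_le_left _ _), by
        have := (min_le_right (min δ₁ d) (min η (T₁ + η - T₂))).trans (min_le_right _ _)
        linarith⟩
  have hW' : ∀ τ ∈ Ioo (T₁ - δ) (T₁ + δ), ∀ ε ∈ Ioo (-δ) δ, Λ₁ (τ, ε) ∈ W := by
    intro τ hτ ε hε
    apply hdW
    rw [Metric.mem_ball, Prod.dist_eq, max_lt_iff, Real.dist_eq, Real.dist_eq, abs_lt, abs_lt]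
    refine ⟨⟨?_, ?_⟩, ?_, ?_⟩ <;> simp only [sub_zero] <;> linarith [hτ.1, hτ.2, hε.1, hε.2]
  have hT₁m : T₁ ∈ Ioo (T₁ - δ) (T₁ + δ) := ⟨by linarith, by linarith⟩
  have hsub : Ioo (-δ) δ ⊆ Ioo (-δ₁) δ₁ := Ioo_subset_Ioo (by linarith) hδδ₁
  set Ψ : ℝ × ℝ → N := fun z => Φ (z.1 - T₁, Λ₁ (T₁, z.2)) with hΨ
  have hΨint : ∀ ε ∈ Ioo (-δ) δ, IsMIntegralCurveOn (fun τ => Ψ (τ, ε)) X (Ioo (T₁ - η) (T₁ + η)) :=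
    fun ε hε => (hΦ' _ (hW' T₁ hT₁m ε hε)).2.1.shift T₁ fun t ht =>
      ⟨by linarith [ht.1], by linarith [ht.2]⟩
  have hΨU : ∀ ε ∈ Ioo (-δ) δ, ∀ τ ∈ Ioo (T₁ - η) (T₁ + η), Ψ (τ, ε) ∈ U := fun ε hε τ hτ =>
    (hΦ' _ (hW' T₁ hT₁m ε hε)).2.2 _ ⟨by linarith [hτ.1], by linarith [hτ.2]⟩
  have hΨ0 : ∀ ε ∈ Ioo (-δ) δ, Ψ (T₁, ε) = Λ₁ (T₁, ε) := fun ε hε => by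
    simp only [hΨ, sub_self]
    exact (hΦ' _ (hW' T₁ hT₁m ε hε)).1
  -- on the overlap the two families agree
  set a := max (T₁ - δ) (-δ) with ha
  have haT : a < T₁ := max_lt (by linarith) (by linarith)
  have hov : ∀ ε ∈ Ioo (-δ) δ, ∀ τ ∈ Ioo a (T₁ + δ), Λ₁ (τ, ε) = Ψ (τ, ε) := by
    intro ε hε τ hτ
    have ha1 : T₁ - δ ≤ a := le_max_left _ _
    have ha2 : -δ ≤ a := le_max_right _ _
    refine huniq (fun τ => Λ₁ (τ, ε)) (fun τ => Ψ (τ, ε)) a (T₁ + δ) T₁ ⟨haT, by linarith⟩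
      ((hΛ.integral ε (hsub hε)).mono (Ioo_subset_Ioo (by linarith) (by linarith)))
      ((hΨint ε hε).mono (Ioo_subset_Ioo (by linarith) (by linarith))) (fun t ht => ⟨?_, ?_⟩)
      (hΨ0 ε hε).symm hτ
    · exact hWU (hW' t ⟨by linarith [ht.1], ht.2⟩ ε hε)
    · exact hΨU ε hε t ⟨by linarith [ht.1], by linarith [ht.2]⟩
  have hΨsm : ∀ ε ∈ Ioo (-δ) δ, ∀ τ ∈ Ioo (T₁ - η) (T₁ + η),
      ContMDiffAt 𝓘(ℝ, ℝ × ℝ) I 1 Ψ (τ, ε) := by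
    intro ε hε τ hτ
    have h1 : ContMDiffAt 𝓘(ℝ, ℝ × ℝ) 𝓘(ℝ, ℝ) 1 (fun z : ℝ × ℝ => z.1 - T₁) (τ, ε) :=
      ContDiffAt.contMDiffAt (by fun_prop)
    have h2 : ContMDiffAt 𝓘(ℝ, ℝ × ℝ) 𝓘(ℝ, ℝ × ℝ) 1 (fun z : ℝ × ℝ => ((T₁, z.2) : ℝ × ℝ)) (τ, ε) :=
      ContDiffAt.contMDiffAt (by fun_prop)
    have hm : ((T₁, ε) : ℝ × ℝ) ∈ Ioo (-δ₁) (T₁ + δ₁) ×ˢ Ioo (-δ₁) δ₁ := ⟨hz₁.1, hsub hε⟩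
    have h3 : ContMDiffAt 𝓘(ℝ, ℝ × ℝ) I 1 Λ₁ (T₁, ε) := hΛ.contMDiffOn.contMDiffAt (hO₁.mem_nhds hm)
    have h4 : ContMDiffAt 𝓘(ℝ, ℝ × ℝ) I 1 (fun z : ℝ × ℝ => Λ₁ (T₁, z.2)) (τ, ε) :=
      ContMDiffAt.comp (I' := 𝓘(ℝ, ℝ × ℝ)) (g := Λ₁) (τ, ε) h3 h2
    have h5 : ContMDiffAt (𝓘(ℝ, ℝ).prod I) I 1 Φ (τ - T₁, Λ₁ (T₁, ε)) :=
      hΦ.contMDiffAt ((isOpen_Ioo.prod hWo).mem_nhds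
        ⟨⟨by linarith [hτ.1], by linarith [hτ.2]⟩, hW' T₁ hT₁m ε hε⟩)
    exact ContMDiffAt.comp (I' := 𝓘(ℝ, ℝ).prod I) (g := Φ) (τ, ε) h5 (h1.prodMk h4)
  set Λ : ℝ × ℝ → N := fun z => if z.1 < T₁ then Λ₁ z else Ψ z with hΛdef
  have hΛ1 : ∀ ε ∈ Ioo (-δ) δ, ∀ τ < T₁ + δ, Λ (τ, ε) = Λ₁ (τ, ε) := by
    intro ε hε τ hτ
    by_cases h : τ < T₁
    · simp [hΛdef, h]
    · simp only [hΛdef, h, if_false]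
      exact (hov ε hε τ ⟨by linarith, hτ⟩).symm
  have hΛ2 : ∀ ε ∈ Ioo (-δ) δ, ∀ τ, a < τ → Λ (τ, ε) = Ψ (τ, ε) := by
    intro ε hε τ hτ
    by_cases h : τ < T₁
    · simp only [hΛdef, h, if_true]
      exact hov ε hε τ ⟨hτ, by linarith⟩
    · simp [hΛdef, h]
  have haη : T₁ - η ≤ a := le_trans (by linarith) (le_max_left _ _)
  refine ⟨δ, hδ, Λ, ⟨?_, ?_, ?_, ?_⟩⟩
  · rintro ⟨τ, ε⟩ ⟨hτ, hε⟩
    apply ContMDiffAt.contMDiffWithinAt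
    by_cases h : τ < T₁ + δ
    · have hm : ((τ, ε) : ℝ × ℝ) ∈ Ioo (-δ₁) (T₁ + δ₁) ×ˢ Ioo (-δ₁) δ₁ :=
        ⟨⟨by linarith [hτ.1], by linarith⟩, hsub hε⟩
      refine (hΛ.contMDiffOn.contMDiffAt (hO₁.mem_nhds hm)).congr_of_eventuallyEq ?_
      filter_upwards [(isOpen_Iio.prod isOpen_Ioo).mem_nhds
        (show ((τ, ε) : ℝ × ℝ) ∈ Iio (T₁ + δ) ×ˢ Ioo (-δ) δ from ⟨h, hε⟩)] with z hz
      exact hΛ1 z.2 hz.2 z.1 hz.1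
    · have h' : a < τ := by linarith
      refine (hΨsm ε hε τ ⟨by linarith, by linarith [hτ.2]⟩).congr_of_eventuallyEq ?_
      filter_upwards [(isOpen_Ioi.prod isOpen_Ioo).mem_nhds
        (show ((τ, ε) : ℝ × ℝ) ∈ Ioi a ×ˢ Ioo (-δ) δ from ⟨h', hε⟩)] with z hz
      exact hΛ2 z.2 hz.2 z.1 hz.1
  · intro ε hε
    rw [hΛ1 ε hε 0 (by linarith)]
    exact hΛ.initial ε (hsub hε)
  · intro ε hε τ hτ
    apply HasMFDerivAt.hasMFDerivWithinAt
    by_cases h : τ < T₁ + δ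
    · have h1 := (hΛ.integral ε (hsub hε)).hasMFDerivAt_of_mem_Ioo
        (t := τ) ⟨by linarith [hτ.1], by linarith⟩
      refine h1.congr_integralCurve ?_
      filter_upwards [isOpen_Iio.mem_nhds h] with s hs using hΛ1 ε hε s hs
    · have h' : a < τ := by linarith
      have h1 := (hΨint ε hε).hasMFDerivAt_of_mem_Ioo (t := τ) ⟨by linarith, by linarith [hτ.2]⟩
      refine h1.congr_integralCurve ?_
      filter_upwards [isOpen_Ioi.mem_nhds h'] with s hs using hΛ2 ε hε s hs
  · intro τ hτ
    have h0 : (0 : ℝ) ∈ Ioo (-δ) δ := ⟨by linarith, hδ⟩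
    by_cases h : τ < T₁
    · rw [hΛ1 0 h0 τ (by linarith)]
      exact hΛ.central τ ⟨hτ.1, h.le⟩
    · rw [hΛ2 0 h0 τ (by linarith)]
      refine huniqr (fun τ => Ψ (τ, 0)) l T₁ T₂
        ((hΨint 0 h0).mono fun t ht => ⟨by linarith [ht.1], by linarith [ht.2]⟩)
        (hl.mono fun t ht => hT₁.trans ht.1)
        (fun t ht => ⟨hΨU 0 h0 t ⟨by linarith [ht.1], by linarith [ht.2]⟩, hWU (hlW t ht)⟩)
        ((hΨ0 0 h0).trans hc1) ⟨by linarith, hτ.2⟩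

/-- A `C¹` curve of initial points through `l 0` extends to a `C¹` family of integral curves
around the integral curve `l`, on any time interval `[0, T]`. -/
theorem exists_isCurveFamily {X : ∀ x : N, TangentSpace I x} {D : Set N} (hD : IsOpen D)
    (hX : ContMDiffOn I I.tangent ∞ (fun x => (⟨x, X x⟩ : TangentBundle I N)) D)
    {l c : ℝ → N} (hl : IsMIntegralCurveOn l X (Ici 0)) (hlD : ∀ t, 0 ≤ t → l t ∈ D)
    {δ₀ : ℝ} (hδ₀ : 0 < δ₀) (hc : ContMDiffOn 𝓘(ℝ, ℝ) I 1 c (Ioo (-δ₀) δ₀)) (hc0 : c 0 = l 0)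
    {T : ℝ} (hT : 0 ≤ T) : ∃ δ > 0, ∃ Λ, IsCurveFamily X l c T δ Λ := by
  choose U _ huniq huniqr η hη W hWo hxW hWU Φ hΦ hΦ' using fun t : Icc 0 T =>
    exists_flow_box hD hX (hlD t t.2.1)
  have hlc : Continuous fun t : Icc 0 T => l t := by
    have : ContinuousOn l (Icc 0 T) := hl.continuousOn.mono fun t ht => ht.1
    exact continuousOn_iff_continuous_domRestrict.1 this
  -- A subdivision of `[0, T]` such that `l` stays in a single flow box on each piece. Both ends of
  -- a piece are within `η i / 2` of `i`, so the piece is shorter than `η i`.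
  obtain ⟨t, ht0, htm, ⟨m, hm⟩, htc⟩ := exists_monotone_Icc_subset_open_cover_Icc hT
    (c := fun i : Icc 0 T => {s : Icc 0 T | l s ∈ W i ∧ |(s : ℝ) - i| < η i / 2})
    (fun i => by
      refine IsOpen.inter (hWo i |>.preimage hlc) ?_
      exact isOpen_lt (f := fun s : Icc 0 T => |(s : ℝ) - i|) (by fun_prop) continuous_const)
    (fun s _ => mem_iUnion.2 ⟨s, hxW s, by simpa using half_pos (hη s)⟩)
  have hgood : ∀ n, ∃ δ > 0, ∃ Λ, IsCurveFamily X l c (t n) δ Λ := by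
    intro n
    induction n with
    | zero =>
      rw [ht0]
      set i : Icc 0 T := ⟨0, le_rfl, hT⟩ with hi
      have hcont : ContinuousAt c 0 :=
        hc.continuousOn.continuousAt (Ioo_mem_nhds (by linarith) hδ₀)
      have hin : ∀ᶠ ε in 𝓝 (0 : ℝ), c ε ∈ W i := by
        refine hcont.eventually ((hWo i).mem_nhds ?_)
        rw [hc0]
        exact hxW i
      obtain ⟨d, hd, hdW⟩ := Metric.eventually_nhds_iff_ball.1 hin
      obtain ⟨δ, hδ, hδ1, hδ2, hδ3⟩ : ∃ δ > 0, δ ≤ δ₀ ∧ δ ≤ d ∧ δ ≤ η i :=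
        ⟨min (min δ₀ d) (η i), lt_min (lt_min hδ₀ hd) (hη i),
          (min_le_left _ _).trans (min_le_left _ _), (min_le_left _ _).trans (min_le_right _ _),
          min_le_right _ _⟩
      have hcW : ∀ ε ∈ Ioo (-δ) δ, c ε ∈ W i := by
        intro ε hε
        apply hdW
        rw [Metric.mem_ball, Real.dist_eq, abs_lt]
        constructor <;> linarith [hε.1, hε.2]
      refine ⟨δ, hδ, fun z => Φ i (z.1, c z.2), ?_, ?_, ?_, ?_⟩
      · rintro ⟨τ, ε⟩ ⟨hτ, hε⟩
        simp only [zero_add] at hτ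
        apply ContMDiffAt.contMDiffWithinAt
        have h1 : ContMDiffAt 𝓘(ℝ, ℝ × ℝ) 𝓘(ℝ, ℝ) 1 (fun z : ℝ × ℝ => z.1) (τ, ε) :=
          ContDiffAt.contMDiffAt (by fun_prop)
        have h2 : ContMDiffAt 𝓘(ℝ, ℝ × ℝ) 𝓘(ℝ, ℝ) 1 (fun z : ℝ × ℝ => z.2) (τ, ε) :=
          ContDiffAt.contMDiffAt (by fun_prop)
        have h3 : ContMDiffAt 𝓘(ℝ, ℝ) I 1 c ε :=
          hc.contMDiffAt (Ioo_mem_nhds (by linarith [hε.1]) (by linarith [hε.2]))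
        have h4 : ContMDiffAt 𝓘(ℝ, ℝ × ℝ) I 1 (fun z : ℝ × ℝ => c z.2) (τ, ε) :=
          ContMDiffAt.comp (I' := 𝓘(ℝ, ℝ)) (g := c) (τ, ε) h3 h2
        have h5 : ContMDiffAt (𝓘(ℝ, ℝ).prod I) I 1 (Φ i) (τ, c ε) :=
          (hΦ i).contMDiffAt ((isOpen_Ioo.prod (hWo i)).mem_nhds
            ⟨⟨by linarith [hτ.1], by linarith [hτ.2]⟩, hcW ε hε⟩)
        exact ContMDiffAt.comp (I' := 𝓘(ℝ, ℝ).prod I) (g := Φ i) (τ, ε) h5 (h1.prodMk h4)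
      · exact fun ε hε => (hΦ' i _ (hcW ε hε)).1
      · intro ε hε
        exact (hΦ' i _ (hcW ε hε)).2.1.mono (Ioo_subset_Ioo (by linarith) (by simpa using hδ3))
      · intro τ hτ
        have h0 : τ = 0 := le_antisymm hτ.2 hτ.1
        subst h0
        simp only [hc0]
        exact (hΦ' i _ (hxW i)).1
    | succ n ih =>
      obtain ⟨δ₁, hδ₁, Λ₁, hΛ₁⟩ := ih
      obtain ⟨i, hi⟩ := htc n
      have hle : t n ≤ t (n + 1) := htm n.le_succ
      have h1 := hi (left_mem_Icc.2 hle)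
      have h2 := hi (right_mem_Icc.2 hle)
      refine hΛ₁.exists_extension (huniq i) (huniqr i) (hη i) (hWo i) (hWU i) (hΦ i) (hΦ' i)
        hl (t n).2.1 hle ?_ ?_ hδ₁
      · have := abs_lt.1 h1.2
        have := abs_lt.1 h2.2
        linarith
      · intro s hs
        exact (hi (a := ⟨s, (t n).2.1.trans hs.1, hs.2.trans (t (n + 1)).2.2⟩) ⟨hs.1, hs.2⟩).1
  have := hgood m
  rwa [hm m le_rfl] at this

end FamilyExtension

set_option maxSynthPendingDepth 3

/-! ### The linear symplectic space `E2 × E2*` -/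

section LinearSymplectic

/-- The model space of the cotangent bundle: positions and momenta. -/
abbrev PhaseSpace : Type := E2 × (E2 →L[ℝ] ℝ)

open ContinuousLinearMap in
/-- The bilinear map `(a, b) ↦ ⟨p(a), q(b)⟩`; as a function of `a` it is the Liouville form. -/
noncomputable def pairing : PhaseSpace →L[ℝ] PhaseSpace →L[ℝ] ℝ :=
  ((compL ℝ PhaseSpace E2 ℝ).flip (fst ℝ E2 (E2 →L[ℝ] ℝ))).comp (snd ℝ E2 (E2 →L[ℝ] ℝ))

@[simp] theorem pairing_apply (a b : PhaseSpace) : pairing a b = a.2 b.1 := rfl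

/-- The standard symplectic form `dp ∧ dq`. -/
noncomputable def omega : PhaseSpace →L[ℝ] PhaseSpace →L[ℝ] ℝ := pairing - pairing.flip

theorem omega_apply (a b : PhaseSpace) : omega a b = a.2 b.1 - b.2 a.1 := rfl

theorem omega_swap (a b : PhaseSpace) : omega a b = -omega b a := by
  simp [omega_apply]

@[simp] theorem omega_self (a : PhaseSpace) : omega a a = 0 := by
  simp [omega_apply]

theorem omega_of_fst_eq_zero {a : PhaseSpace} (ha : a.1 = 0) (b : PhaseSpace) :
    omega a b = a.2 b.1 := by
  simp [omega_apply, ha]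

theorem covector_eq_sum (p : E2 →L[ℝ] ℝ) :
    p = ∑ i, p (EuclideanSpace.single i 1) • (EuclideanSpace.proj i : E2 →L[ℝ] ℝ) := by
  ext v
  have hv : v = ∑ i, v i • EuclideanSpace.single i (1 : ℝ) := by
    ext j
    fin_cases j <;> simp
  conv_lhs => rw [hv]
  simp [mul_comm]

theorem omega_left_injective {X Y : PhaseSpace} (h : ∀ w, omega w X = omega w Y) : X = Y := by
  refine Prod.ext ?_ ?_
  · ext i
    have := h (0, EuclideanSpace.proj i)
    simpa [omega_apply] using this
  · ext v
    have := h (v, 0)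
    simpa [omega_apply] using this

/-- The symplectic gradient: the solution of `omega w (sharp L) = L w`. -/
noncomputable def sharp : (PhaseSpace →L[ℝ] ℝ) →L[ℝ] PhaseSpace :=
  LinearMap.toContinuousLinearMap
    { toFun := fun L => (WithLp.toLp 2 fun i => L (0, EuclideanSpace.proj i),
        -L.comp (ContinuousLinearMap.inl ℝ E2 (E2 →L[ℝ] ℝ)))
      map_add' := fun L L' => by
        refine Prod.ext ?_ ?_
        · ext i; simp
        · ext v; simp; ring
      map_smul' := fun c L => by
        refine Prod.ext ?_ ?_
        · ext i; simp
        · ext v; simp }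

theorem omega_sharp (L : PhaseSpace →L[ℝ] ℝ) (w : PhaseSpace) : omega w (sharp L) = L w := by
  have h1 : w.2 (sharp L).1 = L (0, w.2) := by
    have h : ∀ i, (sharp L).1 i = L (0, EuclideanSpace.proj i) := fun i => rfl
    rw [covector_eq_sum w.2]
    rw [Fin.sum_univ_two]
    have h2 : ((0, w.2 (EuclideanSpace.single 0 1) • (EuclideanSpace.proj 0 : E2 →L[ℝ] ℝ) +
        w.2 (EuclideanSpace.single 1 1) • (EuclideanSpace.proj 1 : E2 →L[ℝ] ℝ)) : PhaseSpace) =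
        w.2 (EuclideanSpace.single 0 1) • (0, (EuclideanSpace.proj 0 : E2 →L[ℝ] ℝ)) +
        w.2 (EuclideanSpace.single 1 1) • (0, (EuclideanSpace.proj 1 : E2 →L[ℝ] ℝ)) := by
      simp
    rw [h2, map_add, map_smul, map_smul, ← h, ← h]
    simp
  have h2 : (sharp L).2 w.1 = -L (w.1, 0) := rfl
  rw [omega_apply, h1, h2, sub_neg_eq_add, ← map_add]
  simp

/-- Hamilton's equation `q' = ∂H/∂p`: the velocity is read off from derivatives along the fibre. -/
theorem sharp_fst (L : PhaseSpace →L[ℝ] ℝ) (ξ : E2 →L[ℝ] ℝ) : ξ (sharp L).1 = L (0, ξ) := by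
  have := omega_sharp L (0, ξ)
  simpa [omega_apply] using this

end LinearSymplectic

/-! ### Canonical coordinates on the cotangent bundle -/

section CanonicalCoordinates

variable {M : Type*} [TopologicalSpace M] [ChartedSpace E2 M] [IsManifold 𝓘(ℝ, E2) ∞ M]

theorem mem_cot_extChartAt_source {μ ν : CoT M} :
    ν ∈ (extChartAt ICoT μ).source ↔ ν.1 ∈ (extChartAt 𝓘(ℝ, E2) μ.1).source := by
  rw [extChartAt_source, extChartAt_source]
  have hb : (trivializationAt (E2 →L[ℝ] ℝ)
      (fun q : M => TangentSpace 𝓘(ℝ, E2) q →L[ℝ] Trivial M ℝ q) μ.1).baseSet =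
      (chartAt E2 μ.1).source := by
    rw [hom_trivializationAt_baseSet]
    simp
  rw [FiberBundle.chartedSpace_chartAt, OpenPartialHomeomorph.trans_source]
  constructor
  · intro h
    have h1 := (Trivialization.mem_source _).1 h.1
    rwa [hb] at h1
  · intro h
    have h1 : ν ∈ (trivializationAt (E2 →L[ℝ] ℝ)
      (fun q : M => TangentSpace 𝓘(ℝ, E2) q →L[ℝ] Trivial M ℝ q) μ.1).source := by
      rw [Trivialization.mem_source, hb]
      exact h
    refine ⟨h1, ?_, mem_univ _⟩
    have h2 := Trivialization.coe_fst _ h1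
    rw [← h2] at h
    exact h

theorem cot_extChartAt_fst (μ ν : CoT M) :
    (extChartAt ICoT μ ν).1 = extChartAt 𝓘(ℝ, E2) μ.1 ν.1 := by
  exact congrArg Prod.fst (hom_chart (HB := E2) μ ν)

/-- The momentum coordinate is the covector transported by the chart of the base, so its pairing
with a transported vector is unchanged. This makes the bundle charts canonical coordinates. -/
theorem cot_extChartAt_snd {μ ν : CoT M} (hν : ν ∈ (extChartAt ICoT μ).source)
    (u : TangentSpace 𝓘(ℝ, E2) ν.1) :
    (extChartAt ICoT μ ν).2 (dChart 𝓘(ℝ, E2) μ.1 ν.1 u) = ν.2 u := by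
  rw [mem_cot_extChartAt_source] at hν
  have h1 : extChartAt ICoT μ ν = chartAt (ModelProd E2 (E2 →L[ℝ] ℝ)) μ ν := rfl
  have hb : ν.1 ∈ (trivializationAt E2 (TangentSpace 𝓘(ℝ, E2)) μ.1).baseSet := by simpa using hν
  rw [h1, hom_chart, ContinuousLinearMap.inCoordinates, ContinuousLinearMap.comp_apply,
    ContinuousLinearMap.comp_apply]
  have h2 : dChart 𝓘(ℝ, E2) μ.1 ν.1 u =
      (trivializationAt E2 (TangentSpace 𝓘(ℝ, E2)) μ.1).continuousLinearMapAt ℝ ν.1 u := by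
    rw [extChartAt_source] at hν
    have h := TangentBundle.continuousLinearMapAt_trivializationAt (I := 𝓘(ℝ, E2)) hν
    exact DFunLike.congr_fun h.symm u
  rw [h2, Trivialization.symmL_continuousLinearMapAt _ hb]
  simp

theorem mdifferentiableAt_proj (ν : CoT M) :
    MDifferentiableAt ICoT 𝓘(ℝ, E2) (proj (M := M)) ν :=
  (contMDiff_proj (n := 1) (IB := 𝓘(ℝ, E2)) (fun q : M => TangentSpace 𝓘(ℝ, E2) q →L[ℝ] Trivial M ℝ q)
    ν).mdifferentiableAt one_ne_zero

theorem dChart_dproj {μ ν : CoT M} (hν : ν ∈ (extChartAt ICoT μ).source)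
    (w : TangentSpace ICoT ν) :
    dChart 𝓘(ℝ, E2) μ.1 ν.1 (dproj ν w) = (dChart ICoT μ ν w).1 := by
  have h1 : (fun ν : CoT M => extChartAt 𝓘(ℝ, E2) μ.1 (proj ν)) =
      fun ν : CoT M => (extChartAt ICoT μ ν).1 := by
    ext1 ν
    exact (cot_extChartAt_fst μ ν).symm
  have h2 := mfderiv_comp_apply ν
    (mdifferentiableAt_extChartAt_of_mem (mem_cot_extChartAt_source.1 hν))
    (mdifferentiableAt_proj ν) w
  have h3 : MDifferentiableAt 𝓘(ℝ, PhaseSpace) 𝓘(ℝ, E2) (Prod.fst : PhaseSpace → E2)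
      (extChartAt ICoT μ ν) := differentiableAt_fst.mdifferentiableAt
  have h4 := mfderiv_comp_apply ν h3 (mdifferentiableAt_extChartAt_of_mem hν) w
  rw [mfderiv_eq_fderiv, fderiv_fst] at h4
  exact (h2.symm.trans (congrArg (fun f : CoT M → E2 => mfderiv ICoT 𝓘(ℝ, E2) f ν w) h1)).trans h4

theorem liouville_apply_chart {μ ν : CoT M} (hν : ν ∈ (extChartAt ICoT μ).source)
    (w : TangentSpace ICoT ν) :
    liouville ν w = (extChartAt ICoT μ ν).2 (dChart ICoT μ ν w).1 := by
  rw [← dChart_dproj hν, cot_extChartAt_snd hν]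
  rfl

theorem chartForm_liouville {μ : CoT M} {y : PhaseSpace} (hy : y ∈ (extChartAt ICoT μ).target) :
    chartForm μ liouville y = pairing y := by
  ext w
  · rw [ContinuousLinearMap.comp_apply, ContinuousLinearMap.comp_apply, chartForm_apply,
      liouville_apply_chart ((extChartAt ICoT μ).map_target hy), dChart_dChartSymm hy,
      (extChartAt ICoT μ).right_inv hy, pairing_apply]
  · rw [ContinuousLinearMap.comp_apply, ContinuousLinearMap.comp_apply, chartForm_apply,
      liouville_apply_chart ((extChartAt ICoT μ).map_target hy), dChart_dChartSymm hy,
      (extChartAt ICoT μ).right_inv hy, pairing_apply]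

/-- The bundle charts are Darboux charts: there the Liouville form is `p dq`, linear in the point,
so its exterior derivative is constant. -/
theorem symplecticForm_apply_chart {μ ν : CoT M} (hν : ν ∈ (extChartAt ICoT μ).source)
    (X Y : TangentSpace ICoT ν) :
    symplecticForm ν X Y = omega (dChart ICoT μ ν X) (dChart ICoT μ ν Y) := by
  have hy : extChartAt ICoT μ ν ∈ (extChartAt ICoT μ).target := (extChartAt ICoT μ).map_source hν
  have h1 : chartForm μ liouville =ᶠ[𝓝 (extChartAt ICoT μ ν)] pairing := by
    filter_upwards [extChartAt_target_mem_nhds' hy] with z hz using chartForm_liouville hz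
  have h2 : HasFDerivAt (chartForm μ liouville) pairing (extChartAt ICoT μ ν) :=
    pairing.hasFDerivAt.congr_of_eventuallyEq h1
  rw [symplecticForm, extD_apply_chart μ liouville hν h2.differentiableAt, h2.fderiv]
  rfl

/-- A function on `T*M` in the canonical coordinates around `μ`. -/
noncomputable def chartFun (μ : CoT M) (h : CoT M → ℝ) (y : PhaseSpace) : ℝ :=
  h ((extChartAt ICoT μ).symm y)

theorem dfun_apply_chart {μ ν : CoT M} (hν : ν ∈ (extChartAt ICoT μ).source) {h : CoT M → ℝ}
    (hh : MDifferentiableAt ICoT 𝓘(ℝ, ℝ) h ν) (w : TangentSpace ICoT ν) :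
    dfun h ν w = fderiv ℝ (chartFun μ h) (extChartAt ICoT μ ν) (dChart ICoT μ ν w) := by
  obtain ⟨y, hy, rfl⟩ : ∃ y ∈ (extChartAt ICoT μ).target, (extChartAt ICoT μ).symm y = ν :=
    ⟨_, (extChartAt ICoT μ).map_source hν, (extChartAt ICoT μ).left_inv hν⟩
  rw [(extChartAt ICoT μ).right_inv hy]
  have h1 := mfderiv_comp_apply y hh (mdifferentiableAt_extChartAt_symm hy)
    (dChart ICoT μ ((extChartAt ICoT μ).symm y) w)
  rw [mfderiv_eq_fderiv] at h1
  refine (h1.trans ?_).symm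
  exact congrArg (dfun h _) (dChartSymm_dChart hy w)

/-- `hamField` is chosen by `Function.invFun`, which solves the defining equation only if a solution
exists; `sharp` in the chart provides one. -/
theorem symplecticForm_hamField {h : CoT M → ℝ} {ν : CoT M}
    (hh : MDifferentiableAt ICoT 𝓘(ℝ, ℝ) h ν) (w : TangentSpace ICoT ν) :
    symplecticForm ν w (hamField h ν) = dfun h ν w := by
  have hν : ν ∈ (extChartAt ICoT ν).source := mem_extChartAt_source ν
  have key : ∃ X : TangentSpace ICoT ν, (fun w => symplecticForm ν w X) = fun w => dfun h ν w := by
    obtain ⟨X, hX⟩ := dChart_surjective hν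
      (sharp (fderiv ℝ (chartFun ν h) (extChartAt ICoT ν ν)))
    refine ⟨X, funext fun w => ?_⟩
    rw [symplecticForm_apply_chart hν, hX, omega_sharp, dfun_apply_chart hν hh]
  exact congrFun (Function.invFun_eq key) w

theorem dChart_hamField {μ ν : CoT M} (hν : ν ∈ (extChartAt ICoT μ).source) {h : CoT M → ℝ}
    (hh : MDifferentiableAt ICoT 𝓘(ℝ, ℝ) h ν) :
    dChart ICoT μ ν (hamField h ν) =
      sharp (fderiv ℝ (chartFun μ h) (extChartAt ICoT μ ν)) := by
  apply omega_left_injective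
  intro w
  obtain ⟨w, rfl⟩ := dChart_surjective hν w
  rw [← symplecticForm_apply_chart hν, symplecticForm_hamField hh, omega_sharp,
    dfun_apply_chart hν hh]

theorem chartField_hamField {μ : CoT M} {y : PhaseSpace} (hy : y ∈ (extChartAt ICoT μ).target)
    {h : CoT M → ℝ} (hh : MDifferentiableAt ICoT 𝓘(ℝ, ℝ) h ((extChartAt ICoT μ).symm y)) :
    chartField μ (hamField h) y = sharp (fderiv ℝ (chartFun μ h) y) := by
  have := dChart_hamField ((extChartAt ICoT μ).map_target hy) hh
  rwa [(extChartAt ICoT μ).right_inv hy] at this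

theorem contDiffOn_chartFun (μ : CoT M) {h : CoT M → ℝ} {D : Set (CoT M)} (hD : IsOpen D)
    (hh : ContMDiffOn ICoT 𝓘(ℝ, ℝ) ∞ h D) :
    ContDiffOn ℝ ∞ (chartFun μ h) ((extChartAt ICoT μ).target ∩ (extChartAt ICoT μ).symm ⁻¹' D) := by
  rw [← contMDiffOn_iff_contDiffOn]
  rintro y ⟨hy, hyD⟩
  exact ((hh.contMDiffAt (hD.mem_nhds hyD)).comp y
    (contMDiffAt_extChartAt_symm hy)).contMDiffWithinAt

theorem mdifferentiableAt_of_contMDiffOn {h : CoT M → ℝ} {D : Set (CoT M)} (hD : IsOpen D)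
    (hh : ContMDiffOn ICoT 𝓘(ℝ, ℝ) ∞ h D) {ν : CoT M} (hν : ν ∈ D) :
    MDifferentiableAt ICoT 𝓘(ℝ, ℝ) h ν :=
  (hh.contMDiffAt (hD.mem_nhds hν)).mdifferentiableAt (by simp)

theorem contMDiffOn_hamField {h : CoT M → ℝ} {D : Set (CoT M)} (hD : IsOpen D)
    (hh : ContMDiffOn ICoT 𝓘(ℝ, ℝ) ∞ h D) :
    ContMDiffOn ICoT ICoT.tangent ∞
      (fun ν => (⟨ν, hamField h ν⟩ : TangentBundle ICoT (CoT M))) D := by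
  intro μ hμ
  set D' := (extChartAt ICoT μ).source ∩ D with hD'
  have hD'o : IsOpen D' := (isOpen_extChartAt_source μ).inter hD
  have hop := isOpen_extChartAt_target_inter_preimage (I := ICoT) μ hD'o
  have h1 : ContDiffOn ℝ ∞ (chartFun μ h)
      ((extChartAt ICoT μ).target ∩ (extChartAt ICoT μ).symm ⁻¹' D') :=
    contDiffOn_chartFun μ hD'o (hh.mono inter_subset_right)
  have h2 : ContDiffOn ℝ ∞ (fderiv ℝ (chartFun μ h))
      ((extChartAt ICoT μ).target ∩ (extChartAt ICoT μ).symm ⁻¹' D') :=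
    h1.fderiv_of_isOpen hop (by simp)
  have h3 := contMDiffOn_of_contDiffOn_chartField (X := hamField h) μ hD'o inter_subset_left
    ((sharp.contDiff.comp_contDiffOn h2).congr fun y hy =>
      chartField_hamField hy.1 (mdifferentiableAt_of_contMDiffOn hD hh hy.2.2))
  exact (h3.contMDiffAt (hD'o.mem_nhds ⟨mem_extChartAt_source μ, hμ⟩)).contMDiffWithinAt

end CanonicalCoordinates

/-! ### The Legendre condition -/

section SecondOrder

/-- A negative second derivative would make `a` a local maximum as well, hence `k` locally constant,
which forces the second derivative to vanish. -/
theorem IsLocalMin.second_order {k k₁ : ℝ → ℝ} {a k₂ : ℝ} (hmin : IsLocalMin k a)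
    (hk : ∀ᶠ x in 𝓝 a, HasDerivAt k (k₁ x) x) (hk₁ : HasDerivAt k₁ k₂ a) :
    k₁ a = 0 ∧ 0 ≤ k₂ := by
  have h0 : k₁ a = 0 := hmin.hasDerivAt_eq_zero hk.self_of_nhds
  refine ⟨h0, ?_⟩
  by_contra! hneg
  have hd : deriv k =ᶠ[𝓝 a] k₁ := hk.mono fun x hx => hx.deriv
  have hdd : deriv (deriv k) a = k₂ := by rw [hd.deriv_eq, hk₁.deriv]
  have hmax : IsLocalMax k a := isLocalMax_of_deriv_deriv_neg (hdd ▸ hneg)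
    (by rw [hk.self_of_nhds.deriv, h0]) hk.self_of_nhds.continuousAt
  have hconst : k =ᶠ[𝓝 a] fun _ => k a := by
    filter_upwards [hmin, hmax] with x h1 h2 using le_antisymm h2 h1
  have h1 : deriv k =ᶠ[𝓝 a] fun _ => 0 := by
    simpa using hconst.deriv
  have h2 : deriv (deriv k) a = 0 := by rw [h1.deriv_eq]; simp
  rw [hdd] at h2
  exact hneg.ne h2

theorem covector_eq_zero_of_linearIndependent {a b : E2} (hab : LinearIndependent ℝ ![a, b])
    {ξ : E2 →L[ℝ] ℝ} (ha : ξ a = 0) (hb : ξ b = 0) : ξ = 0 := by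
  have hs : Submodule.span ℝ (Set.range ![a, b]) = ⊤ :=
    hab.span_eq_top_of_card_eq_finrank (by simp)
  ext w
  have hw : w ∈ Submodule.span ℝ (Set.range ![a, b]) := hs ▸ Submodule.mem_top
  induction hw using Submodule.span_induction with
  | mem x hx =>
    obtain ⟨i, rfl⟩ := hx
    fin_cases i <;> simpa
  | zero => simp
  | add x y _ _ hx hy => simpa [hx] using hy
  | smul r x _ hx => simp_all

theorem HasDerivAt.hamiltonian_along {V : Type*} [NormedAddCommGroup V] [NormedSpace ℝ V]
    {hc : V → ℝ} {y v : V} {ε : ℝ}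
    (hd : DifferentiableAt ℝ hc (y + ε • v)) :
    HasDerivAt (fun ε : ℝ => hc (y + ε • v)) (fderiv ℝ hc (y + ε • v) v) ε := by
  have h1 : HasDerivAt (fun ε : ℝ => y + ε • v) v ε := by
    simpa using ((hasDerivAt_id ε).smul_const v).const_add y
  exact hd.hasFDerivAt.comp_hasDerivAt ε h1

theorem HasDerivAt.fderiv_along {V : Type*} [NormedAddCommGroup V] [NormedSpace ℝ V]
    {hc : V → ℝ} {y v : V}
    (hd : DifferentiableAt ℝ (fderiv ℝ hc) y) :
    HasDerivAt (fun ε : ℝ => fderiv ℝ hc (y + ε • v) v) (fderiv ℝ (fderiv ℝ hc) y v v) 0 := by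
  have h1 : HasDerivAt (fun ε : ℝ => y + ε • v) v 0 := by
    simpa using ((hasDerivAt_id (0 : ℝ)).smul_const v).const_add y
  have h3 : y + (0 : ℝ) • v = y := by rw [zero_smul, add_zero]
  have h2 : HasFDerivAt (fun z => fderiv ℝ hc z v) ((fderiv ℝ (fderiv ℝ hc) y).flip v)
      (y + (0 : ℝ) • v) := by
    rw [h3]
    exact (ContinuousLinearMap.apply ℝ ℝ v).hasFDerivAt.comp y hd.hasFDerivAt
  exact h2.comp_hasDerivAt 0 h1

/-- The gap `hc - (⟨p, F⟩ - C)` is nonnegative on the fibre and zero at the maximizing control, so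
it has a local minimum at `ε = 0` along every path on which the momentum moves in the direction `ξ`
and the control coordinate at speed `K`. The free parameter `K` is exploited afterwards. -/
theorem legendre_inequality {hc : PhaseSpace → ℝ} {y₀ : PhaseSpace} (hhc : ContDiffAt ℝ 2 hc y₀)
    {F : ℝ → E2} {C : ℝ → ℝ} {x₀ : ℝ} (hF : ContDiffAt ℝ 2 F x₀) (hC : ContDiffAt ℝ 2 C x₀)
    (hle : ∀ᶠ z in 𝓝 (y₀, x₀), z.1.1 = y₀.1 → z.1.2 (F z.2) - C z.2 ≤ hc z.1)
    (heq : y₀.2 (F x₀) - C x₀ = hc y₀) (ξ : E2 →L[ℝ] ℝ) (K : ℝ) :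
    fderiv ℝ hc y₀ (0, ξ) - (ξ (F x₀) + K * (y₀.2 (deriv F x₀) - deriv C x₀)) = 0 ∧
      0 ≤ fderiv ℝ (fderiv ℝ hc) y₀ (0, ξ) (0, ξ) - (2 * K * ξ (deriv F x₀) +
        K ^ 2 * (y₀.2 (deriv (deriv F) x₀) - deriv (deriv C) x₀)) := by
  set v : PhaseSpace := (0, ξ) with hv
  have hy : Filter.Tendsto (fun ε : ℝ => y₀ + ε • v) (𝓝 0) (𝓝 y₀) := by
    have : ContinuousAt (fun ε : ℝ => y₀ + ε • v) 0 := by fun_prop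
    simpa [ContinuousAt] using this
  have hx : Filter.Tendsto (fun ε : ℝ => x₀ + K * ε) (𝓝 0) (𝓝 x₀) := by
    have : ContinuousAt (fun ε : ℝ => x₀ + K * ε) 0 := by fun_prop
    simpa [ContinuousAt] using this
  have hxd : ∀ ε : ℝ, HasDerivAt (fun ε : ℝ => x₀ + K * ε) K ε := fun ε => by
    simpa using ((hasDerivAt_id ε).const_mul K).const_add x₀
  have hpd : ∀ ε : ℝ, HasDerivAt (fun ε : ℝ => y₀.2 + ε • ξ) ξ ε := fun ε => by
    simpa using ((hasDerivAt_id ε).smul_const ξ).const_add y₀.2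
  have hmin : IsLocalMin (fun ε : ℝ => hc (y₀ + ε • v) -
      ((y₀.2 + ε • ξ) (F (x₀ + K * ε)) - C (x₀ + K * ε))) 0 := by
    filter_upwards [(hy.prodMk_nhds hx).eventually hle] with ε hε
    have := hε (by simp [hv])
    simp only [zero_smul, add_zero, mul_zero, ← heq, sub_self]
    exact sub_nonneg.2 this
  have hF1 : ∀ᶠ x in 𝓝 x₀, DifferentiableAt ℝ F x :=
    (hF.eventually (by simp)).mono fun x hx => hx.differentiableAt (by simp)
  have hC1 : ∀ᶠ x in 𝓝 x₀, DifferentiableAt ℝ C x :=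
    (hC.eventually (by simp)).mono fun x hx => hx.differentiableAt (by simp)
  have hh1 : ∀ᶠ y in 𝓝 y₀, DifferentiableAt ℝ hc y :=
    (hhc.eventually (by simp)).mono fun x hx => hx.differentiableAt (by simp)
  have hF2 : DifferentiableAt ℝ (deriv F) x₀ := by
    have h : ContDiffAt ℝ 1 (fderiv ℝ F) x₀ := hF.fderiv_right (by norm_num)
    have := (h.differentiableAt one_ne_zero).clm_apply (differentiableAt_const (1 : ℝ))
    exact this
  have hC2 : DifferentiableAt ℝ (deriv C) x₀ := by
    have h : ContDiffAt ℝ 1 (fderiv ℝ C) x₀ := hC.fderiv_right (by norm_num)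
    have := (h.differentiableAt one_ne_zero).clm_apply (differentiableAt_const (1 : ℝ))
    exact this
  have hh2 : DifferentiableAt ℝ (fderiv ℝ hc) y₀ :=
    (hhc.fderiv_right (m := 1) (by norm_num)).differentiableAt one_ne_zero
  have hres := hmin.second_order (k₁ := fun ε => fderiv ℝ hc (y₀ + ε • v) v -
      (ξ (F (x₀ + K * ε)) + (y₀.2 + ε • ξ) (K • deriv F (x₀ + K * ε)) -
        deriv C (x₀ + K * ε) * K)) (k₂ := fderiv ℝ (fderiv ℝ hc) y₀ v v -
        (2 * K * ξ (deriv F x₀) +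
        K ^ 2 * (y₀.2 (deriv (deriv F) x₀) - deriv (deriv C) x₀))) ?_ ?_
  · refine ⟨?_, hres.2⟩
    have := hres.1
    simp only [zero_smul, add_zero, mul_zero, map_smul, smul_eq_mul] at this
    linarith
  · filter_upwards [hy.eventually hh1, hx.eventually hF1, hx.eventually hC1] with ε h1 h2 h3
    refine (HasDerivAt.hamiltonian_along h1).fun_sub (HasDerivAt.fun_sub ?_ ?_)
    · exact (hpd ε).clm_apply (h2.hasDerivAt.scomp ε (hxd ε))
    · exact h3.hasDerivAt.comp ε (hxd ε)
  · have e1 : HasDerivAt (fun ε : ℝ => fderiv ℝ hc (y₀ + ε • v) v)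
        (fderiv ℝ (fderiv ℝ hc) y₀ v v) 0 := HasDerivAt.fderiv_along hh2
    have e2 : HasDerivAt (fun ε : ℝ => F (x₀ + K * ε)) (K • deriv F x₀) 0 := by
      have h2 : HasDerivAt F (deriv F x₀) (x₀ + K * 0) := by
        simpa using hF1.self_of_nhds.hasDerivAt
      exact h2.scomp 0 (hxd 0)
    have e3 : HasDerivAt (fun ε : ℝ => deriv F (x₀ + K * ε)) (K • deriv (deriv F) x₀) 0 := by
      have h2 : HasDerivAt (deriv F) (deriv (deriv F) x₀) (x₀ + K * 0) := by
        simpa using hF2.hasDerivAt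
      exact h2.scomp 0 (hxd 0)
    have e4 : HasDerivAt (fun ε : ℝ => deriv C (x₀ + K * ε)) (deriv (deriv C) x₀ * K) 0 := by
      have h2 : HasDerivAt (deriv C) (deriv (deriv C) x₀) (x₀ + K * 0) := by
        simpa using hC2.hasDerivAt
      exact h2.comp 0 (hxd 0)
    have e5 := e1.fun_sub ((((hasDerivAt_const (0 : ℝ) ξ).clm_apply e2).fun_add
      ((hpd 0).clm_apply (e3.const_smul K))).fun_sub (e4.mul_const K))
    refine e5.congr_deriv ?_
    simp
    ring

/-- First and second order conditions for a function that dominates an affine family of functions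
and coincides with one of its members at a point. -/
theorem legendre_conditions {hc : PhaseSpace → ℝ} {y₀ : PhaseSpace} (hhc : ContDiffAt ℝ 2 hc y₀)
    {F : ℝ → E2} {C : ℝ → ℝ} {x₀ : ℝ} (hF : ContDiffAt ℝ 2 F x₀) (hC : ContDiffAt ℝ 2 C x₀)
    (hle : ∀ᶠ z in 𝓝 (y₀, x₀), z.1.1 = y₀.1 → z.1.2 (F z.2) - C z.2 ≤ hc z.1)
    (heq : y₀.2 (F x₀) - C x₀ = hc y₀) (ξ : E2 →L[ℝ] ℝ) :
    fderiv ℝ hc y₀ (0, ξ) = ξ (F x₀) ∧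
      (ξ (deriv F x₀) ≠ 0 → 0 < fderiv ℝ (fderiv ℝ hc) y₀ (0, ξ) (0, ξ)) := by
  have key := legendre_inequality hhc hF hC hle heq ξ
  constructor
  · have := (key 0).1
    linarith
  · intro hB
    generalize fderiv ℝ (fderiv ℝ hc) y₀ (0, ξ) (0, ξ) = A at key
    generalize ξ (deriv F x₀) = B at key hB
    generalize y₀.2 (deriv (deriv F) x₀) - deriv (deriv C) x₀ = G at key
    by_contra! hA
    have h1 := fun K => (key K).2
    -- If `A ≤ 0`, then `2 K B + K² G ≤ 0` for every `K`. With `K = r B` and `r |G| ≤ 1` the left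
    -- side is at least `r B² > 0`, a contradiction.
    set r := 1 / (|G| + 1) with hr
    have hr0 : 0 < r := by positivity
    have hrG : r * |G| ≤ 1 := by
      rw [hr, one_div, inv_mul_le_iff₀ (by positivity)]
      linarith
    have h2 := h1 (r * B)
    have h3 : 0 < B ^ 2 := by positivity
    have h4 : -(r * |G|) ≤ r * G := by
      have := neg_abs_le G
      nlinarith
    nlinarith [mul_pos hr0 h3]
end SecondOrder

/-! ### The Legendre condition for the maximized Hamiltonian. -/

namespace ControlProblem

variable {M U : Type*} [TopologicalSpace M] [ChartedSpace E2 M] [IsManifold 𝓘(ℝ, E2) ∞ M]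
  [TopologicalSpace U] [ChartedSpace ℝ U] [IsManifold 𝓘(ℝ, ℝ) ∞ U] (P : ControlProblem M U)

theorem ham_eq_preHam {μ : CoT M} {u : U} (hu : IsMaxOn (P.preHam μ) univ u) :
    P.ham μ = P.preHam μ u := by
  have h : IsGreatest (range (P.preHam μ)) (P.preHam μ u) :=
    ⟨mem_range_self u, by rintro _ ⟨w, rfl⟩; exact hu (mem_univ w)⟩
  exact h.csSup_eq

theorem preHam_le_ham {μ : CoT M} (hμ : ∃ u : U, IsMaxOn (P.preHam μ) univ u) (w : U) :
    P.preHam μ w ≤ P.ham μ := by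
  obtain ⟨u, hu⟩ := hμ
  rw [P.ham_eq_preHam hu]
  exact hu (mem_univ w)

theorem ham_eq_of_mem_level {e : ℝ} {μ : CoT M} (hμ : μ ∈ P.level e) : P.ham μ = e :=
  IsGreatest.csSup_eq hμ

theorem mem_level_of_ham_eq {e : ℝ} {μ : CoT M} (hμ : ∃ u : U, IsMaxOn (P.preHam μ) univ u)
    (h : P.ham μ = e) : μ ∈ P.level e := by
  obtain ⟨u, hu⟩ := hμ
  refine ⟨⟨u, by rw [← P.ham_eq_preHam hu, h]⟩, ?_⟩
  rintro _ ⟨w, rfl⟩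
  rw [← h]
  exact P.preHam_le_ham ⟨u, hu⟩ w

/-- The velocity `f(q, u(x))` read in the chart of `M` at `q`. -/
noncomputable def velocityCoord (q : M) (u : U) (x : ℝ) : E2 :=
  dChart 𝓘(ℝ, E2) q q (P.f q ((chartAt ℝ u).symm x))

theorem contDiffAt_velocityCoord (q : M) (u : U) :
    ContDiffAt ℝ ∞ (P.velocityCoord q u) (chartAt ℝ u u) := by
  have h1 : ContMDiffAt 𝓘(ℝ, ℝ) 𝓘(ℝ, ℝ) ∞ (chartAt ℝ u).symm (chartAt ℝ u u) :=
    contMDiffAt_extChartAt_symm (I := 𝓘(ℝ, ℝ)) (mem_extChartAt_target u)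
  have h2 : ContMDiffAt 𝓘(ℝ, ℝ) 𝓘(ℝ, E2).tangent ∞
      (fun x => (⟨q, P.f q ((chartAt ℝ u).symm x)⟩ : TangentBundle 𝓘(ℝ, E2) M)) (chartAt ℝ u u) :=
    (P.smooth_f _).comp (chartAt ℝ u u) (contMDiffAt_const.prodMk h1)
  have h3 := Bundle.contMDiffAt_totalSpace.1 h2
  refine contMDiffAt_iff_contDiffAt.1 (h3.2.congr_of_eventuallyEq (Filter.Eventually.of_forall ?_))
  intro x
  exact (trivializationAt_tangent_snd (I := 𝓘(ℝ, E2)) (mem_extChartAt_source q) _).symm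

theorem contDiffAt_cost (q : M) (u : U) :
    ContDiffAt ℝ ∞ (fun x => P.cost q ((chartAt ℝ u).symm x)) (chartAt ℝ u u) := by
  have h1 : ContMDiffAt 𝓘(ℝ, ℝ) 𝓘(ℝ, ℝ) ∞ (chartAt ℝ u).symm (chartAt ℝ u u) :=
    contMDiffAt_extChartAt_symm (I := 𝓘(ℝ, ℝ)) (mem_extChartAt_target u)
  exact contMDiffAt_iff_contDiffAt.1
    ((P.smooth_cost _).comp (chartAt ℝ u u) (contMDiffAt_const.prodMk h1))

/-- By regularity `f` and `f_u` span the tangent plane, so a nonzero covector that kills `f` cannot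
kill `f_u`. -/
theorem covector_deriv_velocityCoord_ne_zero (hreg : P.IsRegular) (q : M) (u : U)
    {ξ : E2 →L[ℝ] ℝ} (hξ : ξ ≠ 0) (h0 : ξ (dChart 𝓘(ℝ, E2) q q (P.f q u)) = 0) :
    ξ (deriv (P.velocityCoord q u) (chartAt ℝ u u)) ≠ 0 := by
  intro h1
  set A : E2 →L[ℝ] E2 := dChart 𝓘(ℝ, E2) q q with hA
  set B : E2 →L[ℝ] E2 := dChartSymm 𝓘(ℝ, E2) q (extChartAt 𝓘(ℝ, E2) q q) with hB
  have hF : P.velocityCoord q u = fun x => A (P.fCoord q u x) := rfl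
  have hG : P.fCoord q u = fun x => B (P.velocityCoord q u x) := by
    ext1 x
    exact (mfderiv_symm_dChart (I := 𝓘(ℝ, E2)) (mem_extChartAt_source q) _).symm
  have hd : DifferentiableAt ℝ (P.fCoord q u) (chartAt ℝ u u) := by
    rw [hG]
    exact B.differentiableAt.comp _ ((P.contDiffAt_velocityCoord q u).differentiableAt (by simp))
  have h2 : deriv (P.velocityCoord q u) (chartAt ℝ u u) = A (P.fu q u) := by
    rw [hF]
    exact (A.hasFDerivAt.comp_hasDerivAt _ hd.hasDerivAt).deriv
  have h3 : ξ.comp A = 0 := by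
    refine covector_eq_zero_of_linearIndependent (hreg q u).1 h0 ?_
    rw [h2] at h1
    exact h1
  refine hξ (ContinuousLinearMap.ext fun w => ?_)
  obtain ⟨z, hz⟩ := dChart_surjective (I := 𝓘(ℝ, E2)) (mem_extChartAt_source q) w
  rw [← hz]
  exact DFunLike.congr_fun h3 z

theorem preHam_chart {μ ν : CoT M} (hν : ν ∈ (extChartAt ICoT μ).source) (h1 : ν.1 = μ.1) (u : U) :
    P.preHam ν u =
      (extChartAt ICoT μ ν).2 (dChart 𝓘(ℝ, E2) μ.1 μ.1 (P.f μ.1 u)) - P.cost μ.1 u := by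
  obtain ⟨q, p⟩ := ν
  obtain rfl : q = μ.1 := h1
  exact congrArg (· - P.cost μ.1 u) (cot_extChartAt_snd hν _).symm

theorem cot_fst_eq_of_extChartAt_fst_eq {μ ν : CoT M} (hν : ν ∈ (extChartAt ICoT μ).source)
    (h : (extChartAt ICoT μ ν).1 = (extChartAt ICoT μ μ).1) : ν.1 = μ.1 := by
  rw [cot_extChartAt_fst, cot_extChartAt_fst] at h
  exact (extChartAt 𝓘(ℝ, E2) μ.1).injOn (mem_cot_extChartAt_source.1 hν)
    (mem_extChartAt_source μ.1) h

/-- In the chart at `μ`, the derivative of the maximized Hamiltonian along the fibre is the velocity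
of a maximizing control, and its second derivative is positive along the directions which are
tangent to its level. -/
theorem legendre_ham (hreg : P.IsRegular) {D : Set (CoT M)} (hD : IsOpen D)
    (hmax : ∀ μ ∈ D, ∃ u : U, IsMaxOn (P.preHam μ) univ u)
    (hsm : ContMDiffOn ICoT 𝓘(ℝ, ℝ) ∞ P.ham D) {μ : CoT M} (hμ : μ ∈ D) {u : U}
    (hu : IsMaxOn (P.preHam μ) univ u) (ξ : E2 →L[ℝ] ℝ) :
    fderiv ℝ (chartFun μ P.ham) (extChartAt ICoT μ μ) (0, ξ) =
        ξ (dChart 𝓘(ℝ, E2) μ.1 μ.1 (P.f μ.1 u)) ∧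
      (ξ ≠ 0 → ξ (dChart 𝓘(ℝ, E2) μ.1 μ.1 (P.f μ.1 u)) = 0 →
        0 < fderiv ℝ (fderiv ℝ (chartFun μ P.ham)) (extChartAt ICoT μ μ) (0, ξ) (0, ξ)) := by
  have hop := isOpen_extChartAt_target_inter_preimage (I := ICoT) μ hD
  have hmem : extChartAt ICoT μ μ ∈
      (extChartAt ICoT μ).target ∩ (extChartAt ICoT μ).symm ⁻¹' D :=
    ⟨mem_extChartAt_target μ, by
      rw [mem_preimage, (extChartAt ICoT μ).left_inv (mem_extChartAt_source μ)]; exact hμ⟩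
  have hhc : ContDiffAt ℝ 2 (chartFun μ P.ham) (extChartAt ICoT μ μ) :=
    ((contDiffOn_chartFun μ hD hsm).contDiffAt (hop.mem_nhds hmem)).of_le
      (WithTop.coe_le_coe.2 le_top)
  have hu0 : (chartAt ℝ u).symm (chartAt ℝ u u) = u :=
    (chartAt ℝ u).left_inv (mem_chart_source ℝ u)
  have hF0 : P.velocityCoord μ.1 u (chartAt ℝ u u) = dChart 𝓘(ℝ, E2) μ.1 μ.1 (P.f μ.1 u) := by
    rw [velocityCoord, hu0]
  have key := legendre_conditions hhc
    ((P.contDiffAt_velocityCoord μ.1 u).of_le (WithTop.coe_le_coe.2 le_top))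
    ((P.contDiffAt_cost μ.1 u).of_le (WithTop.coe_le_coe.2 le_top)) ?_ ?_ ξ
  · rw [hF0] at key
    exact ⟨key.1, fun hξ h0 => key.2 (P.covector_deriv_velocityCoord_ne_zero hreg μ.1 u hξ h0)⟩
  · have hnear : ∀ᶠ z in 𝓝 (extChartAt ICoT μ μ, chartAt ℝ u u),
        z.1 ∈ (extChartAt ICoT μ).target ∩ (extChartAt ICoT μ).symm ⁻¹' D :=
      continuousAt_fst.eventually (hop.mem_nhds hmem)
    filter_upwards [hnear] with z hz hz1
    have hs := (extChartAt ICoT μ).map_target hz.1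
    have hr := (extChartAt ICoT μ).right_inv hz.1
    have h1 : ((extChartAt ICoT μ).symm z.1).1 = μ.1 :=
      cot_fst_eq_of_extChartAt_fst_eq hs (by rw [hr, hz1])
    have h2 := P.preHam_le_ham (hmax _ hz.2) ((chartAt ℝ u).symm z.2)
    rw [P.preHam_chart hs h1, hr] at h2
    exact h2
  · rw [hF0]
    have h2 := P.ham_eq_preHam hu
    rw [P.preHam_chart (mem_extChartAt_source μ) rfl] at h2
    have h3 : chartFun μ P.ham (extChartAt ICoT μ μ) = P.ham μ := by
      rw [chartFun, (extChartAt ICoT μ).left_inv (mem_extChartAt_source μ)]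
    rw [h3, h2, hu0]

end ControlProblem

/-! ### Hamiltonian fields on a symplectic vector space -/

section SymplecticCalculus

variable {V : Type*} [NormedAddCommGroup V] [NormedSpace ℝ V] {β : V →L[ℝ] V →L[ℝ] ℝ}
  {H : V → ℝ} {X : V → V} {y : V}

theorem omega_fderiv_of_hamiltonian (hH : DifferentiableAt ℝ (fderiv ℝ H) y)
    (hXd : DifferentiableAt ℝ X y) (hX : ∀ᶠ z in 𝓝 y, ∀ w, β w (X z) = fderiv ℝ H z w) (a b : V) :
    β a (fderiv ℝ X y b) = fderiv ℝ (fderiv ℝ H) y b a := by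
  have h1 : HasFDerivAt (fun z => β a (X z)) ((β a).comp (fderiv ℝ X y)) y :=
    (β a).hasFDerivAt.comp y hXd.hasFDerivAt
  have h2 : HasFDerivAt (fun z => fderiv ℝ H z a) ((ContinuousLinearMap.apply ℝ ℝ a).comp
      (fderiv ℝ (fderiv ℝ H) y)) y :=
    (ContinuousLinearMap.apply ℝ ℝ a).hasFDerivAt.comp y hH.hasFDerivAt
  have h3 : (fun z => β a (X z)) =ᶠ[𝓝 y] fun z => fderiv ℝ H z a := hX.mono fun z hz => hz a
  exact DFunLike.congr_fun ((h1.congr_of_eventuallyEq h3.symm).unique h2) b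

/-- The linearization of a Hamiltonian field is infinitesimally symplectic, because the second
derivative of `H` is symmetric. -/
theorem omega_fderiv_add_omega_fderiv (hβ : ∀ a b, β a b = -β b a) (hH : ContDiffAt ℝ 2 H y)
    (hXd : DifferentiableAt ℝ X y) (hX : ∀ᶠ z in 𝓝 y, ∀ w, β w (X z) = fderiv ℝ H z w) (a b : V) :
    β (fderiv ℝ X y a) b + β a (fderiv ℝ X y b) = 0 := by
  have hd : DifferentiableAt ℝ (fderiv ℝ H) y :=
    (hH.fderiv_right (m := 1) (by norm_num)).differentiableAt one_ne_zero
  have hsymm : IsSymmSndFDerivAt ℝ H y :=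
    hH.isSymmSndFDerivAt (by rw [minSmoothness_of_isRCLikeNormedField])
  rw [hβ (fderiv ℝ X y a), omega_fderiv_of_hamiltonian hd hXd hX,
    omega_fderiv_of_hamiltonian hd hXd hX, hsymm.eq]
  ring

/-- A Hamiltonian field is an infinitesimal symmetry of the symplectic form. -/
theorem fderiv_omega_apply_hamiltonian (hβ : ∀ a b, β a b = -β b a) (hH : ContDiffAt ℝ 2 H y)
    (hXd : DifferentiableAt ℝ X y) (hX : ∀ᶠ z in 𝓝 y, ∀ w, β w (X z) = fderiv ℝ H z w)
    {Y Z : V → V} (hY : DifferentiableAt ℝ Y y) (hZ : DifferentiableAt ℝ Z y) :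
    fderiv ℝ (fun z => β (Y z) (Z z)) y (X y) =
      β (VectorField.lieBracket ℝ X Y y) (Z y) + β (Y y) (VectorField.lieBracket ℝ X Z y) := by
  have h1 : HasFDerivAt (fun z => β (Y z)) (β.comp (fderiv ℝ Y y)) y :=
    β.hasFDerivAt.comp y hY.hasFDerivAt
  have h2 := (h1.clm_apply hZ.hasFDerivAt).fderiv
  have h3 := omega_fderiv_add_omega_fderiv hβ hH hXd hX (Y y) (Z y)
  rw [h2]
  simp only [VectorField.lieBracket, map_sub, sub_apply, add_apply, ContinuousLinearMap.comp_apply,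
    ContinuousLinearMap.flip_apply]
  linarith

theorem bilin_smul_smul (B : V →L[ℝ] V →L[ℝ] ℝ) (r : ℝ) (x : V) :
    B (r • x) (r • x) = r * r * B x x := by
  simp [mul_assoc]

/-- Obtained by differentiating the identity `dH(v) = 0` in the direction `a`. -/
theorem fderiv_fderiv_of_tangent {v : V → V} (hH : DifferentiableAt ℝ (fderiv ℝ H) y)
    (hv : DifferentiableAt ℝ v y) (h0 : ∀ᶠ z in 𝓝 y, fderiv ℝ H z (v z) = 0) (a : V) :
    fderiv ℝ (fderiv ℝ H) y a (v y) = -fderiv ℝ H y (fderiv ℝ v y a) := by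
  have h1 := hH.hasFDerivAt.clm_apply hv.hasFDerivAt
  have h2 : (fun z => fderiv ℝ H z (v z)) =ᶠ[𝓝 y] fun _ => (0 : ℝ) := h0
  have h3 := DFunLike.congr_fun ((h1.congr_of_eventuallyEq h2.symm).unique
    (hasFDerivAt_const (0 : ℝ) y)) a
  simp only [add_apply, ContinuousLinearMap.comp_apply, ContinuousLinearMap.flip_apply,
    zero_apply] at h3
  linarith

end SymplecticCalculus

/-! ### Natural vertical fields -/

section NaturalFields

variable {M : Type*} [TopologicalSpace M] [ChartedSpace E2 M] [IsManifold 𝓘(ℝ, E2) ∞ M]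

theorem lieD_of_apply_eq_zero {v : ∀ μ : CoT M, TangentSpace ICoT μ}
    {α : ∀ μ : CoT M, TangentSpace ICoT μ →L[ℝ] ℝ} {ν : CoT M} (h : ∀ᶠ z in 𝓝 ν, α z (v z) = 0) :
    lieD ICoT v α ν = extD ICoT α ν (v ν) := by
  have h1 : (fun y => α y (v y)) =ᶠ[𝓝 ν] fun _ => (0 : ℝ) := h
  have h2 : mfderiv ICoT 𝓘(ℝ, ℝ) (fun y => α y (v y)) ν = 0 := by
    rw [h1.mfderiv_eq]
    exact mfderiv_const
  have key : ∀ d : TangentSpace ICoT ν →L[ℝ] ℝ, d = 0 →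
      extD ICoT α ν (v ν) + d = extD ICoT α ν (v ν) := by
    rintro d rfl
    exact add_zero _
  exact key _ h2

/-- The Liouville form vanishes on vertical vectors, so only the term `i_v ds` of Cartan's formula
survives. -/
theorem lieD_liouville_of_vertical {v : ∀ μ : CoT M, TangentSpace ICoT μ} {N : Set (CoT M)}
    (hN : IsOpen N) (hv : ∀ ν ∈ N, dproj ν (v ν) = 0) {ν : CoT M} (hν : ν ∈ N)
    (w : TangentSpace ICoT ν) : lieD ICoT v liouville ν w = symplecticForm ν (v ν) w := by
  rw [lieD_of_apply_eq_zero]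
  · rfl
  · filter_upwards [hN.mem_nhds hν] with z hz
    rw [liouville, ContinuousLinearMap.comp_apply, hv z hz, map_zero]

theorem chartField_fst_of_vertical {v : ∀ μ : CoT M, TangentSpace ICoT μ} {N : Set (CoT M)}
    (hv : ∀ ν ∈ N, dproj ν (v ν) = 0) {μ : CoT M} {y : PhaseSpace}
    (hy : y ∈ (extChartAt ICoT μ).target ∩ (extChartAt ICoT μ).symm ⁻¹' N) :
    (chartField μ v y).1 = 0 := by
  have := dChart_dproj ((extChartAt ICoT μ).map_target hy.1) (v ((extChartAt ICoT μ).symm y))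
  rw [hv _ hy.2, map_zero] at this
  exact this.symm

theorem chartForm_lieD_liouville {v : ∀ μ : CoT M, TangentSpace ICoT μ} {N : Set (CoT M)}
    (hN : IsOpen N) (hv : ∀ ν ∈ N, dproj ν (v ν) = 0) {μ : CoT M} {y : PhaseSpace}
    (hy : y ∈ (extChartAt ICoT μ).target ∩ (extChartAt ICoT μ).symm ⁻¹' N) :
    chartForm μ (lieD ICoT v liouville) y = omega (chartField μ v y) := by
  refine DFunLike.ext _ _ fun w => ?_
  rw [chartForm_apply, lieD_liouville_of_vertical hN hv hy.2,
    symplecticForm_apply_chart ((extChartAt ICoT μ).map_target hy.1), dChart_dChartSymm hy.1]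
  rfl

/-- The form `L_v s = σ(v, ·)` vanishes on `v`, so its Lie derivative is `σ(Dv·v, w) - σ(Dv·w, v)`
in the chart. The second term is zero: both arguments are vertical, since `v` is vertical throughout
`N`. -/
theorem lieD_lieD_liouville {v : ∀ μ : CoT M, TangentSpace ICoT μ} {N : Set (CoT M)}
    (hN : IsOpen N)
    (hvs : ContMDiffOn ICoT ICoT.tangent ∞ (fun μ => (⟨μ, v μ⟩ : TangentBundle ICoT (CoT M))) N)
    (hv : ∀ ν ∈ N, dproj ν (v ν) = 0) {μ ν : CoT M} (hνs : ν ∈ (extChartAt ICoT μ).source)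
    (hν : ν ∈ N) (w : TangentSpace ICoT ν) :
    lieD ICoT v (lieD ICoT v liouville) ν w =
      omega (fderiv ℝ (chartField μ v) (extChartAt ICoT μ ν)
        (chartField μ v (extChartAt ICoT μ ν))) (dChart ICoT μ ν w) := by
  have hop := isOpen_extChartAt_target_inter_preimage (I := ICoT) μ hN
  have hy : extChartAt ICoT μ ν ∈
      (extChartAt ICoT μ).target ∩ (extChartAt ICoT μ).symm ⁻¹' N :=
    ⟨(extChartAt ICoT μ).map_source hνs, by
      rw [mem_preimage, (extChartAt ICoT μ).left_inv hνs]; exact hν⟩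
  have hvd : DifferentiableAt ℝ (chartField μ v) (extChartAt ICoT μ ν) :=
    ((contDiffOn_chartField μ hN hvs).contDiffAt (hop.mem_nhds hy)).differentiableAt (by simp)
  have h1 : ∀ᶠ z in 𝓝 ν, lieD ICoT v liouville z (v z) = 0 := by
    filter_upwards [hN.mem_nhds hν] with z hz
    rw [lieD_liouville_of_vertical hN hv hz,
      symplecticForm_apply_chart (mem_extChartAt_source z), omega_self]
  have h5 : HasFDerivAt (chartForm μ (lieD ICoT v liouville))
      (omega.comp (fderiv ℝ (chartField μ v) (extChartAt ICoT μ ν))) (extChartAt ICoT μ ν) := by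
    refine (omega.hasFDerivAt.comp _ hvd.hasFDerivAt).congr_of_eventuallyEq ?_
    filter_upwards [hop.mem_nhds hy] with z hz using chartForm_lieD_liouville hN hv hz
  have h6 : ∀ a, (fderiv ℝ (chartField μ v) (extChartAt ICoT μ ν) a).1 = 0 := by
    intro a
    have e1 := (ContinuousLinearMap.fst ℝ E2 (E2 →L[ℝ] ℝ)).hasFDerivAt.comp _ hvd.hasFDerivAt
    have e2 : (fun z => (chartField μ v z).1) =ᶠ[𝓝 (extChartAt ICoT μ ν)] fun _ => (0 : E2) := by
      filter_upwards [hop.mem_nhds hy] with z hz using chartField_fst_of_vertical hv hz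
    exact DFunLike.congr_fun ((e1.congr_of_eventuallyEq e2.symm).unique
      (hasFDerivAt_const (0 : E2) _)) a
  rw [lieD_of_apply_eq_zero h1, extD_apply_chart μ _ hνs h5.differentiableAt, h5.fderiv,
    ContinuousLinearMap.comp_apply, ContinuousLinearMap.comp_apply, ← chartField_apply hνs v,
    omega_of_fst_eq_zero (h6 (dChart ICoT μ ν w)), chartField_fst_of_vertical hv hy, map_zero,
    sub_zero]

end NaturalFields

/-! ### Normalization and uniqueness of the natural vertical field. -/

namespace ControlProblem

variable {M U : Type*} [TopologicalSpace M] [ChartedSpace E2 M] [IsManifold 𝓘(ℝ, E2) ∞ M]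
  [TopologicalSpace U] [ChartedSpace ℝ U] [IsManifold 𝓘(ℝ, ℝ) ∞ U] {P : ControlProblem M U}

/-- `D` is an open set on which the maximum is attained and depends smoothly on the covector. -/
structure IsHamDomain (P : ControlProblem M U) (D : Set (CoT M)) : Prop where
  isOpen : IsOpen D
  attained : ∀ μ ∈ D, ∃ u : U, IsMaxOn (P.preHam μ) univ u
  smooth : ContMDiffOn ICoT 𝓘(ℝ, ℝ) ∞ P.ham D

namespace IsHamDomain

variable {D : Set (CoT M)}

theorem mdifferentiableAt (hD : P.IsHamDomain D) {ν : CoT M} (hν : ν ∈ D) :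
    MDifferentiableAt ICoT 𝓘(ℝ, ℝ) P.ham ν :=
  mdifferentiableAt_of_contMDiffOn hD.isOpen hD.smooth hν

theorem mem_chart (μ : CoT M) {N : Set (CoT M)} {ν : CoT M}
    (hνs : ν ∈ (extChartAt ICoT μ).source) (hν : ν ∈ N) :
    extChartAt ICoT μ ν ∈ (extChartAt ICoT μ).target ∩ (extChartAt ICoT μ).symm ⁻¹' N :=
  ⟨(extChartAt ICoT μ).map_source hνs, by
    rw [mem_preimage, (extChartAt ICoT μ).left_inv hνs]; exact hν⟩

theorem contDiffAt_chartFun (hD : P.IsHamDomain D) {μ : CoT M} {y : PhaseSpace}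
    (hy : y ∈ (extChartAt ICoT μ).target ∩ (extChartAt ICoT μ).symm ⁻¹' D) :
    ContDiffAt ℝ ∞ (chartFun μ P.ham) y :=
  (contDiffOn_chartFun μ hD.isOpen hD.smooth).contDiffAt
    ((isOpen_extChartAt_target_inter_preimage (I := ICoT) μ hD.isOpen).mem_nhds hy)

theorem differentiableAt_fderiv_chartFun (hD : P.IsHamDomain D) {μ : CoT M} {y : PhaseSpace}
    (hy : y ∈ (extChartAt ICoT μ).target ∩ (extChartAt ICoT μ).symm ⁻¹' D) :
    DifferentiableAt ℝ (fderiv ℝ (chartFun μ P.ham)) y :=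
  ((hD.contDiffAt_chartFun hy).fderiv_right (m := ∞) (by simp)).differentiableAt (by simp)

theorem contMDiffOn_hVec (hD : P.IsHamDomain D) :
    ContMDiffOn ICoT ICoT.tangent ∞
      (fun ν => (⟨ν, P.hVec ν⟩ : TangentBundle ICoT (CoT M))) D :=
  contMDiffOn_hamField hD.isOpen hD.smooth

theorem chartField_hVec (hD : P.IsHamDomain D) {μ : CoT M} {y : PhaseSpace}
    (hy : y ∈ (extChartAt ICoT μ).target ∩ (extChartAt ICoT μ).symm ⁻¹' D) :
    chartField μ P.hVec y = sharp (fderiv ℝ (chartFun μ P.ham) y) :=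
  chartField_hamField hy.1 (hD.mdifferentiableAt hy.2)

theorem contDiffAt_chartField_hVec (hD : P.IsHamDomain D) {μ : CoT M} {y : PhaseSpace}
    (hy : y ∈ (extChartAt ICoT μ).target ∩ (extChartAt ICoT μ).symm ⁻¹' D) :
    ContDiffAt ℝ ∞ (chartField μ P.hVec) y :=
  (contDiffOn_chartField μ hD.isOpen hD.contMDiffOn_hVec).contDiffAt
    ((isOpen_extChartAt_target_inter_preimage (I := ICoT) μ hD.isOpen).mem_nhds hy)

theorem omega_chartField_hVec (hD : P.IsHamDomain D) {μ : CoT M} {y : PhaseSpace}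
    (hy : y ∈ (extChartAt ICoT μ).target ∩ (extChartAt ICoT μ).symm ⁻¹' D) (w : PhaseSpace) :
    omega w (chartField μ P.hVec y) = fderiv ℝ (chartFun μ P.ham) y w := by
  rw [hD.chartField_hVec hy, omega_sharp]

theorem dfun_hVec (hD : P.IsHamDomain D) {ν : CoT M} (hν : ν ∈ D) :
    dfun P.ham ν (P.hVec ν) = 0 := by
  rw [← symplecticForm_hamField (hD.mdifferentiableAt hν), hVec,
    symplecticForm_apply_chart (mem_extChartAt_source ν), omega_self]

end IsHamDomain

variable {D N : Set (CoT M)} {e : ℝ} {v : ∀ μ : CoT M, TangentSpace ICoT μ}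

theorem IsNaturalField.fderiv_chartFun (hD : P.IsHamDomain D) (hv : P.IsNaturalField e N v)
    {μ : CoT M} {y : PhaseSpace}
    (hy : y ∈ (extChartAt ICoT μ).target ∩ (extChartAt ICoT μ).symm ⁻¹' (N ∩ D)) :
    fderiv ℝ (chartFun μ P.ham) y (chartField μ v y) = 0 := by
  have h1 := (hv.2.1 _ hy.2.1).2.1
  rw [dfun_apply_chart ((extChartAt ICoT μ).map_target hy.1) (hD.mdifferentiableAt hy.2.2),
    (extChartAt ICoT μ).right_inv hy.1] at h1
  exact h1

theorem IsNaturalField.chartField_ne_zero (hv : P.IsNaturalField e N v)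
    {μ : CoT M} {y : PhaseSpace}
    (hy : y ∈ (extChartAt ICoT μ).target ∩ (extChartAt ICoT μ).symm ⁻¹' N) :
    chartField μ v y ≠ 0 := by
  intro h
  refine (hv.2.1 _ hy.2).2.2 (dChart_injective ((extChartAt ICoT μ).map_target hy.1) ?_)
  exact h.trans (ContinuousLinearMap.map_zero _).symm

theorem IsNaturalField.contDiffAt_chartField (hN : IsOpen N) (hv : P.IsNaturalField e N v)
    {μ : CoT M} {y : PhaseSpace}
    (hy : y ∈ (extChartAt ICoT μ).target ∩ (extChartAt ICoT μ).symm ⁻¹' N) :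
    ContDiffAt ℝ ∞ (chartField μ v) y :=
  (contDiffOn_chartField μ hN hv.1).contDiffAt
    ((isOpen_extChartAt_target_inter_preimage (I := ICoT) μ hN).mem_nhds hy)

theorem IsNaturalField.chartField_fst (hv : P.IsNaturalField e N v) {μ : CoT M} {y : PhaseSpace}
    (hy : y ∈ (extChartAt ICoT μ).target ∩ (extChartAt ICoT μ).symm ⁻¹' N) :
    (chartField μ v y).1 = 0 :=
  chartField_fst_of_vertical (fun ν hν => (hv.2.1 ν hν).1) hy

/-- The natural parameter is normalized by the second derivative of the Hamiltonian. -/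
theorem IsNaturalField.fderiv_fderiv_chartFun (hD : P.IsHamDomain D) (hN : IsOpen N)
    (hv : P.IsNaturalField e N v) {μ ν : CoT M} (hνs : ν ∈ (extChartAt ICoT μ).source)
    (hν : ν ∈ N ∩ D) (hνe : ν ∈ P.level e) :
    fderiv ℝ (fderiv ℝ (chartFun μ P.ham)) (extChartAt ICoT μ ν)
      (chartField μ v (extChartAt ICoT μ ν)) (chartField μ v (extChartAt ICoT μ ν)) =
      liouville ν (P.hVec ν) := by
  have hop := isOpen_extChartAt_target_inter_preimage (I := ICoT) μ (hN.inter hD.isOpen)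
  have hy := IsHamDomain.mem_chart μ hνs hν
  have hyN := IsHamDomain.mem_chart μ hνs hν.1
  have hyD := IsHamDomain.mem_chart μ hνs hν.2
  have hvv : ∀ ν ∈ N, dproj ν (v ν) = 0 := fun ν hν => (hv.2.1 ν hν).1
  obtain ⟨b, -, hb⟩ := hv.2.2
  -- Evaluated on the Hamiltonian field, the relation for `L_v² s` loses its `b` term, because `L_v
  -- s(h) = σ(v, h) = dh(v) = 0`. What remains is `dh(Dv·v) = -s(h)`, and `D²h(v, v) = -dh(Dv·v)`.
  have h1 := hb ν ⟨hν.1, hνe⟩ (P.hVec ν) (hD.dfun_hVec hν.2)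
  have h2 : symplecticForm ν (v ν) (P.hVec ν) = 0 := by
    rw [hVec, symplecticForm_hamField (hD.mdifferentiableAt hν.2)]
    exact (hv.2.1 ν hν.1).2.1
  rw [lieD_liouville_of_vertical hN hvv hν.1, h2, lieD_lieD_liouville hN hv.1 hvv hνs hν.1,
    ← chartField_apply hνs, hD.omega_chartField_hVec hyD] at h1
  rw [fderiv_fderiv_of_tangent (hD.differentiableAt_fderiv_chartFun hyD)
    ((hv.contDiffAt_chartField hN hyN).differentiableAt (by simp)), h1]
  · ring
  · filter_upwards [hop.mem_nhds hy] with z hz using hv.fderiv_chartFun hD hz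

/-- The envelope theorem: `∂h/∂p` is the velocity at a maximizing control. -/
theorem dproj_hVec (hreg : P.IsRegular) (hD : P.IsHamDomain D) {ν : CoT M}
    (hν : ν ∈ D) {u : U} (hu : IsMaxOn (P.preHam ν) univ u) :
    dproj ν (P.hVec ν) = P.f ν.1 u := by
  have hνs := mem_extChartAt_source (I := ICoT) ν
  refine dChart_injective (I := 𝓘(ℝ, E2)) (x₀ := ν.1) (mem_extChartAt_source ν.1) ?_
  rw [dChart_dproj hνs, hVec, dChart_hamField hνs (hD.mdifferentiableAt hν)]
  ext i
  have h1 := sharp_fst (fderiv ℝ (chartFun ν P.ham) (extChartAt ICoT ν ν)) (EuclideanSpace.proj i)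
  rw [(P.legendre_ham hreg hD.isOpen hD.attained hD.smooth hν hu _).1] at h1
  exact h1

theorem exists_smul_of_apply_eq_zero {a : E2} (ha : a ≠ 0) {ξ η : E2 →L[ℝ] ℝ} (hξ : ξ ≠ 0)
    (h1 : ξ a = 0) (h2 : η a = 0) : ∃ r : ℝ, η = r • ξ := by
  obtain ⟨b, hb⟩ : ∃ b, ξ b ≠ 0 := by
    by_contra! h
    exact hξ (ContinuousLinearMap.ext h)
  have hab : LinearIndependent ℝ ![a, b] := by
    rw [LinearIndependent.pair_iff' ha]
    intro c hc
    rw [← hc, map_smul, h1, smul_zero] at hb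
    exact hb rfl
  refine ⟨η b / ξ b, sub_eq_zero.1 (covector_eq_zero_of_linearIndependent hab ?_ ?_)⟩
  · simp [h1, h2]
  · simp [hb]

/-- The natural vertical field is unique up to sign on the level. -/
theorem IsNaturalField.eq_or_eq_neg (hreg : P.IsRegular) (hD : P.IsHamDomain D) {N' : Set (CoT M)}
    {v' : ∀ μ : CoT M, TangentSpace ICoT μ} (hN : IsOpen N) (hv : P.IsNaturalField e N v)
    (hN' : IsOpen N') (hv' : P.IsNaturalField e N' v') {ν : CoT M} (hν : ν ∈ N) (hν' : ν ∈ N')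
    (hνD : ν ∈ D) (hνe : ν ∈ P.level e) : v' ν = v ν ∨ v' ν = -v ν := by
  have hνs := mem_extChartAt_source (I := ICoT) ν
  obtain ⟨u, hu⟩ := hD.attained ν hνD
  set a : E2 := dChart 𝓘(ℝ, E2) ν.1 ν.1 (P.f ν.1 u) with ha
  have ha0 : a ≠ 0 := by
    intro h
    refine (hreg ν.1 u).1.ne_zero 0 (dChart_injective (I := 𝓘(ℝ, E2)) (x₀ := ν.1)
      (mem_extChartAt_source ν.1) ?_)
    rw [map_zero]
    exact h
  have key : ∀ (N : Set (CoT M)) (v : ∀ μ : CoT M, TangentSpace ICoT μ), IsOpen N →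
      P.IsNaturalField e N v → ν ∈ N → ∃ ξ : E2 →L[ℝ] ℝ, dChart ICoT ν ν (v ν) = (0, ξ) ∧ ξ ≠ 0 ∧
        ξ a = 0 ∧ fderiv ℝ (fderiv ℝ (chartFun ν P.ham)) (extChartAt ICoT ν ν) (0, ξ) (0, ξ) =
          liouville ν (P.hVec ν) := by
    intro N v hN hv hν
    have hyN := IsHamDomain.mem_chart ν hνs hν
    have h1 : chartField ν v (extChartAt ICoT ν ν) =
        (0, (chartField ν v (extChartAt ICoT ν ν)).2) :=
      Prod.ext (hv.chartField_fst hyN) rfl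
    refine ⟨_, (chartField_apply hνs v).symm.trans h1, ?_, ?_, ?_⟩
    · intro h
      refine hv.chartField_ne_zero hyN (h1.trans ?_)
      rw [h]
      rfl
    · have h2 := hv.fderiv_chartFun hD (IsHamDomain.mem_chart ν hνs ⟨hν, hνD⟩)
      rw [h1, (P.legendre_ham hreg hD.isOpen hD.attained hD.smooth hνD hu _).1] at h2
      exact h2
    · rw [← h1]
      exact hv.fderiv_fderiv_chartFun hD hN hνs ⟨hν, hνD⟩ hνe
  obtain ⟨ξ, h1, h2, h3, h4⟩ := key N v hN hv hν
  obtain ⟨η, h1', h2', h3', h4'⟩ := key N' v' hN' hv' hν'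
  -- Both fields are covectors annihilating the same nonzero velocity in the plane, hence
  -- proportional. The common value of `D²h`, positive by the Legendre condition, then gives `r² =
  -- 1`.
  obtain ⟨r, rfl⟩ := exists_smul_of_apply_eq_zero ha0 h2 h3 h3'
  have h5 := (P.legendre_ham hreg hD.isOpen hD.attained hD.smooth hνD hu ξ).2 h2 h3
  have h6 : ((0, r • ξ) : PhaseSpace) = r • (0, ξ) := by simp
  rw [h6, bilin_smul_smul, ← h4] at h4'
  have h7 : r * r = 1 := by
    have : (r * r - 1) *
        fderiv ℝ (fderiv ℝ (chartFun ν P.ham)) (extChartAt ICoT ν ν) (0, ξ) (0, ξ) = 0 := by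
      linarith
    rcases mul_eq_zero.1 this with h | h
    · linarith
    · exact absurd h h5.ne'
  rcases mul_self_eq_one_iff.1 h7 with rfl | rfl
  · left
    refine dChart_injective hνs ?_
    rw [h1, h1', one_smul]
  · right
    refine dChart_injective hνs ?_
    have h8 : dChart ICoT ν ν (-v ν) = -dChart ICoT ν ν (v ν) := ContinuousLinearMap.map_neg _ _
    rw [h8, h1, h1', neg_one_smul, Prod.neg_mk, neg_zero]

end ControlProblem

/-! ### Iterated Lie brackets in a chart. -/

section Brackets

variable {E : Type*} [NormedAddCommGroup E] [NormedSpace ℝ E] [CompleteSpace E]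
  {H : Type*} [TopologicalSpace H] {I : ModelWithCorners ℝ E H} [I.Boundaryless]
  {N : Type*} [TopologicalSpace N] [ChartedSpace H N] [IsManifold I ∞ N]

theorem mdifferentiableAt_mlieBracket {V W : ∀ x : N, TangentSpace I x} {D : Set N} (hD : IsOpen D)
    (hV : ContMDiffOn I I.tangent ∞ (fun x => (⟨x, V x⟩ : TangentBundle I N)) D)
    (hW : ContMDiffOn I I.tangent ∞ (fun x => (⟨x, W x⟩ : TangentBundle I N)) D) {x : N}
    (hx : x ∈ D) :
    MDifferentiableAt I I.tangent
      (fun x => (⟨x, VectorField.mlieBracket I V W x⟩ : TangentBundle I N)) x := by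
  have : IsManifold I (2 + 1) N := IsManifold.of_le (n := ∞) (WithTop.coe_le_coe.2 le_top)
  have : IsManifold I (minSmoothness ℝ 2) N := by
    rw [minSmoothness_of_isRCLikeNormedField]; infer_instance
  have h2 : (2 : ℕ∞ω) ≤ ∞ := WithTop.coe_le_coe.2 le_top
  have h := ContMDiffAt.mlieBracket_vectorField (m := 1) (n := 2) (I := I) (U := V) (V := W) (x := x)
    (((hV x hx).contMDiffAt (hD.mem_nhds hx)).of_le h2)
    (((hW x hx).contMDiffAt (hD.mem_nhds hx)).of_le h2)
    (by rw [minSmoothness_of_isRCLikeNormedField]; norm_num)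
  exact h.mdifferentiableAt (by simp)

theorem chartField_mlieBracket_mlieBracket {x₀ : N} {V W : ∀ x : N, TangentSpace I x} {D : Set N}
    (hD : IsOpen D)
    (hV : ContMDiffOn I I.tangent ∞ (fun x => (⟨x, V x⟩ : TangentBundle I N)) D)
    (hW : ContMDiffOn I I.tangent ∞ (fun x => (⟨x, W x⟩ : TangentBundle I N)) D) {y : E}
    (hy : y ∈ (extChartAt I x₀).target ∩ (extChartAt I x₀).symm ⁻¹' D) :
    chartField x₀ (VectorField.mlieBracket I W (VectorField.mlieBracket I V W)) y =
      VectorField.lieBracket ℝ (chartField x₀ W)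
        (VectorField.lieBracket ℝ (chartField x₀ V) (chartField x₀ W)) y := by
  have hop := isOpen_extChartAt_target_inter_preimage (I := I) x₀ hD
  rw [chartField_mlieBracket hy.1 (mdifferentiableAt_vectorField hD hW hy.2)
    (mdifferentiableAt_mlieBracket hD hV hW hy.2)]
  refine Filter.EventuallyEq.lieBracket_vectorField_eq Filter.EventuallyEq.rfl ?_
  filter_upwards [hop.mem_nhds hy] with z hz
  exact chartField_mlieBracket hz.1 (mdifferentiableAt_vectorField hD hV hz.2)
    (mdifferentiableAt_vectorField hD hW hz.2)

theorem exists_chartField_eq (x₀ : N) (w : E → E) :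
    ∃ v : ∀ x : N, TangentSpace I x, ∀ y ∈ (extChartAt I x₀).target, chartField x₀ v y = w y := by
  refine ⟨fun x => (dChartSymm I x₀ (extChartAt I x₀ x) (w (extChartAt I x₀ x)) : E),
    fun y hy => ?_⟩
  have key : ∀ z, z = y →
      dChart I x₀ ((extChartAt I x₀).symm y) (dChartSymm I x₀ z (w z) : E) = w y := by
    rintro z rfl
    exact dChart_dChartSymm hy _
  exact key _ ((extChartAt I x₀).right_inv hy)

end Brackets

/-! ### Existence of the curvature in the time-optimal case -/

section TimeOptimal

variable {H : PhaseSpace → ℝ} {X : PhaseSpace → PhaseSpace} {y : PhaseSpace} {c : ℝ}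

/-- If `s(X) = H + c`, the Hamiltonian field preserves the Liouville form `s`. -/
theorem pairing_lieBracket (hXd : DifferentiableAt ℝ X y)
    (hX : ∀ w, omega w (X y) = fderiv ℝ H y w) (hs : ∀ᶠ z in 𝓝 y, pairing z (X z) = H z + c)
    {Y : PhaseSpace → PhaseSpace} (hY : DifferentiableAt ℝ Y y) :
    pairing y (VectorField.lieBracket ℝ X Y y) = fderiv ℝ (fun z => pairing z (Y z)) y (X y) := by
  have hd : ∀ Z : PhaseSpace → PhaseSpace, DifferentiableAt ℝ Z y → ∀ a,
      fderiv ℝ (fun z => pairing z (Z z)) y a =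
        pairing y (fderiv ℝ Z y a) + pairing a (Z y) := by
    intro Z hZ a
    rw [(pairing.hasFDerivAt.clm_apply hZ.hasFDerivAt).fderiv]
    rfl
  have h1 : fderiv ℝ (fun z => pairing z (X z)) y (Y y) = fderiv ℝ H y (Y y) := by
    have h2 : (fun z => pairing z (X z)) =ᶠ[𝓝 y] fun z => H z + c := hs
    rw [h2.fderiv_eq, fderiv_add_const]
  rw [hd X hXd, ← hX, omega_apply] at h1
  rw [hd Y hY, VectorField.lieBracket, map_sub]
  simp only [pairing_apply] at h1 ⊢
  linarith

/-- The flow of `X` preserves `H`, so bracketing with `X` preserves tangency to the levels.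
Concretely, invariance of `omega` is applied to `omega (Y, X) = dH(Y) = 0`. -/
theorem fderiv_lieBracket_hamiltonian (hH : ContDiffAt ℝ 2 H y) (hXd : DifferentiableAt ℝ X y)
    (hX : ∀ᶠ z in 𝓝 y, ∀ w, omega w (X z) = fderiv ℝ H z w)
    {Y : PhaseSpace → PhaseSpace} (hY : DifferentiableAt ℝ Y y)
    (h0 : ∀ᶠ z in 𝓝 y, fderiv ℝ H z (Y z) = 0) :
    fderiv ℝ H y (VectorField.lieBracket ℝ X Y y) = 0 := by
  have h1 := fderiv_omega_apply_hamiltonian omega_swap hH hXd hX hY hXd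
  have h2 : (fun z => omega (Y z) (X z)) =ᶠ[𝓝 y] fun _ => (0 : ℝ) := by
    filter_upwards [hX, h0] with z hz hz0 using (hz _).trans hz0
  rw [h2.fderiv_eq, VectorField.lieBracket_self, hX.self_of_nhds] at h1
  simpa using h1.symm

/-- The covectors `ξ ≠ 0` and `p` are independent because `ξ` kills `a` and `p` does not; in the
plane only zero is killed by both. -/
theorem covector_pair_eq_zero {a b : E2} {ξ p : E2 →L[ℝ] ℝ} (hξ : ξ ≠ 0) (h1 : ξ a = 0)
    (h2 : p a ≠ 0) (h3 : ξ b = 0) (h4 : p b = 0) : b = 0 := by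
  by_contra hb
  have ha : a ≠ 0 := by rintro rfl; simp at h2
  refine hξ (covector_eq_zero_of_linearIndependent (a := b) (b := a) ?_ h3 h1)
  rw [LinearIndependent.pair_iff' hb]
  intro r hr
  rw [← hr, map_smul, h4, smul_zero] at h2
  exact h2 rfl

theorem ContDiffAt.lieBracket {V W : PhaseSpace → PhaseSpace} (hV : ContDiffAt ℝ ∞ V y)
    (hW : ContDiffAt ℝ ∞ W y) : ContDiffAt ℝ ∞ (VectorField.lieBracket ℝ V W) y :=
  ContDiffAt.sub ((hW.fderiv_right (m := ∞) (by simp)).clm_apply hV)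
    ((hV.fderiv_right (m := ∞) (by simp)).clm_apply hW)

/-- Since `X` preserves `H`, the Liouville form and `omega`, the vector `u = [X, [v, X]]` is
annihilated by `dH`, by `s` and by `omega (v, ·)`. The last two make `u` vertical, and `dH(u) = 0`
then puts it on the line of `v`. -/
theorem exists_lieBracket_lieBracket_eq_smul {O : Set PhaseSpace} (hO : IsOpen O) (hy : y ∈ O)
    {v : PhaseSpace → PhaseSpace} (hH : ∀ z ∈ O, ContDiffAt ℝ ∞ H z)
    (hXs : ∀ z ∈ O, ContDiffAt ℝ ∞ X z) (hvs : ∀ z ∈ O, ContDiffAt ℝ ∞ v z)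
    (hX : ∀ z ∈ O, ∀ w, omega w (X z) = fderiv ℝ H z w)
    (hs : ∀ z ∈ O, pairing z (X z) = H z + c) (hv1 : ∀ z ∈ O, (v z).1 = 0)
    (hv0 : ∀ z ∈ O, fderiv ℝ H z (v z) = 0)
    (hv2 : ∀ z ∈ O, fderiv ℝ (fderiv ℝ H) z (v z) (v z) = H z + c) (hc : 0 < H y + c)
    (hvy : v y ≠ 0) :
    ∃ k : ℝ, VectorField.lieBracket ℝ X (VectorField.lieBracket ℝ v X) y = k • v y := by
  have hnear : ∀ z ∈ O, ∀ {p : PhaseSpace → Prop}, (∀ z ∈ O, p z) → ∀ᶠ z' in 𝓝 z, p z' :=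
    fun z hz p hp => Filter.mem_of_superset (hO.mem_nhds hz) hp
  have hX' : ∀ z ∈ O, DifferentiableAt ℝ X z := fun z hz => (hXs z hz).differentiableAt (by simp)
  have hv' : ∀ z ∈ O, DifferentiableAt ℝ v z := fun z hz => (hvs z hz).differentiableAt (by simp)
  have hH2 : ∀ z ∈ O, ContDiffAt ℝ 2 H z := fun z hz =>
    (hH z hz).of_le (WithTop.coe_le_coe.2 le_top)
  have hH3 : ∀ z ∈ O, DifferentiableAt ℝ (fderiv ℝ H) z := fun z hz =>
    ((hH z hz).fderiv_right (m := ∞) (by simp)).differentiableAt (by simp)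
  set w := VectorField.lieBracket ℝ v X with hw
  have hws : ∀ z ∈ O, ContDiffAt ℝ ∞ w z := fun z hz => (hvs z hz).lieBracket (hXs z hz)
  have hw' : ∀ z ∈ O, DifferentiableAt ℝ w z := fun z hz => (hws z hz).differentiableAt (by simp)
  have hwn : ∀ z, VectorField.lieBracket ℝ X v z = -w z := fun z => by
    simp [hw, VectorField.lieBracket]
  have hw0 : ∀ z ∈ O, fderiv ℝ H z (w z) = 0 := fun z hz => by
    have := fderiv_lieBracket_hamiltonian (hH2 z hz) (hX' z hz) (hnear z hz hX) (hv' z hz)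
      (hnear z hz hv0)
    rw [hwn, map_neg] at this
    linarith
  have hps : ∀ z ∈ O, pairing z (w z) = 0 := fun z hz => by
    have := pairing_lieBracket (hX' z hz) (hX z hz) (hnear z hz hs) (hv' z hz)
    have h1 : (fun z => pairing z (v z)) =ᶠ[𝓝 z] fun _ => (0 : ℝ) :=
      hnear z hz fun z hz => by
        change pairing z (v z) = 0
        rw [pairing_apply, hv1 z hz, map_zero]
    rw [hwn, map_neg, h1.fderiv_eq] at this
    simpa using this
  -- The normalization of `v` turns `omega (v, w)` into a first integral of `X`. Differentiating it
  -- along `X`, with `[X, v] = -w` and `omega (w, w) = 0`, yields `omega (v, u) = 0` below.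
  have hvw : ∀ z ∈ O, omega (v z) (w z) = H z + c := fun z hz => by
    have h1 : (fderiv ℝ v z (X z)).1 = 0 := by
      have e1 := (ContinuousLinearMap.fst ℝ E2 (E2 →L[ℝ] ℝ)).hasFDerivAt.comp _ (hv' z hz).hasFDerivAt
      have e2 : (fun z => (v z).1) =ᶠ[𝓝 z] fun _ => (0 : E2) := hnear z hz hv1
      exact DFunLike.congr_fun ((e1.congr_of_eventuallyEq e2.symm).unique
        (hasFDerivAt_const (0 : E2) _)) (X z)
    rw [hw, VectorField.lieBracket, map_sub,
      omega_fderiv_of_hamiltonian (hH3 z hz) (hX' z hz) (hnear z hz hX), hv2 z hz,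
      omega_of_fst_eq_zero (hv1 z hz), h1, map_zero, sub_zero]
  set u := VectorField.lieBracket ℝ X w y with hu
  have hu0 : fderiv ℝ H y u = 0 :=
    fderiv_lieBracket_hamiltonian (hH2 y hy) (hX' y hy) (hnear y hy hX) (hw' y hy)
      (hnear y hy hw0)
  have hus : pairing y u = 0 := by
    have h1 : (fun z => pairing z (w z)) =ᶠ[𝓝 y] fun _ => (0 : ℝ) := hnear y hy hps
    rw [hu, pairing_lieBracket (hX' y hy) (hX y hy) (hnear y hy hs) (hw' y hy),
      h1.fderiv_eq]
    simp
  have hvu : omega (v y) u = 0 := by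
    have h1 := fderiv_omega_apply_hamiltonian omega_swap (hH2 y hy) (hX' y hy)
      (hnear y hy hX) (hv' y hy) (hw' y hy)
    have h2 : (fun z => omega (v z) (w z)) =ᶠ[𝓝 y] fun z => H z + c := hnear y hy hvw
    rw [h2.fderiv_eq, fderiv_add_const, ← hX y hy, omega_self, hwn, map_neg,
      neg_apply, omega_self] at h1
    simpa using h1.symm
  have hξ : (v y).2 ≠ 0 := fun h => hvy (Prod.ext (hv1 y hy) h)
  have hξX : (v y).2 (X y).1 = 0 := by
    rw [← omega_of_fst_eq_zero (hv1 y hy), hX y hy, hv0 y hy]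
  have hpX : y.2 (X y).1 ≠ 0 := by
    have := hs y hy
    rw [pairing_apply] at this
    rw [this]
    exact hc.ne'
  have hu1 : u.1 = 0 := covector_pair_eq_zero hξ hξX hpX
    (by rw [← omega_of_fst_eq_zero (hv1 y hy)]; exact hvu) hus
  have hX1 : (X y).1 ≠ 0 := fun h => hpX (by rw [h, map_zero])
  obtain ⟨k, hk⟩ := ControlProblem.exists_smul_of_apply_eq_zero hX1 hξ hξX (η := u.2)
    (by rw [← omega_of_fst_eq_zero hu1, hX y hy]; exact hu0)
  refine ⟨k, Prod.ext ?_ hk⟩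
  rw [hu1, Prod.smul_fst, hv1 y hy, smul_zero]

/-- The covector `b ↦ a₀ b₁ - a₁ b₀`. -/
noncomputable def rotCovector : E2 →L[ℝ] E2 →L[ℝ] ℝ :=
  (EuclideanSpace.proj 0 : E2 →L[ℝ] ℝ).smulRight (EuclideanSpace.proj 1 : E2 →L[ℝ] ℝ) -
    (EuclideanSpace.proj 1 : E2 →L[ℝ] ℝ).smulRight (EuclideanSpace.proj 0 : E2 →L[ℝ] ℝ)

theorem rotCovector_apply (a b : E2) : rotCovector a b = a 0 * b 1 - a 1 * b 0 := rfl

theorem rotCovector_self (a : E2) : rotCovector a a = 0 := by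
  rw [rotCovector_apply]; ring

theorem rotCovector_ne_zero {a : E2} (ha : a ≠ 0) : rotCovector a ≠ 0 := by
  intro h
  apply ha
  have h0 := DFunLike.congr_fun h (EuclideanSpace.single 0 1)
  have h1 := DFunLike.congr_fun h (EuclideanSpace.single 1 1)
  rw [rotCovector_apply] at h0 h1
  ext i
  fin_cases i
  · simpa using h1
  · simpa using h0

/-- The rotated velocity is a vertical vector tangent to the level; rescaling it achieves `D²H(v, v)
= H + c = s(X)`. With this choice the covector of `Dv·v` plus `p` kills the velocity, hence is a
multiple of `v`, which is the equation of the natural parameter. -/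
theorem exists_normalized_field {O : Set PhaseSpace} (hO : IsOpen O) (hy : y ∈ O)
    (hH : ∀ z ∈ O, ContDiffAt ℝ ∞ H z) (hXs : ∀ z ∈ O, ContDiffAt ℝ ∞ X z)
    (hX : ∀ z ∈ O, ∀ w, omega w (X z) = fderiv ℝ H z w)
    (hs : ∀ z ∈ O, pairing z (X z) = H z + c) (hc : 0 < H y + c)
    (hG : ∀ ξ : E2 →L[ℝ] ℝ, ξ ≠ 0 → ξ (X y).1 = 0 →
      0 < fderiv ℝ (fderiv ℝ H) y (0, ξ) (0, ξ)) :
    ∃ O' ⊆ O, IsOpen O' ∧ y ∈ O' ∧ ∃ (v : PhaseSpace → PhaseSpace) (b : PhaseSpace → ℝ),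
      ∀ z ∈ O', ContDiffAt ℝ ∞ v z ∧ ContDiffAt ℝ ∞ b z ∧ (v z).1 = 0 ∧ v z ≠ 0 ∧
        fderiv ℝ H z (v z) = 0 ∧ fderiv ℝ (fderiv ℝ H) z (v z) (v z) = H z + c ∧
        (fderiv ℝ v z (v z)).2 + z.2 = b z • (v z).2 := by
  have hX1 : (X y).1 ≠ 0 := by
    intro h
    have := hs y hy
    rw [pairing_apply, h, map_zero] at this
    exact hc.ne this
  set ξ₀ : PhaseSpace → E2 →L[ℝ] ℝ := fun z => rotCovector (X z).1 with hξ₀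
  set v₀ : PhaseSpace → PhaseSpace := fun z => (0, ξ₀ z) with hv₀
  set G : PhaseSpace → ℝ := fun z => fderiv ℝ (fderiv ℝ H) z (v₀ z) (v₀ z) with hGdef
  -- Evaluation at `n` later exhibits the proportionality factor `b` as a quotient of smooth
  -- functions with nonzero denominator.
  obtain ⟨n, hn⟩ : ∃ n, ξ₀ y n ≠ 0 := by
    by_contra! h
    exact rotCovector_ne_zero hX1 (ContinuousLinearMap.ext h)
  have hξs : ∀ z ∈ O, ContDiffAt ℝ ∞ ξ₀ z := fun z hz =>
    rotCovector.contDiff.contDiffAt.comp z (contDiffAt_fst.comp z (hXs z hz))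
  have hv₀s : ∀ z ∈ O, ContDiffAt ℝ ∞ v₀ z := fun z hz => contDiffAt_const.prodMk (hξs z hz)
  have hGs : ∀ z ∈ O, ContDiffAt ℝ ∞ G z := fun z hz =>
    ((((hH z hz).fderiv_right (m := ∞) (by simp)).fderiv_right (m := ∞) (by simp)).clm_apply
      (hv₀s z hz)).clm_apply (hv₀s z hz)
  have hns : ∀ z ∈ O, ContDiffAt ℝ ∞ (fun z => ξ₀ z n) z := fun z hz =>
    (hξs z hz).clm_apply contDiffAt_const
  have hGy : 0 < G y := hG _ (rotCovector_ne_zero hX1) (rotCovector_self _)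
  have hev : ∀ᶠ z in 𝓝 y, z ∈ O ∧ 0 < G z ∧ 0 < H z + c ∧ ξ₀ z n ≠ 0 := by
    refine Filter.Eventually.and (hO.mem_nhds hy) (((hGs y hy).continuousAt.eventually (lt_mem_nhds hGy)).and
      ((((hH y hy).continuousAt.add continuousAt_const).eventually (lt_mem_nhds hc)).and
        ((hns y hy).continuousAt.eventually_ne hn)))
  obtain ⟨O', hO'sub, hO', hyO'⟩ := eventually_nhds_iff.1 hev |>.imp fun t ht => ht
  set g : PhaseSpace → ℝ := fun z => √((H z + c) / G z) with hg
  have hgs : ∀ z ∈ O', ContDiffAt ℝ ∞ g z := fun z hz => by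
    obtain ⟨h1, h2, h3, h4⟩ := hO'sub z hz
    exact (((hH z h1).add contDiffAt_const).div (hGs z h1) h2.ne').sqrt (div_pos h3 h2).ne'
  have hg0 : ∀ z ∈ O', 0 < g z := fun z hz => by
    obtain ⟨h1, h2, h3, h4⟩ := hO'sub z hz
    exact Real.sqrt_pos.2 (div_pos h3 h2)
  set v : PhaseSpace → PhaseSpace := fun z => g z • v₀ z with hv
  have hvs : ∀ z ∈ O', ContDiffAt ℝ ∞ v z := fun z hz =>
    (hgs z hz).smul (hv₀s z (hO'sub z hz).1)
  have hvn : ∀ z ∈ O', (v z).2 n ≠ 0 := fun z hz =>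
    mul_ne_zero (hg0 z hz).ne' (hO'sub z hz).2.2.2
  have hv1 : ∀ z, (v z).1 = 0 := fun z => by simp [hv, hv₀]
  have hvX : ∀ z, (v z).2 (X z).1 = 0 := fun z => by
    simp [hv, hv₀, hξ₀, rotCovector_self]
  have hvH : ∀ z ∈ O', fderiv ℝ H z (v z) = 0 := fun z hz => by
    rw [← hX z (hO'sub z hz).1, omega_of_fst_eq_zero (hv1 z), hvX]
  have hv2 : ∀ z ∈ O', fderiv ℝ (fderiv ℝ H) z (v z) (v z) = H z + c := fun z hz => by
    obtain ⟨h1, h2, h3, h4⟩ := hO'sub z hz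
    rw [hv]
    simp only
    rw [bilin_smul_smul, hg]
    simp only
    rw [Real.mul_self_sqrt (div_pos h3 h2).le]
    exact div_mul_cancel₀ _ h2.ne'
  have hDvs : ∀ z ∈ O', ContDiffAt ℝ ∞ (fun z => (fderiv ℝ v z (v z)).2 + z.2) z := fun z hz =>
    (contDiffAt_snd.comp z
      (((hvs z hz).fderiv_right (m := ∞) (by simp)).clm_apply (hvs z hz))).add contDiffAt_snd
  refine ⟨O', fun z hz => (hO'sub z hz).1, hO', hyO', v,
    fun z => ((fderiv ℝ v z (v z)).2 + z.2) n / (v z).2 n, fun z hz =>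
    ⟨hvs z hz, ?_, hv1 z, fun h => hvn z hz (by rw [h]; rfl), hvH z hz, hv2 z hz, ?_⟩⟩
  · exact ((hDvs z hz).clm_apply contDiffAt_const).div
      ((contDiffAt_snd.comp z (hvs z hz)).clm_apply contDiffAt_const) (hvn z hz)
  · have hzO := (hO'sub z hz).1
    have hX1z : (X z).1 ≠ 0 := fun h => (hO'sub z hz).2.2.2 (by simp [hξ₀, h])
    have hd : DifferentiableAt ℝ v z := (hvs z hz).differentiableAt (by simp)
    have h1 : (fderiv ℝ v z (v z)).1 = 0 := by
      have e1 := (ContinuousLinearMap.fst ℝ E2 (E2 →L[ℝ] ℝ)).hasFDerivAt.comp _ hd.hasFDerivAt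
      have e2 : (fun z => (v z).1) =ᶠ[𝓝 z] fun _ => (0 : E2) := Filter.Eventually.of_forall hv1
      exact DFunLike.congr_fun ((e1.congr_of_eventuallyEq e2.symm).unique
        (hasFDerivAt_const (0 : E2) _)) (v z)
    have h2 := fderiv_fderiv_of_tangent (((hH z hzO).fderiv_right (m := ∞)
      (by simp)).differentiableAt (by simp)) hd
      (Filter.mem_of_superset (hO'.mem_nhds hz) hvH) (v z)
    -- This reads `⟨p, X⟩ = D²H(v, v) = -dH(Dv·v) = -⟨Dv·v, X⟩`, so `Dv·v + p` annihilates the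
    -- velocity.
    rw [hv2 z hz, ← hX z hzO, omega_of_fst_eq_zero h1, ← hs z hzO, pairing_apply] at h2
    obtain ⟨r, hr⟩ := ControlProblem.exists_smul_of_apply_eq_zero hX1z (ξ := (v z).2)
      (η := (fderiv ℝ v z (v z)).2 + z.2) (fun h => hvn z hz (by rw [h]; rfl)) (hvX z)
      (by rw [add_apply]; linarith)
    change _ = (((fderiv ℝ v z (v z)).2 + z.2) n / (v z).2 n) • (v z).2
    rw [hr, smul_apply, smul_eq_mul, mul_div_cancel_right₀ _ (hvn z hz)]

end TimeOptimal

/-! ### The curvature of a time-optimal problem. -/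

namespace ControlProblem

variable {M U : Type*} [TopologicalSpace M] [ChartedSpace E2 M] [IsManifold 𝓘(ℝ, E2) ∞ M]
  [TopologicalSpace U] [ChartedSpace ℝ U] [IsManifold 𝓘(ℝ, ℝ) ∞ U] {P : ControlProblem M U}
  {D : Set (CoT M)} {e c : ℝ}

/-- At a maximizing control `s(h) = ⟨μ, f⟩`, which exceeds the maximized Hamiltonian by the constant
cost. -/
theorem pairing_chartField_hVec (hreg : P.IsRegular) (hD : P.IsHamDomain D)
    (hc : ∀ q u, P.cost q u = c) {μ : CoT M} {y : PhaseSpace}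
    (hy : y ∈ (extChartAt ICoT μ).target ∩ (extChartAt ICoT μ).symm ⁻¹' D) :
    pairing y (chartField μ P.hVec y) = chartFun μ P.ham y + c := by
  obtain ⟨u, hu⟩ := hD.attained _ hy.2
  have h1 := liouville_apply_chart ((extChartAt ICoT μ).map_target hy.1)
    (P.hVec ((extChartAt ICoT μ).symm y))
  rw [(extChartAt ICoT μ).right_inv hy.1] at h1
  have h2 : liouville ((extChartAt ICoT μ).symm y) (P.hVec ((extChartAt ICoT μ).symm y)) =
      ((extChartAt ICoT μ).symm y).2 (P.f ((extChartAt ICoT μ).symm y).1 u) := by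
    rw [← dproj_hVec hreg hD hy.2 hu]
    rfl
  have h3 : chartFun μ P.ham y = P.preHam ((extChartAt ICoT μ).symm y) u := P.ham_eq_preHam hu
  rw [h3, preHam, hc, sub_add_cancel, ← h2, h1]
  rfl

theorem fderiv_fderiv_chartFun_pos (hreg : P.IsRegular) (hD : P.IsHamDomain D) {μ : CoT M}
    (hμ : μ ∈ D) {ξ : E2 →L[ℝ] ℝ} (hξ : ξ ≠ 0)
    (h0 : ξ (chartField μ P.hVec (extChartAt ICoT μ μ)).1 = 0) :
    0 < fderiv ℝ (fderiv ℝ (chartFun μ P.ham)) (extChartAt ICoT μ μ) (0, ξ) (0, ξ) := by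
  obtain ⟨u, hu⟩ := hD.attained μ hμ
  have hμs := mem_extChartAt_source (I := ICoT) μ
  have key := P.legendre_ham hreg hD.isOpen hD.attained hD.smooth hμ hu ξ
  refine key.2 hξ ?_
  rw [← key.1, ← sharp_fst, ← hD.chartField_hVec (IsHamDomain.mem_chart μ hμs hμ)]
  exact h0

/-- In the time-optimal case the curvature is defined at every point of the level. -/
theorem exists_isCurvatureAt_of_timeOptimal (hreg : P.IsRegular) (hD : P.IsHamDomain D)
    (hc : ∀ q u, P.cost q u = c) (hec : 0 < e + c) {μ : CoT M} (hμ : μ ∈ D)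
    (hμe : μ ∈ P.level e) : ∃ k, P.IsCurvatureAt e μ k := by
  have hμs := mem_extChartAt_source (I := ICoT) μ
  have hop := isOpen_extChartAt_target_inter_preimage (I := ICoT) μ hD.isOpen
  have hy := IsHamDomain.mem_chart μ hμs hμ
  have hHy : chartFun μ P.ham (extChartAt ICoT μ μ) = e := by
    rw [chartFun, (extChartAt ICoT μ).left_inv hμs]
    exact P.ham_eq_of_mem_level hμe
  have hcy : 0 < chartFun μ P.ham (extChartAt ICoT μ μ) + c := by rwa [hHy]
  obtain ⟨O', hO'sub, hO', hyO', w, b, hw⟩ := exists_normalized_field hop hy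
    (fun z hz => hD.contDiffAt_chartFun hz) (fun z hz => hD.contDiffAt_chartField_hVec hz)
    (fun z hz => hD.omega_chartField_hVec hz)
    (fun z hz => pairing_chartField_hVec hreg hD hc hz) hcy
    (fun ξ hξ h0 => fderiv_fderiv_chartFun_pos hreg hD hμ hξ h0)
  obtain ⟨v, hv⟩ := exists_chartField_eq (I := ICoT) μ w
  set N : Set (CoT M) := (extChartAt ICoT μ).source ∩ extChartAt ICoT μ ⁻¹' O' with hN
  have hNo : IsOpen N := isOpen_extChartAt_preimage' μ hO'
  have hNs : N ⊆ (extChartAt ICoT μ).source := inter_subset_left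
  have hND : N ⊆ D := fun ν hν => by
    have := (hO'sub hν.2).2
    rwa [mem_preimage, (extChartAt ICoT μ).left_inv hν.1] at this
  have hNO : ∀ z ∈ (extChartAt ICoT μ).target ∩ (extChartAt ICoT μ).symm ⁻¹' N, z ∈ O' := by
    intro z hz
    have := hz.2.2
    rwa [mem_preimage, (extChartAt ICoT μ).right_inv hz.1] at this
  have hON : ∀ z ∈ O', z ∈ (extChartAt ICoT μ).target ∩ (extChartAt ICoT μ).symm ⁻¹' N := by
    intro z hz
    have hzt := (hO'sub hz).1
    refine ⟨hzt, (extChartAt ICoT μ).map_target hzt, ?_⟩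
    rwa [mem_preimage, (extChartAt ICoT μ).right_inv hzt]
  have hvs : ContMDiffOn ICoT ICoT.tangent ∞
      (fun μ => (⟨μ, v μ⟩ : TangentBundle ICoT (CoT M))) N := by
    refine contMDiffOn_of_contDiffOn_chartField μ hNo hNs ?_
    refine ContDiffOn.congr (f := w) (fun z hz => ((hw z (hNO z hz)).1).contDiffWithinAt)
      fun z hz => hv z hz.1
  have hvν : ∀ ν ∈ N, dChart ICoT μ ν (v ν) = w (extChartAt ICoT μ ν) := fun ν hν => by
    rw [← chartField_apply hν.1, hv _ ((extChartAt ICoT μ).map_source hν.1)]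
  have hvert : ∀ ν ∈ N, dproj ν (v ν) = 0 := fun ν hν => by
    refine dChart_injective (I := 𝓘(ℝ, E2)) (mem_cot_extChartAt_source.1 hν.1) ?_
    rw [dChart_dproj hν.1, hvν ν hν, (hw _ hν.2).2.2.1, map_zero]
  have hvw : ∀ z ∈ O', chartField μ v =ᶠ[𝓝 z] w := fun z hz => by
    filter_upwards [hO'.mem_nhds hz] with a ha using hv a (hO'sub ha).1
  have hnat : P.IsNaturalField e N v := by
    refine ⟨hvs, fun ν hν => ⟨hvert ν hν, ?_, ?_⟩, fun ν => b (extChartAt ICoT μ ν), ?_, ?_⟩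
    · rw [dfun_apply_chart hν.1 (hD.mdifferentiableAt (hND hν)), hvν ν hν]
      exact (hw _ hν.2).2.2.2.2.1
    · intro h
      refine (hw _ hν.2).2.2.2.1 ?_
      rw [← hvν ν hν, h]
      exact ContinuousLinearMap.map_zero _
    · intro ν hν
      exact ((hw _ hν.2).2.1.contMDiffAt.comp ν
        (contMDiffAt_extChartAt_of_mem hν.1)).contMDiffWithinAt
    · intro ν hν a _
      have h1 := hw _ hν.1.2
      have hy1 := (extChartAt ICoT μ).map_source hν.1.1
      rw [lieD_lieD_liouville hNo hvs hvert hν.1.1 hν.1,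
        lieD_liouville_of_vertical hNo hvert hν.1, symplecticForm_apply_chart hν.1.1,
        liouville_apply_chart hν.1.1, hvν ν hν.1, (hvw _ hν.1.2).fderiv_eq,
        hv _ hy1, omega_of_fst_eq_zero h1.2.2.1]
      have h2 := DFunLike.congr_fun h1.2.2.2.2.2.2 (dChart ICoT μ ν a).1
      rw [add_apply, smul_apply, smul_eq_mul] at h2
      have h3 : (fderiv ℝ w (extChartAt ICoT μ ν) (w (extChartAt ICoT μ ν))).1 = 0 := by
        have e1 := (ContinuousLinearMap.fst ℝ E2 (E2 →L[ℝ] ℝ)).hasFDerivAt.comp _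
          (h1.1.differentiableAt (by simp)).hasFDerivAt
        have e2 : (fun z => (w z).1) =ᶠ[𝓝 (extChartAt ICoT μ ν)] fun _ => (0 : E2) := by
          filter_upwards [hO'.mem_nhds hν.1.2] with z hz using (hw z hz).2.2.1
        exact DFunLike.congr_fun ((e1.congr_of_eventuallyEq e2.symm).unique
          (hasFDerivAt_const (0 : E2) _)) _
      rw [omega_of_fst_eq_zero h3]
      linarith
  have hμN : μ ∈ N := ⟨hμs, hyO'⟩
  obtain ⟨k, hk⟩ := exists_lieBracket_lieBracket_eq_smul (c := c) hO' hyO'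
    (H := chartFun μ P.ham) (X := chartField μ P.hVec) (v := w)
    (fun z hz => hD.contDiffAt_chartFun (hO'sub hz))
    (fun z hz => hD.contDiffAt_chartField_hVec (hO'sub hz)) (fun z hz => (hw z hz).1)
    (fun z hz => hD.omega_chartField_hVec (hO'sub hz))
    (fun z hz => pairing_chartField_hVec hreg hD hc (hO'sub hz)) (fun z hz => (hw z hz).2.2.1)
    (fun z hz => (hw z hz).2.2.2.2.1) (fun z hz => (hw z hz).2.2.2.2.2.1) hcy
    (hw _ hyO').2.2.2.1
  refine ⟨k, N, hNo, hμN, v, hnat, dChart_injective hμs ?_⟩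
  rw [← chartField_apply hμs (VectorField.mlieBracket ICoT P.hVec
      (VectorField.mlieBracket ICoT v P.hVec)),
    chartField_mlieBracket_mlieBracket hNo hvs (hD.contMDiffOn_hVec.mono hND) (hON _ hyO'),
    Filter.EventuallyEq.lieBracket_vectorField_eq (V := chartField μ P.hVec)
      Filter.EventuallyEq.rfl ((hvw _ hyO').lieBracket_vectorField Filter.EventuallyEq.rfl), hk,
    ← hvν μ hμN]
  exact (ContinuousLinearMap.map_smul _ k (v μ)).symm

end ControlProblem

/-! ### Sturm comparison for functions given up to sign -/

section Sturm

/-- Near every point of `[0, T]` the function `u` is the absolute value of a function `y` which at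
that point satisfies `y'' = -κ y`. -/
def IsAbsJacobi (u κ : ℝ → ℝ) (T : ℝ) : Prop :=
  ∀ t ∈ Icc 0 T, ∃ y z : ℝ → ℝ,
    (∀ᶠ τ in 𝓝[Icc 0 T] t, |y τ| = u τ ∧ HasDerivWithinAt y (z τ) (Icc 0 T) τ) ∧
    HasDerivWithinAt z (-κ t * y t) (Icc 0 T) t ∧ (t = 0 → y 0 = 0 ∧ z 0 ≠ 0)

namespace IsAbsJacobi

variable {u κ : ℝ → ℝ} {T : ℝ}

theorem nonneg (h : IsAbsJacobi u κ T) {t : ℝ} (ht : t ∈ Icc 0 T) : 0 ≤ u t := by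
  obtain ⟨y, z, h1, -, -⟩ := h t ht
  rw [← (h1.self_of_nhdsWithin ht).1]
  exact abs_nonneg _

theorem continuousOn (h : IsAbsJacobi u κ T) : ContinuousOn u (Icc 0 T) := by
  intro t ht
  obtain ⟨y, z, h1, -, -⟩ := h t ht
  have h2 := h1.self_of_nhdsWithin ht
  exact h2.2.continuousWithinAt.abs.congr_of_eventuallyEq
    (h1.mono fun τ hτ => hτ.1.symm) h2.1.symm

theorem zero (h : IsAbsJacobi u κ T) (hT : 0 ≤ T) : u 0 = 0 := by
  obtain ⟨y, z, h1, -, h3⟩ := h 0 ⟨le_rfl, hT⟩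
  rw [← (h1.self_of_nhdsWithin ⟨le_rfl, hT⟩).1, (h3 rfl).1, abs_zero]

/-- At time `0` the local function has a nonzero derivative, so `0` is an isolated zero. -/
theorem eventually_pos (h : IsAbsJacobi u κ T) (hT : 0 < T) : ∀ᶠ t in 𝓝[>] 0, 0 < u t := by
  have h0 : (0 : ℝ) ∈ Icc 0 T := ⟨le_rfl, hT.le⟩
  obtain ⟨y, z, h1, -, h3⟩ := h 0 h0
  obtain ⟨hy0, hz0⟩ := h3 rfl
  have h4 := (h1.self_of_nhdsWithin h0).2
  have h5 : ∀ᶠ t in 𝓝[Icc 0 T \ {0}] 0, y t ≠ 0 := by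
    have := h4.eventually_ne (c := 0) hz0
    exact this
  have h6 : 𝓝[>] (0 : ℝ) ≤ 𝓝[Icc 0 T \ {0}] 0 := by
    rw [nhdsWithin_le_iff]
    filter_upwards [Ioc_mem_nhdsGT hT] with t ht using ⟨⟨ht.1.le, ht.2⟩, ht.1.ne'⟩
  have h7 : 𝓝[>] (0 : ℝ) ≤ 𝓝[Icc 0 T] 0 := h6.trans (nhdsWithin_mono _ sdiff_subset)
  filter_upwards [h6 h5, h7 h1] with t ht ht1
  rw [← ht1.1]
  exact abs_pos.2 ht

/-- As long as `u` does not vanish it is a solution of `u'' = -κ u`. -/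
theorem hasDerivWithinAt (h : IsAbsJacobi u κ T) {a : ℝ} (ha : 0 < a) (haT : a ≤ T)
    (hpos : ∀ t ∈ Ioo 0 a, 0 < u t) {t : ℝ} (ht : t ∈ Icc 0 a) :
    HasDerivWithinAt u (derivWithin u (Icc 0 a) t) (Icc 0 a) t ∧
      HasDerivWithinAt (derivWithin u (Icc 0 a)) (-κ t * u t) (Icc 0 a) t := by
  have hsub : Icc 0 a ⊆ Icc 0 T := Icc_subset_Icc_right haT
  obtain ⟨y, z, h1, h2, -⟩ := h t (hsub ht)
  obtain ⟨δ, hδ, hJ⟩ := Metric.mem_nhdsWithin_iff.1 h1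
  set J := Metric.ball t δ ∩ Icc 0 a with hJdef
  have hJ1 : ∀ τ ∈ J, |y τ| = u τ ∧ HasDerivWithinAt y (z τ) (Icc 0 T) τ := fun τ hτ =>
    hJ ⟨hτ.1, hsub hτ.2⟩
  have hJn : J ∈ 𝓝[Icc 0 a] t := Filter.inter_mem
    (mem_nhdsWithin_of_mem_nhds (Metric.ball_mem_nhds t hδ)) self_mem_nhdsWithin
  have hJo : OrdConnected J := by
    rw [hJdef, Real.ball_eq_Ioo]
    exact ordConnected_Ioo.inter ordConnected_Icc
  -- Since `u > 0` inside `(0, a)`, the function `y` can vanish on `J` only at the ends `0` and `a`.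
  -- Hence `K` is an interval, `y` has constant sign on it, and `u = ± y` on all of `J`, which
  -- removes the absolute value.
  set K := {τ ∈ J | y τ ≠ 0} with hK
  have hKo : OrdConnected K := by
    refine ⟨fun x hx x' hx' τ hτ => ⟨hJo.out hx.1 hx'.1 hτ, ?_⟩⟩
    intro hy
    have hτJ := hJo.out hx.1 hx'.1 hτ
    have hu : u τ = 0 := by rw [← (hJ1 τ hτJ).1, hy, abs_zero]
    have hx0 : x ≠ 0 := by
      rintro rfl
      apply hx.2
      have := h.zero (ha.le.trans haT)
      rw [← (hJ1 0 hx.1).1] at this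
      exact abs_eq_zero.1 this
    have hτ0 : 0 < τ := ((hx.1.2.1).lt_of_ne hx0.symm).trans_le hτ.1
    rcases hτJ.2.2.lt_or_eq with hlt | rfl
    · exact (hpos τ ⟨hτ0, hlt⟩).ne' hu
    · have : x' = τ := le_antisymm hx'.1.2.2 hτ.2
      exact hx'.2 (this ▸ hy)
  have hyc : ContinuousOn y K := fun τ hτ =>
    (hJ1 τ hτ.1).2.continuousWithinAt.mono fun x hx => hsub hx.1.2
  obtain ⟨s, hs, hsu⟩ : ∃ s : ℝ, s ≠ 0 ∧ ∀ τ ∈ J, u τ = s * y τ := by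
    have hsq := hKo.isPreconnected.eq_or_eq_neg_of_sq_eq (f := fun τ => |y τ|) (g := y) hyc.abs hyc
      (fun τ _ => by simp) (fun hτ => hτ.2)
    rcases hsq with hsq | hsq
    · refine ⟨1, one_ne_zero, fun τ hτ => ?_⟩
      by_cases hy : y τ = 0
      · rw [← (hJ1 τ hτ).1, hy]; simp
      · rw [← (hJ1 τ hτ).1, one_mul]
        exact hsq ⟨hτ, hy⟩
    · refine ⟨-1, by norm_num, fun τ hτ => ?_⟩
      by_cases hy : y τ = 0
      · rw [← (hJ1 τ hτ).1, hy]; simp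
      · rw [← (hJ1 τ hτ).1, neg_one_mul]
        exact hsq ⟨hτ, hy⟩
  have hJnear : ∀ τ ∈ J, J ∈ 𝓝[Icc 0 a] τ := fun τ hτ =>
    Filter.inter_mem (mem_nhdsWithin_of_mem_nhds (Metric.isOpen_ball.mem_nhds hτ.1))
      self_mem_nhdsWithin
  have hud : ∀ τ ∈ J, HasDerivWithinAt u (s * z τ) (Icc 0 a) τ := fun τ hτ =>
    (((hJ1 τ hτ).2.mono hsub).const_mul s).congr_of_eventuallyEq
      (Filter.mem_of_superset (hJnear τ hτ) hsu) (hsu τ hτ)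
  have hdu : ∀ τ ∈ J, derivWithin u (Icc 0 a) τ = s * z τ := fun τ hτ =>
    (hud τ hτ).derivWithin (uniqueDiffOn_Icc ha τ hτ.2)
  have htJ : t ∈ J := ⟨Metric.mem_ball_self hδ, ht⟩
  refine ⟨(hud t htJ).differentiableWithinAt.hasDerivWithinAt, ?_⟩
  refine (((h2.mono hsub).const_mul s).congr_of_eventuallyEq
    (Filter.mem_of_superset hJn hdu) (hdu t htJ)).congr_deriv ?_
  rw [hsu t htJ]
  ring

/-- The Wronskian of `u` and `sin (r t)`. -/
theorem exists_wronskian (h : IsAbsJacobi u κ T) {a : ℝ} (ha : 0 < a) (haT : a ≤ T)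
    (hpos : ∀ t ∈ Ioo 0 a, 0 < u t) (r : ℝ) :
    ∃ W : ℝ → ℝ, ContinuousOn W (Icc 0 a) ∧ W 0 = 0 ∧
      W a = derivWithin u (Icc 0 a) a * Real.sin (r * a) - u a * (r * Real.cos (r * a)) ∧
      ∀ t ∈ Ioo 0 a, HasDerivAt W ((r ^ 2 - κ t) * (u t * Real.sin (r * t))) t := by
  have key := fun t (ht : t ∈ Icc 0 a) => h.hasDerivWithinAt ha haT hpos ht
  have hS : ∀ t, HasDerivAt (fun t => Real.sin (r * t)) (r * Real.cos (r * t)) t := fun t => by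
    have := ((hasDerivAt_id t).const_mul r).sin
    simpa [mul_comm] using this
  have hC : ∀ t, HasDerivAt (fun t => r * Real.cos (r * t)) (-(r ^ 2 * Real.sin (r * t))) t :=
    fun t => by
      have := (((hasDerivAt_id t).const_mul r).cos).const_mul r
      refine this.congr_deriv ?_
      simp
      ring
  have hW : ∀ t ∈ Icc 0 a, HasDerivWithinAt (fun t => derivWithin u (Icc 0 a) t * Real.sin (r * t) -
      u t * (r * Real.cos (r * t))) ((r ^ 2 - κ t) * (u t * Real.sin (r * t))) (Icc 0 a) t := by
    intro t ht
    refine (((key t ht).2.fun_mul (hS t).hasDerivWithinAt).fun_sub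
      ((key t ht).1.fun_mul (hC t).hasDerivWithinAt)).congr_deriv ?_
    ring
  refine ⟨_, fun t ht => (hW t ht).continuousWithinAt, ?_, rfl, fun t ht =>
    (hW t ⟨ht.1.le, ht.2.le⟩).hasDerivAt (Icc_mem_nhds ht.1 ht.2)⟩
  simp [h.zero (ha.le.trans haT)]

/-- Sturm comparison from above: `κ < r²` excludes zeros in `(0, π / r]`. -/
theorem ne_zero_of_lt (h : IsAbsJacobi u κ T) {r : ℝ} (hr : 0 < r) (hT : 0 < T)
    (hTr : T * r ≤ Real.pi) (hκ : ∀ t ∈ Icc 0 T, κ t < r ^ 2) : u T ≠ 0 := by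
  intro huT
  obtain ⟨η, hη, hηpos⟩ := mem_nhdsGT_iff_exists_Ioc_subset.1 (h.eventually_pos hT)
  -- The least element `a` of this compact set is the first positive zero of `u`, because `u` is
  -- positive on `(0, η]`.
  set Z := {t ∈ Icc (min η T) T | u t = 0} with hZ
  have hη' : 0 < min η T := lt_min hη hT
  have hZc : IsCompact Z := by
    have : IsClosed Z := (h.continuousOn.mono (Icc_subset_Icc_left hη'.le)).preimage_isClosed_of_isClosed
      isClosed_Icc (isClosed_singleton (x := (0 : ℝ)))
    exact isCompact_Icc.of_isClosed_subset this fun t ht => ht.1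
  obtain ⟨a, haZ, hamin⟩ := hZc.exists_isLeast ⟨T, ⟨min_le_right _ _, le_rfl⟩, huT⟩
  have ha : 0 < a := hη'.trans_le haZ.1.1
  have haT : a ≤ T := haZ.1.2
  have hpos : ∀ t ∈ Ioo 0 a, 0 < u t := by
    intro t ht
    have htT : t ∈ Icc 0 T := ⟨ht.1.le, ht.2.le.trans haT⟩
    rcases le_or_gt t η with htη | htη
    · exact hηpos ⟨ht.1, htη⟩
    · refine (h.nonneg htT).lt_of_ne fun h0 => ?_
      exact absurd (hamin ⟨⟨(min_le_left _ _).trans htη.le, htT.2⟩, h0.symm⟩) (not_le.2 ht.2)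
  obtain ⟨W, hWc, hW0, hWa, hWd⟩ := h.exists_wronskian ha haT hpos r
  have hra : r * a ≤ Real.pi := by nlinarith
  have hmono : StrictMonoOn W (Icc 0 a) := by
    refine strictMonoOn_of_deriv_pos (convex_Icc 0 a) hWc fun t ht => ?_
    rw [interior_Icc] at ht
    rw [(hWd t ht).deriv]
    refine mul_pos (sub_pos.2 (hκ t ⟨ht.1.le, ht.2.le.trans haT⟩)) (mul_pos (hpos t ht)
      (Real.sin_pos_of_pos_of_lt_pi (mul_pos hr ht.1) ?_))
    nlinarith [ht.2]
  have h1 : 0 < W a := hW0 ▸ hmono ⟨le_rfl, ha.le⟩ ⟨ha.le, le_rfl⟩ ha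
  -- A nonnegative function arriving at a zero has nonpositive left derivative. Then `W a = u'(a)
  -- sin (r a) ≤ 0`, although `W` increases strictly from `0`.
  have h2 : derivWithin u (Icc 0 a) a ≤ 0 := by
    have hd := (h.hasDerivWithinAt ha haT hpos (t := a) ⟨ha.le, le_rfl⟩).1
    rw [hasDerivWithinAt_iff_tendsto_slope, Icc_sdiff_right] at hd
    have : (𝓝[Ico 0 a] a).NeBot := by
      rw [nhdsWithin_Ico_eq_nhdsLT ha]; infer_instance
    refine le_of_tendsto hd ?_
    filter_upwards [self_mem_nhdsWithin] with t ht
    rw [slope_def_field, haZ.2, sub_zero]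
    have := h.nonneg (t := t) ⟨ht.1, ht.2.le.trans haT⟩
    exact div_nonpos_of_nonneg_of_nonpos this (by linarith [ht.2])
  rw [hWa, haZ.2, zero_mul, sub_zero] at h1
  have h3 : 0 ≤ Real.sin (r * a) :=
    Real.sin_nonneg_of_nonneg_of_le_pi (mul_pos hr ha).le hra
  nlinarith

/-- Sturm comparison from below: `r² ≤ κ` forces a zero in `(0, π / r]`. -/
theorem exists_zero_of_le (h : IsAbsJacobi u κ T) {r : ℝ} (hr : 0 < r) (hT : 0 < T)
    (hTr : r * T = Real.pi) (hκ : ∀ t ∈ Icc 0 T, r ^ 2 ≤ κ t) : ∃ t ∈ Ioc 0 T, u t = 0 := by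
  by_contra! hne
  have hpos : ∀ t ∈ Ioc 0 T, 0 < u t := fun t ht =>
    (h.nonneg ⟨ht.1.le, ht.2⟩).lt_of_ne (hne t ht).symm
  obtain ⟨W, hWc, hW0, hWa, hWd⟩ := h.exists_wronskian hT le_rfl
    (fun t ht => hpos t ⟨ht.1, ht.2.le⟩) r
  have hanti : AntitoneOn W (Icc 0 T) := by
    refine antitoneOn_of_deriv_nonpos (convex_Icc 0 T) hWc ?_ fun t ht => ?_
    · rw [interior_Icc]
      exact fun t ht => (hWd t ht).differentiableAt.differentiableWithinAt
    rw [interior_Icc] at ht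
    rw [(hWd t ht).deriv]
    refine mul_nonpos_of_nonpos_of_nonneg (sub_nonpos.2 (hκ t ⟨ht.1.le, ht.2.le⟩))
      (mul_pos (hpos t ⟨ht.1, ht.2.le⟩) (Real.sin_pos_of_pos_of_lt_pi (mul_pos hr ht.1) ?_)).le
    rw [← hTr]
    exact mul_lt_mul_of_pos_left ht.2 hr
  have h1 : W T ≤ 0 := hW0 ▸ hanti ⟨le_rfl, hT.le⟩ ⟨hT.le, le_rfl⟩ hT.le
  -- At `r T = π` the Wronskian equals `r u(T)`, which is positive here, while `W` decreases from
  -- `0`.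
  rw [hWa, hTr, Real.sin_pi, Real.cos_pi] at h1
  have := mul_pos (hpos T ⟨hT, le_rfl⟩) hr
  linarith

/-- Strict Sturm comparison from below: `r² < κ` forces a zero in `(0, π / r)`. -/
theorem exists_zero_of_lt (h : IsAbsJacobi u κ T) {r : ℝ} (hr : 0 < r) (hT : 0 < T)
    (hTr : r * T = Real.pi) (hκ : ∀ t ∈ Icc 0 T, r ^ 2 < κ t) : ∃ t ∈ Ioo 0 T, u t = 0 := by
  by_contra! hne
  have hpos : ∀ t ∈ Ioo 0 T, 0 < u t := fun t ht =>
    (h.nonneg ⟨ht.1.le, ht.2.le⟩).lt_of_ne (hne t ht).symm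
  obtain ⟨W, hWc, hW0, hWa, hWd⟩ := h.exists_wronskian hT le_rfl hpos r
  have hanti : StrictAntiOn W (Icc 0 T) := by
    refine strictAntiOn_of_deriv_neg (convex_Icc 0 T) hWc fun t ht => ?_
    rw [interior_Icc] at ht
    rw [(hWd t ht).deriv]
    refine mul_neg_of_neg_of_pos (sub_neg.2 (hκ t ⟨ht.1.le, ht.2.le⟩))
      (mul_pos (hpos t ht) (Real.sin_pos_of_pos_of_lt_pi (mul_pos hr ht.1) ?_))
    rw [← hTr]
    exact mul_lt_mul_of_pos_left ht.2 hr
  have h1 : W T < 0 := hW0 ▸ hanti ⟨le_rfl, hT.le⟩ ⟨hT.le, le_rfl⟩ hT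
  -- Now `W T = r u(T)` is negative, which contradicts even `u T ≥ 0`; the zero is therefore found
  -- strictly before `T`.
  rw [hWa, hTr, Real.sin_pi, Real.cos_pi] at h1
  have := mul_nonneg (h.nonneg (t := T) ⟨hT.le, le_rfl⟩) hr.le
  linarith

end IsAbsJacobi

end Sturm

/-! ### Jacobi fields -/

section Variation

variable {V : Type*} [NormedAddCommGroup V] [NormedSpace ℝ V] [CompleteSpace V]
  {β : V →L[ℝ] V →L[ℝ] ℝ} {H : V → ℝ} {X : V → V}

/-- The variation `∂G/∂ε` solves the linearized equation and `DX` is infinitesimally symplectic, so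
the derivative falls on `Y` in the form of a Lie bracket. Applied twice, this yields the Jacobi
equation. -/
theorem hasDerivAt_omega_variation (hβ : ∀ a b, β a b = -β b a) {G : ℝ × ℝ → V} {O : Set (ℝ × ℝ)}
    (hO : IsOpen O) (hG : ContDiffOn ℝ 1 G O) {Q : Set V} (hQ : IsOpen Q)
    (hH : ∀ z ∈ Q, ContDiffAt ℝ ∞ H z) (hXs : ∀ z ∈ Q, ContDiffAt ℝ ∞ X z)
    (hX : ∀ z ∈ Q, ∀ w, β w (X z) = fderiv ℝ H z w) (hGQ : ∀ z ∈ O, G z ∈ Q)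
    (hode : ∀ z ∈ O, HasDerivAt (fun τ => G (τ, z.2)) (X (G z)) z.1) {t ε : ℝ} (h : (t, ε) ∈ O)
    {Y : V → V} (hY : DifferentiableAt ℝ Y (G (t, ε))) :
    HasDerivAt (fun τ => β (Y (G (τ, ε))) (fderiv ℝ G (τ, ε) (0, 1)))
      (β (VectorField.lieBracket ℝ X Y (G (t, ε))) (fderiv ℝ G (t, ε) (0, 1))) t := by
  have hq := hGQ _ h
  have h1 := hasDerivAt_variation hO hG hQ
    (fun z hz => ((hXs z hz).of_le (by simp)).contDiffWithinAt) hGQ hode h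
  have h2 : HasDerivAt (fun τ => Y (G (τ, ε))) (fderiv ℝ Y (G (t, ε)) (X (G (t, ε)))) t :=
    hY.hasFDerivAt.comp_hasDerivAt t (hode _ h)
  have h3 : HasDerivAt (fun τ => β (Y (G (τ, ε)))) (β (fderiv ℝ Y (G (t, ε)) (X (G (t, ε))))) t :=
    β.hasFDerivAt.comp_hasDerivAt t h2
  refine (h3.clm_apply h1).congr_deriv ?_
  have h4 := omega_fderiv_add_omega_fderiv hβ ((hH _ hq).of_le (WithTop.coe_le_coe.2 le_top))
    ((hXs _ hq).differentiableAt (by simp)) (Filter.mem_of_superset (hQ.mem_nhds hq) hX)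
    (Y (G (t, ε))) (fderiv ℝ G (t, ε) (0, 1))
  rw [VectorField.lieBracket, map_sub, sub_apply]
  linarith

end Variation

/-! ### Fans of extremals and their critical points. -/

namespace ControlProblem

variable {M U : Type*} [TopologicalSpace M] [ChartedSpace E2 M] [IsManifold 𝓘(ℝ, E2) ∞ M]
  [TopologicalSpace U] [ChartedSpace ℝ U] [IsManifold 𝓘(ℝ, ℝ) ∞ U] {P : ControlProblem M U}
  {D : Set (CoT M)} {e : ℝ} {l : ℝ → CoT M}

/-- The surface swept on `[0, T]`, under the Hamiltonian flow, by a regular parametrization of the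
curve `h⁻¹(e) ∩ T*_{q₀} M` near `l 0`. -/
structure IsFan (P : ControlProblem M U) (e : ℝ) (l : ℝ → CoT M) (T δ : ℝ) (Λ : ℝ × ℝ → CoT M) :
    Prop where
  pos : 0 < δ
  contMDiffOn : ContMDiffOn 𝓘(ℝ, ℝ × ℝ) ICoT 1 Λ (Ioo (-δ) (T + δ) ×ˢ Ioo (-δ) δ)
  initial : ∀ ε ∈ Ioo (-δ) δ, Λ (0, ε) ∈ P.level e ∧ proj (Λ (0, ε)) = proj (l 0) ∧
    IsMIntegralCurveOn (fun τ => Λ (τ, ε)) P.hVec (Ioo (-δ) (T + δ))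
  central : ∀ τ ∈ Icc 0 T, Λ (τ, 0) = l τ
  regular : mfderiv 𝓘(ℝ, ℝ) ICoT (fun ε : ℝ => Λ (0, ε)) 0 ≠ 0

theorem isConjugateTime_iff {t : ℝ} : P.IsConjugateTime e l t ↔ 0 < t ∧ ∃ δ Λ, P.IsFan e l t δ Λ ∧
    ¬ Function.Surjective
      (mfderiv 𝓘(ℝ, ℝ × ℝ) 𝓘(ℝ, E2) (fun x : ℝ × ℝ => proj (Λ x)) (t, 0)) := by
  constructor
  · rintro ⟨ht, δ, hδ, Λ, h1, h2, h3, h4, h5⟩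
    exact ⟨ht, δ, Λ, ⟨hδ, h1, h2, h3, h4⟩, h5⟩
  · rintro ⟨ht, δ, Λ, ⟨hδ, h1, h2, h3, h4⟩, h5⟩
    exact ⟨ht, δ, hδ, Λ, h1, h2, h3, h4, h5⟩

namespace IsFan

variable {T δ : ℝ} {Λ : ℝ × ℝ → CoT M}

theorem restrict (hΛ : P.IsFan e l T δ Λ) {t : ℝ} (htT : t ≤ T) : P.IsFan e l t δ Λ where
  pos := hΛ.pos
  contMDiffOn := hΛ.contMDiffOn.mono
    (prod_mono (Ioo_subset_Ioo_right (by linarith)) Subset.rfl)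
  initial ε hε := ⟨(hΛ.initial ε hε).1, (hΛ.initial ε hε).2.1,
    (hΛ.initial ε hε).2.2.mono (Ioo_subset_Ioo_right (by linarith))⟩
  central τ hτ := hΛ.central τ ⟨hτ.1, hτ.2.trans htT⟩
  regular := hΛ.regular

theorem isOpen_domain (hΛ : P.IsFan e l T δ Λ) {N : Set (CoT M)} (hN : IsOpen N) :
    IsOpen (Ioo (-δ) (T + δ) ×ˢ Ioo (-δ) δ ∩ Λ ⁻¹' N) :=
  hΛ.contMDiffOn.continuousOn.isOpen_inter_preimage (isOpen_Ioo.prod isOpen_Ioo) hN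

theorem mem_domain (hΛ : P.IsFan e l T δ Λ) {τ : ℝ} (hτ : τ ∈ Icc 0 T) :
    ((τ, 0) : ℝ × ℝ) ∈ Ioo (-δ) (T + δ) ×ˢ Ioo (-δ) δ :=
  have := hΛ.pos
  ⟨⟨by linarith [hτ.1], by linarith [hτ.2]⟩, by simpa⟩

theorem mdifferentiableAt (hΛ : P.IsFan e l T δ Λ) {x : ℝ × ℝ}
    (hx : x ∈ Ioo (-δ) (T + δ) ×ˢ Ioo (-δ) δ) : MDifferentiableAt 𝓘(ℝ, ℝ × ℝ) ICoT Λ x :=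
  ((hΛ.contMDiffOn x hx).contMDiffAt
    ((isOpen_Ioo.prod isOpen_Ioo).mem_nhds hx)).mdifferentiableAt one_ne_zero

theorem contDiffOn_chart (hΛ : P.IsFan e l T δ Λ) {N : Set (CoT M)} {μ : CoT M}
    (hNs : N ⊆ (extChartAt ICoT μ).source) :
    ContDiffOn ℝ 1 (fun x => extChartAt ICoT μ (Λ x))
      (Ioo (-δ) (T + δ) ×ˢ Ioo (-δ) δ ∩ Λ ⁻¹' N) := by
  rw [← contMDiffOn_iff_contDiffOn]
  intro x hx
  have h1 : ContMDiffAt 𝓘(ℝ, ℝ × ℝ) ICoT 1 Λ x := (hΛ.contMDiffOn x hx.1).contMDiffAt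
    ((isOpen_Ioo.prod isOpen_Ioo).mem_nhds hx.1)
  exact (((contMDiffAt_extChartAt_of_mem (hNs hx.2)).of_le (by simp)).comp x h1).contMDiffWithinAt

theorem hasDerivAt_chart (hΛ : P.IsFan e l T δ Λ) {μ : CoT M} {x : ℝ × ℝ}
    (hx : x ∈ Ioo (-δ) (T + δ) ×ˢ Ioo (-δ) δ) (hxs : Λ x ∈ (extChartAt ICoT μ).source) :
    HasDerivAt (fun τ => extChartAt ICoT μ (Λ (τ, x.2)))
      (chartField μ P.hVec (extChartAt ICoT μ (Λ x))) x.1 :=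
  (((hΛ.initial x.2 hx.2).2.2 x.1 hx.1).hasDerivWithinAt_extChartAt
    (γ := fun τ => Λ (τ, x.2)) hxs).hasDerivAt (Ioo_mem_nhds hx.1.1 hx.1.2)

theorem fderiv_chart (hΛ : P.IsFan e l T δ Λ) {μ : CoT M} {x : ℝ × ℝ}
    (hx : x ∈ Ioo (-δ) (T + δ) ×ˢ Ioo (-δ) δ) (hxs : Λ x ∈ (extChartAt ICoT μ).source)
    (a : ℝ × ℝ) :
    fderiv ℝ (fun x => extChartAt ICoT μ (Λ x)) x a =
      dChart ICoT μ (Λ x) (mfderiv 𝓘(ℝ, ℝ × ℝ) ICoT Λ x a) := by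
  have h := mfderiv_comp_apply x (mdifferentiableAt_extChartAt_of_mem hxs)
    (hΛ.mdifferentiableAt hx) a
  rw [mfderiv_eq_fderiv] at h
  exact h

/-- The Jacobi field `∂Λ/∂ε`. -/
noncomputable def jacobi (Λ : ℝ × ℝ → CoT M) (τ : ℝ) : TangentSpace ICoT (Λ (τ, 0)) :=
  mfderiv 𝓘(ℝ, ℝ × ℝ) ICoT Λ (τ, 0) ((0, 1) : ℝ × ℝ)

theorem mfderiv_proj_apply (hΛ : P.IsFan e l T δ Λ) {t : ℝ} (ht : t ∈ Icc 0 T) (a b : ℝ) :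
    mfderiv 𝓘(ℝ, ℝ × ℝ) 𝓘(ℝ, E2) (fun x : ℝ × ℝ => proj (Λ x)) (t, 0) ((a, b) : ℝ × ℝ) =
      dproj (Λ (t, 0)) (a • P.hVec (Λ (t, 0)) + b • jacobi Λ t) := by
  have hx := hΛ.mem_domain ht
  have h1 := mfderiv_comp_apply ((t, 0) : ℝ × ℝ) (mdifferentiableAt_proj (Λ (t, 0)))
    (hΛ.mdifferentiableAt hx) ((a, b) : ℝ × ℝ)
  refine Eq.trans h1 (congrArg (dproj (Λ (t, 0))) ?_)
  have hxs := mem_extChartAt_source (I := ICoT) (Λ (t, 0))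
  refine dChart_injective hxs ?_
  have hsum : ((a, b) : ℝ × ℝ) = a • ((1, 0) : ℝ × ℝ) + b • ((0, 1) : ℝ × ℝ) := by simp
  have hd : DifferentiableAt ℝ (fun x => extChartAt ICoT (Λ (t, 0)) (Λ x)) (t, 0) := by
    have := (mdifferentiableAt_extChartAt_of_mem hxs).comp (t, 0) (hΛ.mdifferentiableAt hx)
    exact mdifferentiableAt_iff_differentiableAt.1 this
  have h2 : fderiv ℝ (fun x => extChartAt ICoT (Λ (t, 0)) (Λ x)) (t, 0) (1, 0) =
      dChart ICoT (Λ (t, 0)) (Λ (t, 0)) (P.hVec (Λ (t, 0))) := by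
    have e1 : HasDerivAt (fun τ : ℝ => ((τ, 0) : ℝ × ℝ)) (1, 0) t :=
      (hasDerivAt_id t).prodMk (hasDerivAt_const t 0)
    have e2 := hd.hasFDerivAt.comp_hasDerivAt t e1
    rw [← chartField_apply hxs]
    exact e2.unique (hΛ.hasDerivAt_chart hx hxs)
  have h3 := hΛ.fderiv_chart hx hxs (0, 1)
  have h4 := hΛ.fderiv_chart hx hxs (a, b)
  rw [← h4, hsum, map_add, map_smul, map_smul, h2, h3]
  have h5 : dChart ICoT (Λ (t, 0)) (Λ (t, 0)) (a • P.hVec (Λ (t, 0)) + b • jacobi Λ t) =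
      a • dChart ICoT (Λ (t, 0)) (Λ (t, 0)) (P.hVec (Λ (t, 0))) +
      b • dChart ICoT (Λ (t, 0)) (Λ (t, 0)) (jacobi Λ t) := by
    rw [ContinuousLinearMap.map_add, ContinuousLinearMap.map_smul, ContinuousLinearMap.map_smul]
  rw [h5]
  rfl

/-- The initial curve stays in one fibre and in one level and is regular; these give the three
properties of its velocity. -/
theorem initial_variation (hΛ : P.IsFan e l T δ Λ) (hT : 0 ≤ T) {μ : CoT M}
    (hμs : Λ (0, 0) ∈ (extChartAt ICoT μ).source)
    (hh : MDifferentiableAt ICoT 𝓘(ℝ, ℝ) P.ham (Λ (0, 0))) :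
    (dChart ICoT μ (Λ (0, 0)) (jacobi Λ 0)).1 = 0 ∧
      fderiv ℝ (chartFun μ P.ham) (extChartAt ICoT μ (Λ (0, 0)))
        (dChart ICoT μ (Λ (0, 0)) (jacobi Λ 0)) = 0 ∧
      dChart ICoT μ (Λ (0, 0)) (jacobi Λ 0) ≠ 0 := by
  have hx := hΛ.mem_domain (τ := 0) ⟨le_rfl, hT⟩
  have he1 : HasDerivAt (fun ε : ℝ => ((0, ε) : ℝ × ℝ)) (0, 1) 0 :=
    (hasDerivAt_const (0 : ℝ) (0 : ℝ)).prodMk (hasDerivAt_id (0 : ℝ))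
  have hnear : ∀ᶠ ε in 𝓝 (0 : ℝ), ε ∈ Ioo (-δ) δ := Ioo_mem_nhds (neg_lt_zero.2 hΛ.pos) hΛ.pos
  have hd : DifferentiableAt ℝ (fun x => extChartAt ICoT μ (Λ x)) (0, 0) := by
    have := (mdifferentiableAt_extChartAt_of_mem hμs).comp (0, 0) (hΛ.mdifferentiableAt hx)
    exact mdifferentiableAt_iff_differentiableAt.1 this
  have hJ : HasDerivAt (fun ε : ℝ => extChartAt ICoT μ (Λ (0, ε)))
      (dChart ICoT μ (Λ (0, 0)) (jacobi Λ 0)) 0 := by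
    have := hd.hasFDerivAt.comp_hasDerivAt 0 he1
    rw [hΛ.fderiv_chart hx hμs] at this
    exact this
  refine ⟨?_, ?_, ?_⟩
  · have h1 := (ContinuousLinearMap.fst ℝ E2 (E2 →L[ℝ] ℝ)).hasFDerivAt.comp_hasDerivAt (0 : ℝ) hJ
    refine h1.unique ((hasDerivAt_const (0 : ℝ)
      (extChartAt 𝓘(ℝ, E2) μ.1 (proj (l 0)))).congr_of_eventuallyEq ?_)
    filter_upwards [hnear] with ε hε
    rw [← (hΛ.initial ε hε).2.1]
    exact cot_extChartAt_fst μ (Λ (0, ε))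
  · have hcont : ContinuousAt (fun ε : ℝ => Λ (0, ε)) 0 := by
      have h0 : ContinuousAt Λ ((fun ε : ℝ => ((0, ε) : ℝ × ℝ)) 0) :=
        (hΛ.mdifferentiableAt hx).continuousAt
      exact ContinuousAt.comp (f := fun ε : ℝ => ((0, ε) : ℝ × ℝ)) h0 he1.continuousAt
    have hdH : DifferentiableAt ℝ (chartFun μ P.ham) (extChartAt ICoT μ (Λ (0, 0))) := by
      have hy := (extChartAt ICoT μ).map_source hμs
      have e1 : MDifferentiableAt ICoT 𝓘(ℝ, ℝ) P.ham
          ((extChartAt ICoT μ).symm (extChartAt ICoT μ (Λ (0, 0)))) := by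
        rwa [(extChartAt ICoT μ).left_inv hμs]
      exact mdifferentiableAt_iff_differentiableAt.1
        (e1.comp _ (mdifferentiableAt_extChartAt_symm hy))
    have h1 := hdH.hasFDerivAt.comp_hasDerivAt (0 : ℝ) hJ
    refine h1.unique ((hasDerivAt_const (0 : ℝ) e).congr_of_eventuallyEq ?_)
    filter_upwards [hnear, hcont ((isOpen_extChartAt_source μ).mem_nhds hμs)] with ε hε hεs
    have h2 := P.ham_eq_of_mem_level (hΛ.initial ε hε).1
    rw [← h2, Function.comp_apply, chartFun, (extChartAt ICoT μ).left_inv hεs]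
  · intro h0
    have hJ0 : jacobi Λ 0 = 0 :=
      dChart_injective hμs (h0.trans (ContinuousLinearMap.map_zero _).symm)
    refine hΛ.regular ?_
    have hm : MDifferentiableAt 𝓘(ℝ, ℝ) 𝓘(ℝ, ℝ × ℝ) (fun ε : ℝ => ((0, ε) : ℝ × ℝ)) 0 :=
      he1.differentiableAt.mdifferentiableAt
    have h1 := mfderiv_comp_apply (0 : ℝ)
      (show MDifferentiableAt 𝓘(ℝ, ℝ × ℝ) ICoT Λ ((fun ε : ℝ => ((0, ε) : ℝ × ℝ)) 0) from
        hΛ.mdifferentiableAt hx) hm (1 : ℝ)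
    have h2 : mfderiv 𝓘(ℝ, ℝ) 𝓘(ℝ, ℝ × ℝ) (fun ε : ℝ => ((0, ε) : ℝ × ℝ)) 0 (1 : ℝ) =
        ((0, 1) : ℝ × ℝ) := by
      rw [mfderiv_eq_fderiv]
      exact he1.deriv
    rw [h2] at h1
    refine ContinuousLinearMap.ext_ring ?_
    exact h1.trans hJ0

end IsFan

theorem dChart_hVec_fst_ne_zero (hreg : P.IsRegular) (hD : P.IsHamDomain D) {μ ν : CoT M}
    (hνs : ν ∈ (extChartAt ICoT μ).source) (hν : ν ∈ D) :
    (dChart ICoT μ ν (P.hVec ν)).1 ≠ 0 := by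
  obtain ⟨u, hu⟩ := hD.attained ν hν
  rw [← dChart_dproj hνs, dproj_hVec hreg hD hν hu]
  intro h
  refine (hreg ν.1 u).1.ne_zero 0 (dChart_injective (I := 𝓘(ℝ, E2)) (x₀ := μ.1)
    (mem_cot_extChartAt_source.1 hνs) ?_)
  rw [map_zero]
  exact h

/-- In the plane the kernel of `ξ` is the line of `x`, so `j` completes `x` to a basis exactly when
it lies outside this kernel. -/
theorem forall_exists_smul_add_smul_iff {x j : E2} {ξ : E2 →L[ℝ] ℝ} (hξ : ξ ≠ 0) (hx : x ≠ 0)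
    (hξx : ξ x = 0) : (∀ w : E2, ∃ a b : ℝ, a • x + b • j = w) ↔ ξ j ≠ 0 := by
  constructor
  · intro h hj
    refine hξ (ContinuousLinearMap.ext fun w => ?_)
    obtain ⟨a, b, rfl⟩ := h w
    simp [hξx, hj]
  · intro hj w
    by_contra! hne
    have hind : LinearIndependent ℝ ![x, w - (ξ w / ξ j) • j] := by
      rw [LinearIndependent.pair_iff' hx]
      intro a ha
      exact hne a (ξ w / ξ j) (by rw [ha, sub_add_cancel])
    refine hξ (covector_eq_zero_of_linearIndependent hind hξx ?_)
    simp [hj]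

/-- The image is spanned by `π_* h ≠ 0` and `π_* J`. As a covector `v` annihilates `π_* h`, and
`σ(v, J)` is its value on `π_* J`. -/
theorem IsFan.surjective_iff (hreg : P.IsRegular) (hD : P.IsHamDomain D) {T δ : ℝ}
    {Λ : ℝ × ℝ → CoT M} (hΛ : P.IsFan e l T δ Λ) {t : ℝ} (ht : t ∈ Icc 0 T) {N : Set (CoT M)}
    {v : ∀ μ : CoT M, TangentSpace ICoT μ} (hv : P.IsNaturalField e N v) (hN : Λ (t, 0) ∈ N)
    (htD : Λ (t, 0) ∈ D) :
    Function.Surjective (mfderiv 𝓘(ℝ, ℝ × ℝ) 𝓘(ℝ, E2) (fun x : ℝ × ℝ => proj (Λ x)) (t, 0)) ↔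
      symplecticForm (Λ (t, 0)) (v (Λ (t, 0))) (IsFan.jacobi Λ t) ≠ 0 := by
  set ν := Λ (t, 0) with hν
  have hνs := mem_extChartAt_source (I := ICoT) ν
  have hyN := IsHamDomain.mem_chart ν hνs hN
  have h1 : (dChart ICoT ν ν (v ν)).1 = 0 := by
    rw [← chartField_apply hνs]; exact hv.chartField_fst hyN
  have h2 : (dChart ICoT ν ν (v ν)).2 ≠ 0 := fun h0 => by
    refine hv.chartField_ne_zero hyN ?_
    rw [chartField_apply hνs]
    exact Prod.ext h1 h0
  have h3 : (dChart ICoT ν ν (v ν)).2 (dChart ICoT ν ν (P.hVec ν)).1 = 0 := by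
    rw [← omega_of_fst_eq_zero h1, ← symplecticForm_apply_chart hνs, hVec,
      symplecticForm_hamField (hD.mdifferentiableAt htD)]
    exact (hv.2.1 ν hN).2.1
  rw [symplecticForm_apply_chart hνs, omega_of_fst_eq_zero h1,
    ← forall_exists_smul_add_smul_iff h2 (dChart_hVec_fst_ne_zero hreg hD hνs htD) h3]
  have key : ∀ a b : ℝ, dChart 𝓘(ℝ, E2) ν.1 ν.1
      (mfderiv 𝓘(ℝ, ℝ × ℝ) 𝓘(ℝ, E2) (fun x : ℝ × ℝ => proj (Λ x)) (t, 0) ((a, b) : ℝ × ℝ)) =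
      a • (dChart ICoT ν ν (P.hVec ν)).1 + b • (dChart ICoT ν ν (IsFan.jacobi Λ t)).1 := by
    intro a b
    have h5 : dChart ICoT ν ν (a • P.hVec ν + b • IsFan.jacobi Λ t) =
        a • dChart ICoT ν ν (P.hVec ν) + b • dChart ICoT ν ν (IsFan.jacobi Λ t) := by
      rw [ContinuousLinearMap.map_add, ContinuousLinearMap.map_smul, ContinuousLinearMap.map_smul]
    have h6 := dChart_dproj hνs (a • P.hVec ν + b • IsFan.jacobi Λ t)
    rw [h5] at h6
    refine Eq.trans (congrArg (dChart 𝓘(ℝ, E2) ν.1 ν.1) (hΛ.mfderiv_proj_apply ht a b)) ?_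
    exact h6
  have hs1 := mem_extChartAt_source (I := 𝓘(ℝ, E2)) ν.1
  constructor
  · intro h w
    obtain ⟨w', hw'⟩ := dChart_surjective hs1 w
    obtain ⟨⟨a, b⟩, hab⟩ := h w'
    refine ⟨a, b, ?_⟩
    rw [← key, ← hw']
    exact congrArg (dChart 𝓘(ℝ, E2) ν.1 ν.1) hab
  · intro h w
    obtain ⟨a, b, hab⟩ := h (dChart 𝓘(ℝ, E2) ν.1 ν.1 w)
    refine ⟨((a, b) : ℝ × ℝ), dChart_injective hs1 ?_⟩
    rw [← key] at hab
    exact hab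

end ControlProblem

/-! ### The Jacobi equation along an extremal. -/

namespace ControlProblem

variable {M U : Type*} [TopologicalSpace M] [ChartedSpace E2 M] [IsManifold 𝓘(ℝ, E2) ∞ M]
  [TopologicalSpace U] [ChartedSpace ℝ U] [IsManifold 𝓘(ℝ, ℝ) ∞ U] {P : ControlProblem M U}
  {D : Set (CoT M)} {e : ℝ} {l : ℝ → CoT M}

theorem abs_symplecticForm_eq {ν : CoT M} {a b : TangentSpace ICoT ν} (h : a = b ∨ a = -b)
    (w : TangentSpace ICoT ν) : |symplecticForm ν a w| = |symplecticForm ν b w| := by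
  rcases h with rfl | rfl
  · rfl
  · have hνs := mem_extChartAt_source (I := ICoT) ν
    have h1 : dChart ICoT ν ν (-b) = -dChart ICoT ν ν b := ContinuousLinearMap.map_neg _ _
    rw [symplecticForm_apply_chart hνs, symplecticForm_apply_chart hνs, h1, map_neg, neg_apply,
      abs_neg]

/-- Source of the minus sign in `y'' = -κ y`: the curvature is defined by `[h, [v, h]]`, whereas
differentiating twice produces `[h, [h, v]]`. -/
theorem lieBracket_lieBracket_swap {V : Type*} [NormedAddCommGroup V] [NormedSpace ℝ V]
    (X v : V → V) (y : V) :
    VectorField.lieBracket ℝ X (VectorField.lieBracket ℝ X v) y =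
      -VectorField.lieBracket ℝ X (VectorField.lieBracket ℝ v X) y := by
  have h : VectorField.lieBracket ℝ X v = -VectorField.lieBracket ℝ v X := by
    ext1 z
    simp [VectorField.lieBracket]
  rw [h]
  simp only [VectorField.lieBracket, fderiv_neg, Pi.neg_apply, map_neg, neg_apply]
  abel

/-- For a vertical field `v` and a vertical vector `j` tangent to the level, `σ([h, v], j)` is the
second derivative of the Hamiltonian. -/
theorem omega_lieBracket_vertical {H : PhaseSpace → ℝ} {X v : PhaseSpace → PhaseSpace}
    {y : PhaseSpace} (hH : DifferentiableAt ℝ (fderiv ℝ H) y) (hXd : DifferentiableAt ℝ X y)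
    (hX : ∀ᶠ z in 𝓝 y, ∀ w, omega w (X z) = fderiv ℝ H z w) (hvd : DifferentiableAt ℝ v y)
    (hv : ∀ᶠ z in 𝓝 y, (v z).1 = 0) {j : PhaseSpace} (hj : j.1 = 0) :
    omega (VectorField.lieBracket ℝ X v y) j = fderiv ℝ (fderiv ℝ H) y (v y) j := by
  have h1 : (fderiv ℝ v y (X y)).1 = 0 := by
    have e1 := (ContinuousLinearMap.fst ℝ E2 (E2 →L[ℝ] ℝ)).hasFDerivAt.comp _ hvd.hasFDerivAt
    have e2 : (fun z => (v z).1) =ᶠ[𝓝 y] fun _ => (0 : E2) := hv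
    exact DFunLike.congr_fun ((e1.congr_of_eventuallyEq e2.symm).unique
      (hasFDerivAt_const (0 : E2) _)) (X y)
  rw [VectorField.lieBracket, map_sub, sub_apply, omega_of_fst_eq_zero h1, hj, map_zero, zero_sub,
    omega_swap, neg_neg, omega_fderiv_of_hamiltonian hH hXd hX]

/-- The symplectic product of the natural vertical field and the Jacobi field satisfies the Jacobi
equation. -/
theorem IsFan.isAbsJacobi (hreg : P.IsRegular) (hD : P.IsHamDomain D) (hle : P.level e ⊆ D)
    (hl : ∀ t, 0 ≤ t → l t ∈ P.level e) {κ : ℝ → ℝ} {N : ℝ → Set (CoT M)}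
    {v : ℝ → ∀ μ : CoT M, TangentSpace ICoT μ} (hN : ∀ t, 0 ≤ t → IsOpen (N t) ∧ l t ∈ N t)
    (hv : ∀ t, 0 ≤ t → P.IsNaturalField e (N t) (v t))
    (hκ : ∀ t, 0 ≤ t → VectorField.mlieBracket ICoT P.hVec
      (VectorField.mlieBracket ICoT (v t) P.hVec) (l t) = κ t • v t (l t))
    {T δ : ℝ} {Λ : ℝ × ℝ → CoT M} (hΛ : P.IsFan e l T δ Λ) :
    IsAbsJacobi (fun τ => |symplecticForm (Λ (τ, 0)) (v τ (Λ (τ, 0))) (jacobi Λ τ)|) κ T := by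
  intro t ht
  set μ := l t with hμ
  have hμs := mem_extChartAt_source (I := ICoT) μ
  have hμD : μ ∈ D := hle (hl t ht.1)
  have hct : Λ (t, 0) = μ := hΛ.central t ht
  obtain ⟨hNo, hμN⟩ := hN t ht.1
  have hvt := hv t ht.1
  have hNDo : IsOpen (N t ∩ D) := hNo.inter hD.isOpen
  set N' := (N t ∩ D) ∩ (extChartAt ICoT μ).source with hN'
  have hN'o : IsOpen N' := hNDo.inter (isOpen_extChartAt_source μ)
  set O := Ioo (-δ) (T + δ) ×ˢ Ioo (-δ) δ ∩ Λ ⁻¹' N' with hOdef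
  have hO : IsOpen O := hΛ.isOpen_domain hN'o
  have htO : ((t, 0) : ℝ × ℝ) ∈ O :=
    ⟨hΛ.mem_domain ht, by rw [mem_preimage, hct]; exact ⟨⟨hμN, hμD⟩, hμs⟩⟩
  set G : ℝ × ℝ → PhaseSpace := fun x => extChartAt ICoT μ (Λ x) with hGdef
  have hG : ContDiffOn ℝ 1 G O := hΛ.contDiffOn_chart inter_subset_right
  set Q := (extChartAt ICoT μ).target ∩ (extChartAt ICoT μ).symm ⁻¹' (N t ∩ D) with hQdef
  have hQ : IsOpen Q := isOpen_extChartAt_target_inter_preimage (I := ICoT) μ hNDo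
  have hQD : ∀ z ∈ Q, z ∈ (extChartAt ICoT μ).target ∩ (extChartAt ICoT μ).symm ⁻¹' D :=
    fun z hz => ⟨hz.1, hz.2.2⟩
  have hQN : ∀ z ∈ Q, z ∈ (extChartAt ICoT μ).target ∩ (extChartAt ICoT μ).symm ⁻¹' (N t) :=
    fun z hz => ⟨hz.1, hz.2.1⟩
  have hGQ : ∀ x ∈ O, G x ∈ Q := fun x hx => IsHamDomain.mem_chart μ hx.2.2 hx.2.1
  set X := chartField μ P.hVec with hXdef
  set w := chartField μ (v t) with hwdef
  set H := chartFun μ P.ham with hHdef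
  have hHs : ∀ z ∈ Q, ContDiffAt ℝ ∞ H z := fun z hz => hD.contDiffAt_chartFun (hQD z hz)
  have hXs : ∀ z ∈ Q, ContDiffAt ℝ ∞ X z := fun z hz => hD.contDiffAt_chartField_hVec (hQD z hz)
  have hX : ∀ z ∈ Q, ∀ a, omega a (X z) = fderiv ℝ H z a := fun z hz =>
    hD.omega_chartField_hVec (hQD z hz)
  have hws : ∀ z ∈ Q, ContDiffAt ℝ ∞ w z := fun z hz => hvt.contDiffAt_chartField hNo (hQN z hz)
  have hode : ∀ x ∈ O, HasDerivAt (fun τ => G (τ, x.2)) (X (G x)) x.1 := fun x hx =>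
    hΛ.hasDerivAt_chart hx.1 hx.2.2
  have hvar : ∀ (Y : PhaseSpace → PhaseSpace), (∀ z ∈ Q, ContDiffAt ℝ ∞ Y z) → ∀ τ,
      ((τ, 0) : ℝ × ℝ) ∈ O → HasDerivAt (fun τ => omega (Y (G (τ, 0))) (fderiv ℝ G (τ, 0) (0, 1)))
        (omega (VectorField.lieBracket ℝ X Y (G (τ, 0))) (fderiv ℝ G (τ, 0) (0, 1))) τ :=
    fun Y hY τ hτ => hasDerivAt_omega_variation omega_swap hO hG hQ hHs hXs hX hGQ hode hτ
      ((hY _ (hGQ _ hτ)).differentiableAt (by simp))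
  have hnear : ∀ᶠ τ in 𝓝[Icc 0 T] t, ((τ, 0) : ℝ × ℝ) ∈ O := by
    have hc : ContinuousAt (fun τ : ℝ => ((τ, 0) : ℝ × ℝ)) t := by fun_prop
    exact mem_nhdsWithin_of_mem_nhds (hc (hO.mem_nhds htO))
  have hyτ : ∀ τ, ((τ, 0) : ℝ × ℝ) ∈ O → omega (w (G (τ, 0))) (fderiv ℝ G (τ, 0) (0, 1)) =
      symplecticForm (Λ (τ, 0)) (v t (Λ (τ, 0))) (jacobi Λ τ) := by
    intro τ hτ
    rw [symplecticForm_apply_chart hτ.2.2, ← chartField_apply hτ.2.2 (v t),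
      hΛ.fderiv_chart hτ.1 hτ.2.2]
    rfl
  have hyG : G (t, 0) = extChartAt ICoT μ μ := congrArg (extChartAt ICoT μ) hct
  refine ⟨fun τ => omega (w (G (τ, 0))) (fderiv ℝ G (τ, 0) (0, 1)),
    fun τ => omega (VectorField.lieBracket ℝ X w (G (τ, 0))) (fderiv ℝ G (τ, 0) (0, 1)),
    ?_, ?_, ?_⟩
  · filter_upwards [hnear, self_mem_nhdsWithin] with τ hτ hτT
    refine ⟨?_, (hvar w hws τ hτ).hasDerivWithinAt⟩
    rw [hyτ τ hτ]
    have hlτ : Λ (τ, 0) = l τ := hΛ.central τ hτT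
    have hτe : Λ (τ, 0) ∈ P.level e := hlτ ▸ hl τ hτT.1
    -- The field selected at time `τ` and the field `v t` used near `t` agree up to sign at `l τ`,
    -- so the absolute values coincide.
    exact abs_symplecticForm_eq (IsNaturalField.eq_or_eq_neg hreg hD (hN τ hτT.1).1 (hv τ hτT.1)
      hNo hvt (hlτ ▸ (hN τ hτT.1).2) hτ.2.1.1 (hle hτe) hτe) _
  · have h1 := hvar (VectorField.lieBracket ℝ X w)
      (fun z hz => (hXs z hz).lieBracket (hws z hz)) t htO
    refine (h1.congr_deriv ?_).hasDerivWithinAt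
    have h2 : VectorField.lieBracket ℝ X (VectorField.lieBracket ℝ w X) (G (t, 0)) =
        κ t • w (G (t, 0)) := by
      rw [hyG, hwdef, hXdef, ← chartField_mlieBracket_mlieBracket hNDo
        (hvt.1.mono inter_subset_left) (hD.contMDiffOn_hVec.mono inter_subset_right)
        (IsHamDomain.mem_chart μ hμs ⟨hμN, hμD⟩), chartField_apply hμs, chartField_apply hμs,
        hκ t ht.1]
      exact ContinuousLinearMap.map_smul _ _ _
    rw [lieBracket_lieBracket_swap, h2, map_neg, map_smul, neg_apply, smul_apply, smul_eq_mul,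
      neg_mul]
  · rintro rfl
    have hq := hGQ _ htO
    have hct' : Λ (0, 0) ∈ (extChartAt ICoT μ).source := htO.2.2
    obtain ⟨h1, h2, h3⟩ := hΛ.initial_variation ht.2 hct' (hD.mdifferentiableAt htO.2.1.2)
    set j : PhaseSpace := dChart ICoT μ (Λ (0, 0)) (jacobi Λ 0) with hj
    have hjG : fderiv ℝ G (0, 0) (0, 1) = j := hΛ.fderiv_chart htO.1 hct' (0, 1)
    have hw1 : (w (G (0, 0))).1 = 0 := hvt.chartField_fst (hQN _ hq)
    have hw0 : w (G (0, 0)) ≠ 0 := hvt.chartField_ne_zero (hQN _ hq)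
    have hξ : (w (G (0, 0))).2 ≠ 0 := fun h => hw0 (Prod.ext hw1 h)
    have hwX : (w (G (0, 0))).2 (X (G (0, 0))).1 = 0 := by
      rw [← omega_of_fst_eq_zero hw1, hX _ hq]
      exact hvt.fderiv_chartFun hD hq
    have hjX : j.2 (X (G (0, 0))).1 = 0 := by
      rw [← omega_of_fst_eq_zero h1, hX _ hq]
      exact h2
    have hX0 : (X (G (0, 0))).1 ≠ 0 := by
      have := dChart_hVec_fst_ne_zero hreg hD hct' htO.2.1.2
      rw [← chartField_apply hct'] at this
      exact this
    constructor
    · change omega (w (G (0, 0))) (fderiv ℝ G (0, 0) (0, 1)) = 0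
      rw [hjG, omega_of_fst_eq_zero hw1, h1, map_zero]
    · change omega (VectorField.lieBracket ℝ X w (G (0, 0))) (fderiv ℝ G (0, 0) (0, 1)) ≠ 0
      rw [hjG, omega_lieBracket_vertical
        (((hHs _ hq).fderiv_right (m := ∞) (by simp)).differentiableAt (by simp))
        ((hXs _ hq).differentiableAt (by simp)) (Filter.mem_of_superset (hQ.mem_nhds hq) hX)
        ((hws _ hq).differentiableAt (by simp)) (Filter.mem_of_superset (hQ.mem_nhds hq)
          fun z hz => hvt.chartField_fst (hQN z hz)) h1]
      -- At time `0` the Jacobi field is a nonzero multiple of `v`, so `y'(0)` is a nonzero multiple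
      -- of `D²h(v, v) > 0`.
      obtain ⟨r, hr⟩ := exists_smul_of_apply_eq_zero hX0 hξ hwX hjX
      have hjr : j = r • w (G (0, 0)) := Prod.ext (by rw [h1, Prod.smul_fst, hw1, smul_zero]) hr
      have hr0 : r ≠ 0 := by
        rintro rfl
        exact h3 (by rw [hjr, zero_smul])
      rw [hjr, map_smul, smul_eq_mul]
      refine mul_ne_zero hr0 (ne_of_gt ?_)
      have hww : w (G (0, 0)) = (0, (w (G (0, 0))).2) := Prod.ext hw1 rfl
      rw [hww, hyG]
      rw [hyG] at hξ hwX
      exact fderiv_fderiv_chartFun_pos hreg hD hμD hξ hwX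

end ControlProblem

/-! ### Conjugate times -/

namespace ControlProblem

variable {M U : Type*} [TopologicalSpace M] [ChartedSpace E2 M] [IsManifold 𝓘(ℝ, E2) ∞ M]
  [TopologicalSpace U] [ChartedSpace ℝ U] [IsManifold 𝓘(ℝ, ℝ) ∞ U] {P : ControlProblem M U}
  {D : Set (CoT M)} {e : ℝ} {l : ℝ → CoT M}

/-- A regular parametrization, in the chart at `μ`, of the part of the level in the fibre. -/
theorem exists_fibre_curve (hreg : P.IsRegular) (hD : P.IsHamDomain D) {μ : CoT M} (hμ : μ ∈ D) :
    ∃ η > 0, ∃ α : ℝ → PhaseSpace, α 0 = extChartAt ICoT μ μ ∧ ContDiffOn ℝ 1 α (Ioo (-η) η) ∧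
      deriv α 0 ≠ 0 ∧ ∀ ε ∈ Ioo (-η) η,
        α ε ∈ (extChartAt ICoT μ).target ∩ (extChartAt ICoT μ).symm ⁻¹' D ∧
        (α ε).1 = (extChartAt ICoT μ μ).1 ∧ chartFun μ P.ham (α ε) = P.ham μ := by
  have hμs := mem_extChartAt_source (I := ICoT) μ
  set y₀ := extChartAt ICoT μ μ with hy₀
  set Q := (extChartAt ICoT μ).target ∩ (extChartAt ICoT μ).symm ⁻¹' D with hQdef
  have hQ : IsOpen Q := isOpen_extChartAt_target_inter_preimage (I := ICoT) μ hD.isOpen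
  have hyQ : y₀ ∈ Q := IsHamDomain.mem_chart μ hμs hμ
  set X := chartField μ P.hVec with hXdef
  -- This field is vertical and tangent to the levels of the Hamiltonian, so its integral curve
  -- through `y₀` stays in the fibre and in the level.
  set Y : PhaseSpace → PhaseSpace := fun y => (0, rotCovector (X y).1) with hYdef
  have hYs : ContDiffAt ℝ ∞ Y y₀ := contDiffAt_const.prodMk
    (rotCovector.contDiff.contDiffAt.comp y₀
      (contDiffAt_fst.comp y₀ (hD.contDiffAt_chartField_hVec hyQ)))
  obtain ⟨η, hη, r, hr, Φ, hΦs, hΦ⟩ :=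
    exists_contDiffOn_local_flow (hYs.of_le (WithTop.coe_le_coe.2 le_top))
  obtain ⟨hα0, hαd⟩ := hΦ y₀ (Metric.mem_ball_self hr)
  set α : ℝ → PhaseSpace := fun ε => Φ (ε, y₀) with hα
  replace hα0 : α 0 = y₀ := hα0
  replace hαd : ∀ t ∈ Ioo (-η) η, HasDerivAt α (Y (α t)) t := hαd
  have hαs : ContDiffOn ℝ 1 α (Ioo (-η) η) :=
    hΦs.comp (contDiff_id.prodMk contDiff_const).contDiffOn fun ε hε =>
      ⟨hε, Metric.mem_ball_self hr⟩
  have h0η : (0 : ℝ) ∈ Ioo (-η) η := by simpa using hη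
  have hαc : ContinuousAt α 0 := (hαd 0 h0η).continuousAt
  have hev : α ⁻¹' Q ∈ 𝓝 (0 : ℝ) := hαc (hQ.mem_nhds (by rw [hα0]; exact hyQ))
  obtain ⟨η', hη', hball⟩ := Metric.mem_nhds_iff.1 hev
  set ρ := min η η' with hρ
  have hρ0 : 0 < ρ := lt_min hη hη'
  have hρη : Ioo (-ρ) ρ ⊆ Ioo (-η) η := Ioo_subset_Ioo (neg_le_neg (min_le_left _ _))
    (min_le_left _ _)
  have hρQ : ∀ ε ∈ Ioo (-ρ) ρ, α ε ∈ Q := fun ε hε => hball (by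
    rw [Metric.mem_ball, Real.dist_eq, sub_zero, abs_lt]
    exact ⟨(neg_le_neg (min_le_right _ _)).trans_lt hε.1, hε.2.trans_le (min_le_right _ _)⟩)
  have h0ρ : (0 : ℝ) ∈ Ioo (-ρ) ρ := by simpa using hρ0
  have hconst : ∀ {F : Type} [NormedAddCommGroup F] [NormedSpace ℝ F] (f : ℝ → F),
      (∀ ε ∈ Ioo (-ρ) ρ, HasDerivAt f 0 ε) → ∀ ε ∈ Ioo (-ρ) ρ, f ε = f 0 := by
    intro F _ _ f hf ε hε
    exact isOpen_Ioo.is_const_of_deriv_eq_zero isPreconnected_Ioo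
      (fun x hx => (hf x hx).differentiableAt.differentiableWithinAt)
      (fun x hx => (hf x hx).deriv) hε h0ρ
  refine ⟨ρ, hρ0, α, hα0, hαs.mono hρη, ?_, fun ε hε => ⟨hρQ ε hε, ?_, ?_⟩⟩
  · rw [(hαd 0 h0η).deriv, hα0]
    intro h
    have hX0 := dChart_hVec_fst_ne_zero hreg hD hμs hμ
    rw [← chartField_apply hμs] at hX0
    exact rotCovector_ne_zero hX0 (congrArg Prod.snd h)
  · rw [← hα0]
    refine hconst (fun ε => (α ε).1) (fun ε hε => ?_) ε hε
    exact (ContinuousLinearMap.fst ℝ E2 (E2 →L[ℝ] ℝ)).hasFDerivAt.comp_hasDerivAt ε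
      (hαd ε (hρη hε))
  · have h1 := hconst (fun ε => chartFun μ P.ham (α ε)) (fun ε hε => ?_) ε hε
    · rw [h1, hα0, chartFun, (extChartAt ICoT μ).left_inv hμs]
    · have hq := hρQ ε hε
      have h2 := ((hD.contDiffAt_chartFun hq).differentiableAt
        (by simp)).hasFDerivAt.comp_hasDerivAt ε (hαd ε (hρη hε))
      refine h2.congr_deriv ?_
      change fderiv ℝ (chartFun μ P.ham) (α ε) (Y (α ε)) = 0
      rw [← hD.omega_chartField_hVec hq, omega_of_fst_eq_zero rfl]
      exact rotCovector_self _

theorem exists_isFan (hreg : P.IsRegular) (hD : P.IsHamDomain D) (hle : P.level e ⊆ D)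
    (hl : P.IsExtremal e l) {T : ℝ} (hT : 0 ≤ T) : ∃ δ Λ, P.IsFan e l T δ Λ := by
  have hμe := hl.2 0 le_rfl
  set μ := l 0 with hμ
  have hμs := mem_extChartAt_source (I := ICoT) μ
  obtain ⟨η, hη, α, hα0, hαs, hαd, hα⟩ := exists_fibre_curve hreg hD (hle hμe)
  have h0η : (0 : ℝ) ∈ Ioo (-η) η := by simpa using hη
  set c : ℝ → CoT M := fun ε => (extChartAt ICoT μ).symm (α ε) with hc
  have hcs : ContMDiffOn 𝓘(ℝ, ℝ) ICoT 1 c (Ioo (-η) η) := fun ε hε =>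
    ((contMDiffAt_extChartAt_symm (hα ε hε).1.1).of_le (by simp)).comp_contMDiffWithinAt ε
      (contMDiffOn_iff_contDiffOn.2 hαs ε hε)
  have hc0 : c 0 = l 0 := by
    rw [hc]
    simp only [hα0]
    exact (extChartAt ICoT μ).left_inv hμs
  obtain ⟨δ, hδ, Λ, hΛ⟩ := exists_isCurveFamily hD.isOpen hD.contMDiffOn_hVec hl.1
    (fun t ht => hle (hl.2 t ht)) hη hcs hc0 hT
  set ρ := min δ η with hρ
  have hρ0 : 0 < ρ := lt_min hδ hη
  have hρδ : Ioo (-ρ) ρ ⊆ Ioo (-δ) δ := Ioo_subset_Ioo (neg_le_neg (min_le_left _ _))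
    (min_le_left _ _)
  have hρη : Ioo (-ρ) ρ ⊆ Ioo (-η) η := Ioo_subset_Ioo (neg_le_neg (min_le_right _ _))
    (min_le_right _ _)
  have hρT : Ioo (-ρ) (T + ρ) ⊆ Ioo (-δ) (T + δ) := Ioo_subset_Ioo (neg_le_neg (min_le_left _ _))
    (by linarith [min_le_left δ η])
  refine ⟨ρ, Λ, hρ0, hΛ.contMDiffOn.mono (prod_mono hρT hρδ), fun ε hε => ⟨?_, ?_,
    (hΛ.integral ε (hρδ hε)).mono hρT⟩, hΛ.central, ?_⟩
  · obtain ⟨h1, -, h3⟩ := hα ε (hρη hε)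
    rw [hΛ.initial ε (hρδ hε)]
    refine P.mem_level_of_ham_eq (hD.attained _ h1.2) ?_
    exact h3.trans (P.ham_eq_of_mem_level hμe)
  · obtain ⟨h1, h2, -⟩ := hα ε (hρη hε)
    rw [hΛ.initial ε (hρδ hε)]
    refine cot_fst_eq_of_extChartAt_fst_eq ((extChartAt ICoT μ).map_target h1.1) ?_
    rw [hc, (extChartAt ICoT μ).right_inv h1.1, h2]
  · intro h0
    have hev : (fun ε : ℝ => Λ (0, ε)) =ᶠ[𝓝 0] c := by
      filter_upwards [Ioo_mem_nhds (neg_lt_zero.2 hδ) hδ] with ε hε using hΛ.initial ε hε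
    rw [hev.mfderiv_eq] at h0
    have hcm : MDifferentiableAt 𝓘(ℝ, ℝ) ICoT c 0 :=
      ((hcs 0 h0η).contMDiffAt (Ioo_mem_nhds h0η.1 h0η.2)).mdifferentiableAt one_ne_zero
    have hcs0 : c 0 ∈ (extChartAt ICoT μ).source := by rw [hc0]; exact hμs
    have h1 := mfderiv_comp_apply (0 : ℝ) (mdifferentiableAt_extChartAt_of_mem hcs0) hcm (1 : ℝ)
    rw [mfderiv_eq_fderiv] at h1
    have h2 : (mfderiv 𝓘(ℝ, ℝ) ICoT c 0 (1 : ℝ) : PhaseSpace) = 0 := DFunLike.congr_fun h0 (1 : ℝ)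
    have h3 : deriv (fun ε => extChartAt ICoT μ (c ε)) 0 =
        dChart ICoT μ (c 0) (mfderiv 𝓘(ℝ, ℝ) ICoT c 0 (1 : ℝ)) := h1
    have h4 : dChart ICoT μ (c 0) (mfderiv 𝓘(ℝ, ℝ) ICoT c 0 (1 : ℝ)) = 0 := by
      refine (congrArg (dChart ICoT μ (c 0)) h2).trans ?_
      exact ContinuousLinearMap.map_zero _
    have h5 : (fun ε => extChartAt ICoT μ (c ε)) =ᶠ[𝓝 0] α := by
      filter_upwards [Ioo_mem_nhds h0η.1 h0η.2] with ε hε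
      exact (extChartAt ICoT μ).right_inv (hα ε hε).1.1
    rw [h4, h5.deriv_eq] at h3
    exact hαd h3

/-- A function on `[0, ∞)`, which satisfies the Jacobi equation up to sign, and whose zeros are the
critical times of a fan. -/
theorem exists_abs_jacobi_function (hreg : P.IsRegular) (hD : P.IsHamDomain D)
    (hle : P.level e ⊆ D) (hl : P.IsExtremal e l)
    (hcurv : ∀ t, 0 ≤ t → ∃ k, P.IsCurvatureAt e (l t) k) {T δ : ℝ} {Λ : ℝ × ℝ → CoT M}
    (hΛ : P.IsFan e l T δ Λ) :
    ∃ u : ℝ → ℝ, IsAbsJacobi u (fun t => P.curvature e (l t)) T ∧ ∀ t ∈ Icc 0 T,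
      (¬ Function.Surjective
        (mfderiv 𝓘(ℝ, ℝ × ℝ) 𝓘(ℝ, E2) (fun x : ℝ × ℝ => proj (Λ x)) (t, 0)) ↔ u t = 0) := by
  have hk : ∀ t : ℝ, ∃ (N : Set (CoT M)) (v : ∀ μ : CoT M, TangentSpace ICoT μ), 0 ≤ t →
      IsOpen N ∧ l t ∈ N ∧ P.IsNaturalField e N v ∧ VectorField.mlieBracket ICoT P.hVec
        (VectorField.mlieBracket ICoT v P.hVec) (l t) = P.curvature e (l t) • v (l t) := by
    intro t
    by_cases ht : 0 ≤ t
    · obtain ⟨N, hN, htN, v, hv, hb⟩ : P.IsCurvatureAt e (l t) (P.curvature e (l t)) :=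
        Classical.epsilon_spec (hcurv t ht)
      exact ⟨N, v, fun _ => ⟨hN, htN, hv, hb⟩⟩
    · exact ⟨∅, fun _ => 0, fun h => absurd h ht⟩
  choose N v hNv using hk
  refine ⟨_, hΛ.isAbsJacobi hreg hD hle hl.2 (N := N) (v := v)
    (fun t ht => ⟨(hNv t ht).1, (hNv t ht).2.1⟩) (fun t ht => (hNv t ht).2.2.1)
    (fun t ht => (hNv t ht).2.2.2), fun t ht => ?_⟩
  have hct : Λ (t, 0) = l t := hΛ.central t ht
  have h1 := hΛ.surjective_iff hreg hD ht (hNv t ht.1).2.2.1 (hct ▸ (hNv t ht.1).2.1)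
    (hct ▸ hle (hl.2 t ht.1))
  rw [h1, not_not, abs_eq_zero]

theorem not_isConjugateTime (hreg : P.IsRegular) (hD : P.IsHamDomain D) (hle : P.level e ⊆ D)
    (hl : P.IsExtremal e l) (hcurv : ∀ t, 0 ≤ t → ∃ k, P.IsCurvatureAt e (l t) k) {t r : ℝ}
    (hr : 0 < r) (htr : t * r ≤ Real.pi) (hκ : ∀ τ, 0 ≤ τ → P.curvature e (l τ) < r ^ 2) :
    ¬ P.IsConjugateTime e l t := by
  intro h
  obtain ⟨ht, δ, Λ, hΛ, hns⟩ := isConjugateTime_iff.1 h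
  obtain ⟨u, hu, huz⟩ := exists_abs_jacobi_function hreg hD hle hl hcurv hΛ
  exact hu.ne_zero_of_lt hr ht htr (fun τ hτ => hκ τ hτ.1) ((huz t ⟨ht.le, le_rfl⟩).1 hns)

theorem exists_isConjugateTime (hreg : P.IsRegular) (hD : P.IsHamDomain D) (hle : P.level e ⊆ D)
    (hl : P.IsExtremal e l) (hcurv : ∀ t, 0 ≤ t → ∃ k, P.IsCurvatureAt e (l t) k) {T r : ℝ}
    (hr : 0 < r) (hT : 0 < T) (hrT : r * T = Real.pi) :
    ((∀ τ, 0 ≤ τ → r ^ 2 ≤ P.curvature e (l τ)) → ∃ t ∈ Ioc 0 T, P.IsConjugateTime e l t) ∧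
    ((∀ τ, 0 ≤ τ → r ^ 2 < P.curvature e (l τ)) → ∃ t ∈ Ioo 0 T, P.IsConjugateTime e l t) := by
  obtain ⟨δ, Λ, hΛ⟩ := exists_isFan hreg hD hle hl hT.le
  obtain ⟨u, hu, huz⟩ := exists_abs_jacobi_function hreg hD hle hl hcurv hΛ
  have key : ∀ t ∈ Ioc 0 T, u t = 0 → P.IsConjugateTime e l t := fun t ht h0 =>
    isConjugateTime_iff.2 ⟨ht.1, δ, Λ, hΛ.restrict ht.2, (huz t ⟨ht.1.le, ht.2⟩).2 h0⟩
  constructor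
  · intro hκ
    obtain ⟨t, ht, h0⟩ := hu.exists_zero_of_le hr hT hrT fun τ hτ => hκ τ hτ.1
    exact ⟨t, ht, key t ht h0⟩
  · intro hκ
    obtain ⟨t, ht, h0⟩ := hu.exists_zero_of_lt hr hT hrT fun τ hτ => hκ τ hτ.1
    exact ⟨t, ht, key t ⟨ht.1, ht.2.le⟩ h0⟩

end ControlProblem

theorem theorem2 {M U : Type*} [TopologicalSpace M] [T2Space M] [ChartedSpace E2 M]
    [IsManifold 𝓘(ℝ, E2) ∞ M] [TopologicalSpace U] [ChartedSpace ℝ U]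
    [IsManifold 𝓘(ℝ, ℝ) ∞ U]
    (P : ControlProblem M U) (hreg : P.IsRegular)
    (e : ℝ) (hsmooth : P.HamSmoothNear e)
    (l : ℝ → CoT M) (hl : P.IsExtremal e l)
    -- the cost is a constant `c` (time-optimal problem) with `e + c > 0`, or, for any other cost,
    -- the commutator relation that defines the curvature holds along the extremal
    (hcurv : (∃ c : ℝ, (∀ q u, P.cost q u = c) ∧ 0 < e + c) ∨
      ∀ t, 0 ≤ t → ∃ k, P.IsCurvatureAt e (l t) k) :
    ((∀ t, 0 ≤ t → P.curvature e (l t) ≤ 0) →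
      ∀ t, 0 ≤ t → ¬ P.IsConjugateTime e l t) ∧
    (∀ κ₁ : ℝ, 0 < κ₁ →
      ((∀ t, 0 ≤ t → P.curvature e (l t) ≤ κ₁) →
        ∀ t ∈ Set.Ico 0 (Real.pi / √κ₁), ¬ P.IsConjugateTime e l t) ∧
      ((∀ t, 0 ≤ t → P.curvature e (l t) < κ₁) →
        ∀ t ∈ Set.Icc 0 (Real.pi / √κ₁), ¬ P.IsConjugateTime e l t)) ∧
    (∀ κ₀ : ℝ, 0 < κ₀ →
      ((∀ t, 0 ≤ t → κ₀ ≤ P.curvature e (l t)) →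
        ∃ t ∈ Set.Ioc 0 (Real.pi / √κ₀), P.IsConjugateTime e l t) ∧
      ((∀ t, 0 ≤ t → κ₀ < P.curvature e (l t)) →
        ∃ t ∈ Set.Ioo 0 (Real.pi / √κ₀), P.IsConjugateTime e l t)) := by
  obtain ⟨D, hDo, hle, hatt, hsm⟩ := hsmooth
  have hD : P.IsHamDomain D := ⟨hDo, hatt, hsm⟩
  have hk : ∀ t, 0 ≤ t → ∃ k, P.IsCurvatureAt e (l t) k := by
    rcases hcurv with ⟨c, hc, hec⟩ | h
    · exact fun t ht => ControlProblem.exists_isCurvatureAt_of_timeOptimal hreg hD hc hec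
        (hle (hl.2 t ht)) (hl.2 t ht)
    · exact h
  -- Weak curvature bounds become strict by comparing with `sin (π τ / t)`, whose first positive
  -- zero is `t` itself. This covers `κ ≤ 0` at every time and `κ ≤ κ₁` at times below `π / √κ₁`.
  have hweak : ∀ κ t : ℝ, 0 < t → κ < (Real.pi / t) ^ 2 →
      (∀ τ, 0 ≤ τ → P.curvature e (l τ) ≤ κ) → ¬ P.IsConjugateTime e l t := by
    intro κ t ht hκt hκ
    refine ControlProblem.not_isConjugateTime hreg hD hle hl hk (r := Real.pi / t)
      (div_pos Real.pi_pos ht) ?_ fun τ hτ => (hκ τ hτ).trans_lt hκt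
    rw [mul_div_cancel₀ _ ht.ne']
  refine ⟨fun hκ t _ hconj => ?_, fun κ₁ hκ₁ => ⟨fun hκ t ht hconj => ?_, fun hκ t ht => ?_⟩,
    fun κ₀ hκ₀ => ?_⟩
  · have ht : 0 < t := hconj.1
    exact hweak 0 t ht (by have := Real.pi_pos; positivity) hκ hconj
  · have ht0 : 0 < t := hconj.1
    refine hweak κ₁ t ht0 ?_ hκ hconj
    have hs : 0 < √κ₁ := Real.sqrt_pos.2 hκ₁
    have h1 : √κ₁ < Real.pi / t := by
      rw [lt_div_iff₀ ht0, mul_comm]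
      exact (lt_div_iff₀ hs).1 ht.2
    calc κ₁ = √κ₁ ^ 2 := (Real.sq_sqrt hκ₁.le).symm
      _ < (Real.pi / t) ^ 2 := by gcongr
  · have hs : 0 < √κ₁ := Real.sqrt_pos.2 hκ₁
    refine ControlProblem.not_isConjugateTime hreg hD hle hl hk hs ((le_div_iff₀ hs).1 ht.2)
      fun τ hτ => ?_
    rw [Real.sq_sqrt hκ₁.le]
    exact hκ τ hτ
  · have hs : 0 < √κ₀ := Real.sqrt_pos.2 hκ₀
    have h := ControlProblem.exists_isConjugateTime hreg hD hle hl hk hs (div_pos Real.pi_pos hs)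
      (mul_div_cancel₀ _ hs.ne')
    rw [Real.sq_sqrt hκ₀.le] at h
    exact h
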